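/- Let $T_1$ and $T_2$ be rooted trees on the same set of $n$ leaves in which every internal node has at least two children, and whose nodes carry real weights such that every child is heavier than its parent. The nodes of each tree are numbered arbitrarily as $0, 1, 2, \dots$ without gaps. A node $u_1$ of $T_1$ and a node $u_2$ of $T_2$ are *induced together* if some leaf is a descendant of both; every node counts as an ancestor and as a descendant of itself. A pair of *heaviest induced ancestors* of a node $v_1$ of $T_1$ and a node $v_2$ of $T_2$ is an ancestor $u_1$ of $v_1$ and an ancestor $u_2$ of $v_2$ that are induced together and have maximum combined weight among all such pairs. Then $T_1$ and $T_2$ can be stored in $O(n \log^2 n)$ space such that, given (the numbers of) a node $v_1$ of $T_1$ and a node $v_2$ of $T_2$, a pair of their heaviest induced ancestors can be found in $O(\log n \log\log n)$ time in the worst case. The model is the word RAM: space is the number of memory cells, each of which holds either a machine word or the weight of one node; weights can be added and compared in constant time and not manipulated otherwise. There are one query program, independent of the trees and of $n$, and a function $L(n) = O(\log n)$ such that the claim holds for every word length of at least $L(n)$ bits, with bounds that depend on $n$ only. A query leaves the stored structure unchanged. -/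

import Mathlib

open Filter Asymptotics

namespace HIA

/-! ### Weighted trees on a common set of leaves -/

/-- A rooted tree with node set `V`, given by its parent map. The root is, by convention, its own
parent; every node reaches the root by iterating the parent map. -/
structure RootedTree (V : Type) where
  root : V
  parent : V → V
  parent_root : parent root = root
  reaches_root : ∀ v, ∃ k : ℕ, parent^[k] v = root

namespace RootedTree

variable {V : Type}

/-- `c` is a child of `p`. -/
def IsChild (T : RootedTree V) (c p : V) : Prop := c ≠ T.root ∧ T.parent c = p

/-- `u` is an ancestor of `v` (equivalently, `v` is a descendant of `u`).
Every node is an ancestor and a descendant of itself. -/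
def IsAncestor (T : RootedTree V) (u v : V) : Prop := ∃ k : ℕ, T.parent^[k] v = u

/-- A leaf is a node without children. -/
def IsLeaf (T : RootedTree V) (v : V) : Prop := ∀ c, ¬ T.IsChild c v

end RootedTree

/-- A rooted tree with `m` nodes, numbered `0, …, m - 1` in an arbitrary way, whose leaves are
identified with the elements of the `n`-element set `Fin n`, in which every internal node has at
least two children, with real node weights such that children are heavier than their parents. -/
structure WeightedTree (n m : ℕ) extends RootedTree (Fin m) where
  leaf : Fin n → Fin m
  leaf_injective : Function.Injective leaf
  isLeaf_iff : ∀ v, toRootedTree.IsLeaf v ↔ ∃ x, leaf x = v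
  two_children : ∀ v, ¬ toRootedTree.IsLeaf v →
    ∃ c c', c ≠ c' ∧ toRootedTree.IsChild c v ∧ toRootedTree.IsChild c' v
  weight : Fin m → ℝ
  weight_lt : ∀ c p, toRootedTree.IsChild c p → weight p < weight c

section

variable {n m₁ m₂ : ℕ}

/-- A node of the first tree and a node of the second tree are induced together if they have a
common leaf descendant. -/
def Induced (T₁ : WeightedTree n m₁) (T₂ : WeightedTree n m₂)
    (u₁ : Fin m₁) (u₂ : Fin m₂) : Prop :=
  ∃ x : Fin n, T₁.IsAncestor u₁ (T₁.leaf x) ∧ T₂.IsAncestor u₂ (T₂.leaf x)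

/-- `(u₁, u₂)` is a pair of heaviest induced ancestors of `(v₁, v₂)`. -/
structure IsHeaviestInducedAncestors (T₁ : WeightedTree n m₁) (T₂ : WeightedTree n m₂)
    (v₁ : Fin m₁) (v₂ : Fin m₂) (u₁ : Fin m₁) (u₂ : Fin m₂) : Prop where
  ancestor₁ : T₁.IsAncestor u₁ v₁
  ancestor₂ : T₂.IsAncestor u₂ v₂
  induced : Induced T₁ T₂ u₁ u₂
  heaviest : ∀ u₁' u₂', T₁.IsAncestor u₁' v₁ → T₂.IsAncestor u₂' v₂ → Induced T₁ T₂ u₁' u₂' →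
    T₁.weight u₁' + T₂.weight u₂' ≤ T₁.weight u₁ + T₂.weight u₂

end

/-! ### The machine: a word RAM that can add and compare weights -/

/-- The arithmetic and bitwise operations on words. -/
inductive WordOp where
  | add | sub | mul | div | mod | and | or | xor | shiftLeft | shiftRight

/-- Operations on `w`-bit words (unsigned, modulo `2 ^ w`). -/
def WordOp.eval {w : ℕ} : WordOp → BitVec w → BitVec w → BitVec w
  | .add, x, y => x + y
  | .sub, x, y => x - y
  | .mul, x, y => x * y
  | .div, x, y => x / y
  | .mod, x, y => x % y
  | .and, x, y => x &&& y
  | .or, x, y => x ||| y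
  | .xor, x, y => x ^^^ y
  | .shiftLeft, x, y => x <<< y
  | .shiftRight, x, y => x >>> y

/-- Tests: comparisons of two word registers or of two weight registers. -/
inductive Test where
  | wordEq (a b : ℕ)
  | wordLt (a b : ℕ)
  | weightLt (a b : ℕ)

/-- Programs. The numbers `d`, `s`, `a`, `b` name registers, so that a program uses only finitely
many of them. There are word registers and weight registers; a weight can only be loaded, copied,
added to another weight and compared with another weight. -/
inductive Prog where
  | skip
  /-- word register `d` := the literal `k` -/
  | const (d k : ℕ)
  | copy (d s : ℕ)
  | op (o : WordOp) (d a b : ℕ)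
  /-- word register `d` := the memory cell whose address is in word register `a` -/
  | load (d a : ℕ)
  /-- the memory cell whose address is in word register `a` := word register `s` -/
  | store (a s : ℕ)
  /-- weight register `d` := the stored weight whose address is in word register `a` -/
  | loadWeight (d a : ℕ)
  | copyWeight (d s : ℕ)
  | addWeight (d a b : ℕ)
  | seq (p q : Prog)
  | cond (t : Test) (p q : Prog)
  | loop (t : Test) (p : Prog)

/-- The contents of the memory: `numWords` cells that hold `w`-bit words and `numWeights` cells that
hold weights. The values of `word` and `weight` at larger addresses play no role, as
a program has no access to them. -/
structure Storage (w : ℕ) where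
  numWords : ℕ
  word : ℕ → BitVec w
  numWeights : ℕ
  weight : ℕ → ℝ

/-- The space, in memory cells. -/
def Storage.size {w : ℕ} (D : Storage w) : ℕ := D.numWords + D.numWeights

/-- Every weight cell holds the weight of a node of one of the two trees. -/
def Storage.WeightsFrom {w n m₁ m₂ : ℕ} (D : Storage w)
    (T₁ : WeightedTree n m₁) (T₂ : WeightedTree n m₂) : Prop :=
  ∀ i < D.numWeights, (∃ v, D.weight i = T₁.weight v) ∨ (∃ v, D.weight i = T₂.weight v)

/-- A machine state: word registers, weight registers, memory. -/
structure State (w : ℕ) where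
  reg : ℕ → BitVec w
  wreg : ℕ → ℝ
  mem : Storage w

namespace State

variable {w : ℕ}

def setReg (s : State w) (d : ℕ) (x : BitVec w) : State w :=
  { s with reg := Function.update s.reg d x }

def setWreg (s : State w) (d : ℕ) (x : ℝ) : State w :=
  { s with wreg := Function.update s.wreg d x }

def setMem (s : State w) (i : ℕ) (x : BitVec w) : State w :=
  { s with mem := { s.mem with word := Function.update s.mem.word i x } }

/-- The initial state of a query: memory `D`, word registers `0` and `1` hold the words `x` and `y`,
all other registers are zero. -/
def init (D : Storage w) (x y : BitVec w) : State w where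
  reg := fun i => if i = 0 then x else if i = 1 then y else 0
  wreg := fun _ => 0
  mem := D

end State

/-- The truth value of a test in a state. -/
def Test.Holds {w : ℕ} : Test → State w → Prop
  | .wordEq a b, s => s.reg a = s.reg b
  | .wordLt a b, s => (s.reg a).toNat < (s.reg b).toNat
  | .weightLt a b, s => s.wreg a < s.wreg b

/-- `Exec p s t s'`: started in state `s`, the program `p` halts after `t` steps in state `s'`. Every
basic instruction and every evaluation of a test takes one step. Accessing a memory
cell outside the memory is a failure: no execution of the program exists then. -/
inductive Exec {w : ℕ} : Prog → State w → ℕ → State w → Prop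
  | skip (s : State w) : Exec .skip s 1 s
  | const (s : State w) (d k : ℕ) : Exec (.const d k) s 1 (s.setReg d (BitVec.ofNat w k))
  | copy (s : State w) (d a : ℕ) : Exec (.copy d a) s 1 (s.setReg d (s.reg a))
  | op (s : State w) (o : WordOp) (d a b : ℕ) :
      Exec (.op o d a b) s 1 (s.setReg d (o.eval (s.reg a) (s.reg b)))
  | load (s : State w) (d a : ℕ) (h : (s.reg a).toNat < s.mem.numWords) :
      Exec (.load d a) s 1 (s.setReg d (s.mem.word (s.reg a).toNat))
  | store (s : State w) (a b : ℕ) (h : (s.reg a).toNat < s.mem.numWords) :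
      Exec (.store a b) s 1 (s.setMem (s.reg a).toNat (s.reg b))
  | loadWeight (s : State w) (d a : ℕ) (h : (s.reg a).toNat < s.mem.numWeights) :
      Exec (.loadWeight d a) s 1 (s.setWreg d (s.mem.weight (s.reg a).toNat))
  | copyWeight (s : State w) (d a : ℕ) : Exec (.copyWeight d a) s 1 (s.setWreg d (s.wreg a))
  | addWeight (s : State w) (d a b : ℕ) :
      Exec (.addWeight d a b) s 1 (s.setWreg d (s.wreg a + s.wreg b))
  | seq {p q : Prog} {s s' s'' : State w} {t t' : ℕ} (hp : Exec p s t s') (hq : Exec q s' t' s'') :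
      Exec (.seq p q) s (t + t') s''
  | cond_true {b : Test} {p q : Prog} {s s' : State w} {t : ℕ} (hb : b.Holds s)
      (hp : Exec p s t s') : Exec (.cond b p q) s (1 + t) s'
  | cond_false {b : Test} {p q : Prog} {s s' : State w} {t : ℕ} (hb : ¬ b.Holds s)
      (hq : Exec q s t s') : Exec (.cond b p q) s (1 + t) s'
  | loop_done {b : Test} {p : Prog} {s : State w} (hb : ¬ b.Holds s) : Exec (.loop b p) s 1 s
  | loop_step {b : Test} {p : Prog} {s s' s'' : State w} {t t' : ℕ} (hb : b.Holds s)
      (hp : Exec p s t s') (hl : Exec (.loop b p) s' t' s'') :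
      Exec (.loop b p) s (1 + t + t') s''

/-- With memory `D`, the program `p` answers every heaviest-induced-ancestors query on `T₁`, `T₂` in
at most `t` steps: given the numbers of a node of `T₁` and of a node of `T₂` in word registers
`0` and `1`, it leaves there the numbers of a pair of their heaviest induced ancestors. At the end
the memory is the same as at the beginning, so that queries can be repeated. -/
def AnswersQueries {w n m₁ m₂ : ℕ} (p : Prog) (D : Storage w)
    (T₁ : WeightedTree n m₁) (T₂ : WeightedTree n m₂) (t : ℕ) : Prop :=
  ∀ (v₁ : Fin m₁) (v₂ : Fin m₂), ∃ (k : ℕ) (s : State w) (u₁ : Fin m₁) (u₂ : Fin m₂),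
    Exec p (State.init D (BitVec.ofNat w v₁) (BitVec.ofNat w v₂)) k s ∧ k ≤ t ∧
    (s.reg 0).toNat = u₁ ∧ (s.reg 1).toNat = u₂ ∧
    IsHeaviestInducedAncestors T₁ T₂ v₁ v₂ u₁ u₂ ∧ s.mem = D

end HIA

/-! Both trees are cut into heavy paths. A light child has at most half of the leaves of its parent,
so the ancestors of a node lie on at most `Nat.log 2 n + 1` heavy paths, its levels. On level `i`
the deepest ancestor of `v` is its exit `ex v i`; an ancestor of that level that is also above a
leaf `x` is above both `ex v i` and `exl x i`. Hence for fixed levels `i` and `j` of the two query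
nodes (a cell) it suffices to maximize, over the leaves below the tops of both paths, the sum of two
minima in `leafWeight`.

The leaves of each tree are ordered depth first with the heavy child last. Then the leaves below a
node of a heavy path form a final segment of the block of leaves below the top of the path, and
exits move down the path as ranks grow. In a cell three kinds of candidates suffice
(`cellDone_of_candidates`). For the leaves below the first exit, the first node can be that exit,
and the last such leaf in the order of the second tree is best; it is tabulated. The same holds with
the sides exchanged. After discarding the leaves dominated by the second candidate, the leaves that
remain have exits above those of the query on both sides. Their values do not depend on the query,
so their maximum is a range maximum.

For every level of one tree, the leaves of each block are listed in the order of the other tree. The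
lists of one level have `n` entries at most, and a query node occupies a gap in each list. The
lemmas `exists_group_table`, `exists_start_table`, `exists_best_table` and `exists_cross_table` show
that what a query needs depends only on a gap and two levels. So a bounded number of tables with
`O(n)` entries for each pair of levels is enough, which gives the space bound.

The time has three sources. The gaps are found by a binary search in the first list and then by
short searches between samples; the logarithms of the lengths of these searches telescope
(`log_slack_add_potential_le`). A cell is dominated by its diagonal successor if that has a leaf
(`CellDone.of_succ`), and the cells with a leaf form a staircase, so only the `O(log n)` cells on
its boundary are visited (`WalkState.runs_step`). A range maximum takes `O(log log n)` steps: that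
many levels of a heap, followed by a sparse table over blocks long enough to make it linear in size.

The program is written in a small language with a weakest precondition calculus (`Cmd.runs`); loops
are handled by invariants that carry the remaining time (`Runs.whileLt`). -/

namespace HIA

open HIA.RootedTree

/-! ### Ancestors in rooted trees -/

namespace RootedTree

variable {V : Type} (T : RootedTree V)

theorem IsAncestor.refl (v : V) : T.IsAncestor v v := ⟨0, rfl⟩

variable {T}

theorem IsAncestor.trans {u v x : V} (h : T.IsAncestor u v) (h' : T.IsAncestor v x) :
    T.IsAncestor u x := by
  obtain ⟨k, rfl⟩ := h
  obtain ⟨l, rfl⟩ := h'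
  exact ⟨k + l, Function.iterate_add_apply _ _ _ _⟩

theorem isAncestor_root (v : V) : T.IsAncestor T.root v := T.reaches_root v

theorem isAncestor_parent (v : V) : T.IsAncestor (T.parent v) v := ⟨1, rfl⟩

theorem IsChild.isAncestor {c p : V} (h : T.IsChild c p) : T.IsAncestor p c :=
  h.2 ▸ isAncestor_parent c

theorem isChild_parent {v : V} (h : v ≠ T.root) : T.IsChild v (T.parent v) := ⟨h, rfl⟩

@[elab_as_elim]
theorem induction_on {P : V → Prop} (v : V) (root : P T.root)
    (step : ∀ c p, T.IsChild c p → P p → P c) : P v := by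
  obtain ⟨k, hk⟩ := T.reaches_root v
  induction k generalizing v with
  | zero => exact (show v = T.root from hk) ▸ root
  | succ k ih =>
    by_cases h : v = T.root
    · exact h ▸ root
    · exact step v _ (isChild_parent h) (ih _ hk)

theorem IsAncestor.total {u u' v : V} (h : T.IsAncestor u v) (h' : T.IsAncestor u' v) :
    T.IsAncestor u u' ∨ T.IsAncestor u' u := by
  obtain ⟨k, rfl⟩ := h
  obtain ⟨l, rfl⟩ := h'
  rcases le_total k l with hkl | hkl
  · obtain ⟨d, rfl⟩ := Nat.exists_eq_add_of_le' hkl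
    exact Or.inr ⟨d, (Function.iterate_add_apply _ _ _ _).symm⟩
  · obtain ⟨d, rfl⟩ := Nat.exists_eq_add_of_le' hkl
    exact Or.inl ⟨d, (Function.iterate_add_apply _ _ _ _).symm⟩

theorem IsAncestor.of_child {u c p : V} (hc : T.IsChild c p) (h : T.IsAncestor u c) :
    u = c ∨ T.IsAncestor u p := by
  obtain ⟨k, hk⟩ := h
  cases k with
  | zero => exact Or.inl hk.symm
  | succ k => exact Or.inr ⟨k, by rw [← hc.2]; exact hk⟩

theorem isAncestor_child_iff {u c p : V} (hc : T.IsChild c p) :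
    T.IsAncestor u c ↔ u = c ∨ T.IsAncestor u p :=
  ⟨fun h => h.of_child hc, fun h => h.elim (fun h => h ▸ IsAncestor.refl T _)
    fun h => h.trans hc.isAncestor⟩

theorem IsAncestor.exists_child {p v : V} (h : T.IsAncestor p v) :
    v = p ∨ ∃ c, T.IsChild c p ∧ T.IsAncestor c v := by
  obtain ⟨k, hk⟩ := h
  induction k generalizing v with
  | zero => exact Or.inl hk
  | succ k ih =>
    by_cases hv : v = T.root
    · subst hv
      refine Or.inl ?_
      rw [← hk, Function.iterate_fixed T.parent_root]
    · rcases ih (v := T.parent v) hk with h | ⟨c, hc, hcv⟩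
      · exact Or.inr ⟨v, ⟨hv, h⟩, IsAncestor.refl T v⟩
      · exact Or.inr ⟨c, hc, hcv.trans (isAncestor_parent v)⟩

end RootedTree

open HIA.RootedTree

namespace WeightedTree

variable {n m : ℕ} (T : WeightedTree n m)

/-- Weights act as a strict rank function on root paths; antisymmetry of ancestry and the comparison
of nodes on one root path are drawn from this. -/
theorem weight_lt_of_isAncestor {u v : Fin m} (h : T.IsAncestor u v) (hne : u ≠ v) :
    T.weight u < T.weight v := by
  induction v using RootedTree.induction_on (T := T.toRootedTree) with
  | root =>
    obtain ⟨k, hk⟩ := h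
    rw [Function.iterate_fixed T.parent_root] at hk
    exact absurd hk.symm hne
  | step c p hc ih =>
    rcases h.of_child hc with h | h
    · exact absurd h hne
    · by_cases hp : u = p
      · exact hp ▸ T.weight_lt _ _ hc
      · exact (ih h hp).trans (T.weight_lt _ _ hc)

theorem weight_le_of_isAncestor {u v : Fin m} (h : T.IsAncestor u v) :
    T.weight u ≤ T.weight v := by
  by_cases hne : u = v
  · exact hne ▸ le_rfl
  · exact (T.weight_lt_of_isAncestor h hne).le

theorem isAncestor_antisymm {u v : Fin m} (h : T.IsAncestor u v) (h' : T.IsAncestor v u) :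
    u = v := by
  by_contra hne
  exact lt_asymm (T.weight_lt_of_isAncestor h hne) (T.weight_lt_of_isAncestor h' (Ne.symm hne))

theorem isAncestor_of_weight_le {u u' v : Fin m} (h : T.IsAncestor u v) (h' : T.IsAncestor u' v)
    (hw : T.weight u ≤ T.weight u') : T.IsAncestor u u' := by
  rcases h.total h' with h1 | h1
  · exact h1
  · by_cases hne : u' = u
    · exact hne ▸ IsAncestor.refl _ _
    · exact absurd (T.weight_lt_of_isAncestor h1 hne) (not_lt.mpr hw)

theorem child_unique {c c' p v : Fin m} (hc : T.IsChild c p) (hc' : T.IsChild c' p)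
    (h : T.IsAncestor c v) (h' : T.IsAncestor c' v) : c = c' := by
  rcases h.total h' with h1 | h1
  · rcases h1.of_child hc' with h2 | h2
    · exact h2
    · exact absurd (T.weight_le_of_isAncestor h2) (not_le.mpr (T.weight_lt _ _ hc))
  · rcases h1.of_child hc with h2 | h2
    · exact h2.symm
    · exact absurd (T.weight_le_of_isAncestor h2) (not_le.mpr (T.weight_lt _ _ hc'))

theorem isLeaf_leaf (x : Fin n) : T.IsLeaf (T.leaf x) := (T.isLeaf_iff _).mpr ⟨x, rfl⟩

theorem eq_of_isLeaf {u v : Fin m} (hu : T.IsLeaf u) (h : T.IsAncestor u v) : v = u := by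
  rcases h.exists_child with h | ⟨c, hc, -⟩
  · exact h
  · exact absurd hc (hu c)

/-- A heaviest descendant of `u` has no child. -/
theorem exists_leaf_below (u : Fin m) : ∃ x, T.IsAncestor u (T.leaf x) := by
  classical
  obtain ⟨v, hv, hmax⟩ := (Finset.univ.filter (fun v => T.IsAncestor u v)).exists_max_image T.weight
    ⟨u, by simpa using IsAncestor.refl _ u⟩
  simp only [Finset.mem_filter, Finset.mem_univ, true_and] at hv hmax
  by_cases hl : T.IsLeaf v
  · obtain ⟨x, rfl⟩ := (T.isLeaf_iff v).mp hl
    exact ⟨x, hv⟩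
  · obtain ⟨c, -, -, hc, -⟩ := T.two_children v hl
    exact absurd (hmax c (hv.trans hc.isAncestor)) (not_le.mpr (T.weight_lt _ _ hc))

open Classical in
/-- The leaves below a node. -/
noncomputable def below (u : Fin m) : Finset (Fin n) :=
  Finset.univ.filter fun x => T.IsAncestor u (T.leaf x)

/-- The number of leaves below a node. -/
noncomputable def sz (u : Fin m) : ℕ := (T.below u).card

variable {T}

@[simp] theorem mem_below {u : Fin m} {x : Fin n} :
    x ∈ T.below u ↔ T.IsAncestor u (T.leaf x) := by simp [below]

variable (T)

theorem sz_pos (u : Fin m) : 0 < T.sz u := by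
  obtain ⟨x, hx⟩ := T.exists_leaf_below u
  exact Finset.card_pos.mpr ⟨x, mem_below.mpr hx⟩

theorem sz_le (u : Fin m) : T.sz u ≤ n := by
  simpa [sz] using Finset.card_le_univ (T.below u)

theorem sz_root : T.sz T.root = n := by
  have : T.below T.root = Finset.univ := by
    ext x; simp [isAncestor_root]
  simp [sz, this]

theorem n_pos {n m : ℕ} (T : WeightedTree n m) : 0 < n := T.sz_root ▸ T.sz_pos T.root

theorem sz_leaf (x : Fin n) : T.sz (T.leaf x) = 1 := by
  refine Finset.card_eq_one.mpr ⟨x, ?_⟩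
  ext y
  rw [mem_below, Finset.mem_singleton]
  refine ⟨fun h => T.leaf_injective (T.eq_of_isLeaf (T.isLeaf_leaf x) h), ?_⟩
  rintro rfl
  exact IsAncestor.refl _ _

open Classical in
/-- The children of a node. -/
noncomputable def children (u : Fin m) : Finset (Fin m) :=
  Finset.univ.filter fun c => T.IsChild c u

variable {T}

@[simp] theorem mem_children {c u : Fin m} : c ∈ T.children u ↔ T.IsChild c u := by
  simp [children]

variable (T)

theorem disjoint_below {c c' p : Fin m} (hc : T.IsChild c p) (hc' : T.IsChild c' p) (hne : c ≠ c') :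
    Disjoint (T.below c) (T.below c') := by
  rw [Finset.disjoint_left]
  intro x hx hx'
  exact hne (T.child_unique hc hc' (mem_below.mp hx) (mem_below.mp hx'))

theorem card_biUnion_below (p : Fin m) (s : Finset (Fin m)) (hs : s ⊆ T.children p) :
    (s.biUnion T.below).card = ∑ c ∈ s, T.sz c :=
  Finset.card_biUnion fun _ hc _ hc' hne =>
    T.disjoint_below (mem_children.mp (hs hc)) (mem_children.mp (hs hc')) hne

theorem sum_sz_le (p : Fin m) (s : Finset (Fin m)) (hs : s ⊆ T.children p) :
    ∑ c ∈ s, T.sz c ≤ T.sz p := by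
  rw [← T.card_biUnion_below p s hs]
  refine Finset.card_le_card fun x hx => ?_
  obtain ⟨c, hc, hx⟩ := Finset.mem_biUnion.mp hx
  exact mem_below.mpr ((mem_children.mp (hs hc)).isAncestor.trans (mem_below.mp hx))

theorem sum_sz_children {p : Fin m} (hp : ¬ T.IsLeaf p) :
    ∑ c ∈ T.children p, T.sz c = T.sz p := by
  rw [← T.card_biUnion_below p _ (Finset.Subset.refl _)]
  refine congrArg Finset.card (Finset.ext fun x => ?_)
  rw [Finset.mem_biUnion, mem_below]
  constructor
  · rintro ⟨c, hc, hx⟩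
    exact (mem_children.mp hc).isAncestor.trans (mem_below.mp hx)
  · intro hx
    rcases hx.exists_child with h | ⟨c, hc, hcx⟩
    · exact absurd (h ▸ T.isLeaf_leaf x) hp
    · exact ⟨c, mem_children.mpr hc, mem_below.mpr hcx⟩

/-- Count the pairs of a child and its parent: there are `m - 1` of them, and each of the `m - n`
internal nodes accounts for at least two. -/
theorem card_nodes_le {n m : ℕ} (T : WeightedTree n m) : m ≤ 2 * n := by
  classical
  have h1 : (Finset.univ.filter fun v => v ≠ T.root).card
      = ∑ p : Fin m, (T.children p).card := by
    rw [Finset.card_eq_sum_card_fiberwise (f := T.parent) (t := Finset.univ)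
      (fun _ _ => Finset.mem_coe.mpr (Finset.mem_univ _))]
    refine Finset.sum_congr rfl fun p _ => congrArg Finset.card (Finset.ext fun c => ?_)
    simp [IsChild]
  have h2 : (Finset.univ.filter fun v => v ≠ T.root).card + 1 = m := by
    rw [Finset.filter_ne', Finset.card_erase_of_mem (Finset.mem_univ _), Finset.card_univ,
      Fintype.card_fin]
    have := T.root.pos
    omega
  have h3 : ∑ p : Fin m, (if T.IsLeaf p then 0 else 2) ≤ ∑ p : Fin m, (T.children p).card := by
    refine Finset.sum_le_sum fun p _ => ?_
    split_ifs with hp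
    · exact Nat.zero_le _
    · obtain ⟨c, c', hne, hc, hc'⟩ := T.two_children p hp
      rw [← Finset.card_pair hne]
      refine Finset.card_le_card ?_
      intro x hx
      rcases Finset.mem_insert.mp hx with rfl | hx
      · exact mem_children.mpr hc
      · exact (Finset.mem_singleton.mp hx) ▸ mem_children.mpr hc'
  have h4 : (Finset.univ.filter fun p => T.IsLeaf p).card = n := by
    have : (Finset.univ.filter fun p => T.IsLeaf p) = Finset.univ.image T.leaf := by
      ext p; simp [T.isLeaf_iff]
    rw [this, Finset.card_image_of_injective _ T.leaf_injective, Finset.card_univ, Fintype.card_fin]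
  have h5 : (Finset.univ.filter fun p => T.IsLeaf p).card
      + (Finset.univ.filter fun p => ¬ T.IsLeaf p).card = m := by
    rw [Finset.card_filter_add_card_filter_not, Finset.card_univ, Fintype.card_fin]
  have h6 : ∑ p : Fin m, (if T.IsLeaf p then 0 else 2)
      = (Finset.univ.filter fun p => ¬ T.IsLeaf p).card * 2 := by
    rw [← smul_eq_mul, ← Finset.sum_const, Finset.sum_filter]
    refine Finset.sum_congr rfl fun p _ => ?_
    split_ifs <;> simp_all
  omega

/-! ### Heavy paths -/

open Classical in
/-- The heavy child of an internal node; a leaf is its own heavy child. -/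
noncomputable def hv (u : Fin m) : Fin m :=
  if h : (T.children u).Nonempty then ((T.children u).exists_max_image T.sz h).choose else u

theorem nonempty_children {u : Fin m} (hu : ¬ T.IsLeaf u) : (T.children u).Nonempty := by
  obtain ⟨c, -, -, hc, -⟩ := T.two_children u hu
  exact ⟨c, mem_children.mpr hc⟩

theorem isChild_hv {u : Fin m} (hu : ¬ T.IsLeaf u) : T.IsChild (T.hv u) u := by
  rw [hv, dif_pos (T.nonempty_children hu)]
  exact mem_children.mp ((T.children u).exists_max_image T.sz (T.nonempty_children hu)).choose_spec.1

theorem sz_le_sz_hv {c u : Fin m} (hc : T.IsChild c u) : T.sz c ≤ T.sz (T.hv u) := by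
  have h : (T.children u).Nonempty := ⟨c, mem_children.mpr hc⟩
  rw [hv, dif_pos h]
  exact ((T.children u).exists_max_image T.sz h).choose_spec.2 c (mem_children.mpr hc)

theorem not_isLeaf_of_isChild {c p : Fin m} (hc : T.IsChild c p) : ¬ T.IsLeaf p := fun h => h c hc

theorem isAncestor_hv (u : Fin m) : T.IsAncestor u (T.hv u) := by
  by_cases hu : T.IsLeaf u
  · have : ¬ (T.children u).Nonempty := fun ⟨c, hc⟩ => hu c (mem_children.mp hc)
    rw [hv, dif_neg this]
    exact IsAncestor.refl _ _
  · exact (T.isChild_hv hu).isAncestor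

/-- A node is light if it is neither the root nor the heavy child of its parent. -/
def Light (u : Fin m) : Prop := u ≠ T.root ∧ u ≠ T.hv (T.parent u)

/-- The heavy sibling of a light child has at least as many leaves, and the two sets of leaves are
disjoint. -/
theorem two_mul_sz_le {c p : Fin m} (hc : T.IsChild c p) (hl : T.Light c) :
    2 * T.sz c ≤ T.sz p := by
  have h1 := T.isChild_hv (T.not_isLeaf_of_isChild hc)
  have hne : c ≠ T.hv p := hc.2 ▸ hl.2
  have h2 := T.sum_sz_le p {c, T.hv p} (by
    intro x hx
    rcases Finset.mem_insert.mp hx with rfl | hx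
    · exact mem_children.mpr hc
    · exact (Finset.mem_singleton.mp hx) ▸ mem_children.mpr h1)
  rw [Finset.sum_pair hne] at h2
  have := T.sz_le_sz_hv hc
  omega

open Classical in
/-- The number of light ancestors. -/
noncomputable def ld (v : Fin m) : ℕ :=
  (Finset.univ.filter fun u => T.IsAncestor u v ∧ T.Light u).card

theorem ld_root : T.ld T.root = 0 := by
  classical
  refine Finset.card_eq_zero.mpr (Finset.filter_eq_empty_iff.mpr ?_)
  rintro u - ⟨h, hl⟩
  exact hl.1 (T.isAncestor_antisymm h (isAncestor_root u))

open Classical in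
theorem ld_child {c p : Fin m} (hc : T.IsChild c p) :
    T.ld c = T.ld p + if T.Light c then 1 else 0 := by
  have hcp : ¬ T.IsAncestor c p := fun h =>
    absurd (T.weight_le_of_isAncestor h) (not_le.mpr (T.weight_lt _ _ hc))
  unfold ld
  split_ifs with hl
  · rw [← Finset.card_insert_of_notMem (a := c) (by simp [hcp])]
    refine congrArg Finset.card (Finset.ext fun u => ?_)
    simp only [Finset.mem_filter, Finset.mem_univ, true_and, Finset.mem_insert,
      isAncestor_child_iff hc]
    constructor
    · rintro ⟨h | h, h'⟩
      · exact Or.inl h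
      · exact Or.inr ⟨h, h'⟩
    · rintro (rfl | ⟨h, h'⟩)
      · exact ⟨Or.inl rfl, hl⟩
      · exact ⟨Or.inr h, h'⟩
  · rw [add_zero]
    refine congrArg Finset.card (Finset.ext fun u => ?_)
    simp only [Finset.mem_filter, Finset.mem_univ, true_and, isAncestor_child_iff hc]
    constructor
    · rintro ⟨rfl | h, h'⟩
      · exact absurd h' hl
      · exact ⟨h, h'⟩
    · rintro ⟨h, h'⟩
      exact ⟨Or.inr h, h'⟩

theorem ld_mono {u v : Fin m} (h : T.IsAncestor u v) : T.ld u ≤ T.ld v := by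
  classical
  refine Finset.card_le_card fun x hx => ?_
  simp only [Finset.mem_filter, Finset.mem_univ, true_and] at hx ⊢
  exact ⟨hx.1.trans h, hx.2⟩

/-- On the way down `sz` never grows, and it at least halves whenever `ld` increases. -/
theorem two_pow_ld_mul_sz_le (v : Fin m) : 2 ^ T.ld v * T.sz v ≤ n := by
  classical
  induction v using RootedTree.induction_on (T := T.toRootedTree) with
  | root => simp [ld_root, sz_root]
  | step c p hc ih =>
    rw [T.ld_child hc]
    have h1 : T.sz c ≤ T.sz p := by
      simpa using T.sum_sz_le p {c} (by simpa using hc)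
    split_ifs with hl
    · have h2 := T.two_mul_sz_le hc hl
      calc 2 ^ (T.ld p + 1) * T.sz c = 2 ^ T.ld p * (2 * T.sz c) := by ring
        _ ≤ 2 ^ T.ld p * T.sz p := Nat.mul_le_mul_left _ h2
        _ ≤ n := ih
    · exact (Nat.mul_le_mul_left _ h1).trans ih

theorem ld_le_log (v : Fin m) : T.ld v ≤ Nat.log 2 n := by
  refine Nat.le_log_of_pow_le (by norm_num) ((Nat.le_mul_of_pos_right _ (T.sz_pos v)).trans
    (T.two_pow_ld_mul_sz_le v))

/-- `ld` is `0` at the root and grows by at most one per edge, so no level is skipped. -/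
theorem exists_ancestor_ld {v : Fin m} {i : ℕ} (hi : i ≤ T.ld v) :
    ∃ u, T.IsAncestor u v ∧ T.ld u = i := by
  classical
  induction v using RootedTree.induction_on (T := T.toRootedTree) with
  | root => exact ⟨T.root, IsAncestor.refl _ _, by rw [ld_root] at *; omega⟩
  | step c p hc ih =>
    by_cases h : i ≤ T.ld p
    · obtain ⟨u, hu, hui⟩ := ih h
      exact ⟨u, hu.trans hc.isAncestor, hui⟩
    · refine ⟨c, IsAncestor.refl _ _, ?_⟩
      have := T.ld_child hc
      split_ifs at this <;> omega

open Classical in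
/-- The ancestors of `v` on its heavy path of level `i`. -/
noncomputable def level (v : Fin m) (i : ℕ) : Finset (Fin m) :=
  Finset.univ.filter fun u => T.IsAncestor u v ∧ T.ld u = i

open Classical in
/-- The deepest ancestor of `v` on the heavy path of level `i`. -/
noncomputable def ex (v : Fin m) (i : ℕ) : Fin m :=
  if h : (T.level v i).Nonempty then ((T.level v i).exists_max_image T.weight h).choose else v

open Classical in
/-- The top of the heavy path of level `i` above `v`. -/
noncomputable def top (v : Fin m) (i : ℕ) : Fin m :=
  if h : (T.level v i).Nonempty then ((T.level v i).exists_min_image T.weight h).choose else v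

variable {T}

theorem mem_level {u v : Fin m} {i : ℕ} : u ∈ T.level v i ↔ T.IsAncestor u v ∧ T.ld u = i := by
  simp [level]

theorem level_nonempty {v : Fin m} {i : ℕ} (hi : i ≤ T.ld v) : (T.level v i).Nonempty := by
  obtain ⟨u, hu⟩ := T.exists_ancestor_ld hi
  exact ⟨u, mem_level.mpr hu⟩

theorem ex_mem {v : Fin m} {i : ℕ} (hi : i ≤ T.ld v) :
    T.IsAncestor (T.ex v i) v ∧ T.ld (T.ex v i) = i := by
  rw [ex, dif_pos (level_nonempty hi)]
  exact mem_level.mp ((T.level v i).exists_max_image T.weight (level_nonempty hi)).choose_spec.1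

theorem top_mem {v : Fin m} {i : ℕ} (hi : i ≤ T.ld v) :
    T.IsAncestor (T.top v i) v ∧ T.ld (T.top v i) = i := by
  rw [top, dif_pos (level_nonempty hi)]
  exact mem_level.mp ((T.level v i).exists_min_image T.weight (level_nonempty hi)).choose_spec.1

theorem isAncestor_ex {u v : Fin m} (hu : T.IsAncestor u v) : T.IsAncestor u (T.ex v (T.ld u)) := by
  have hi := T.ld_mono hu
  refine T.isAncestor_of_weight_le hu (ex_mem hi).1 ?_
  rw [ex, dif_pos (level_nonempty hi)]
  exact ((T.level v _).exists_max_image T.weight (level_nonempty hi)).choose_spec.2 u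
    (mem_level.mpr ⟨hu, rfl⟩)

theorem top_isAncestor {u v : Fin m} (hu : T.IsAncestor u v) :
    T.IsAncestor (T.top v (T.ld u)) u := by
  have hi := T.ld_mono hu
  refine T.isAncestor_of_weight_le (top_mem hi).1 hu ?_
  rw [top, dif_pos (level_nonempty hi)]
  exact ((T.level v _).exists_min_image T.weight (level_nonempty hi)).choose_spec.2 u
    (mem_level.mpr ⟨hu, rfl⟩)

theorem top_isAncestor_ex {v : Fin m} {i : ℕ} (hi : i ≤ T.ld v) :
    T.IsAncestor (T.top v i) (T.ex v i) := by
  have := isAncestor_ex (top_mem hi).1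
  rwa [(top_mem hi).2] at this

/-- Both are ancestors of `v`, hence comparable, and `ld` is monotone along root paths. -/
theorem ex_isAncestor_top_succ {v : Fin m} {i j : ℕ} (hij : i < j) (hj : j ≤ T.ld v) :
    T.IsAncestor (T.ex v i) (T.top v j) := by
  have h1 := ex_mem (T := T) (v := v) (i := i) (by omega)
  have h2 := top_mem hj
  rcases h1.1.total h2.1 with h | h
  · exact h
  · have := T.ld_mono h
    omega

/-- The top of a heavy path is the root or light, hence is the only candidate for a top above it. -/
theorem top_eq_of_isAncestor {v x : Fin m} {i : ℕ} (hi : i ≤ T.ld v)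
    (hx : T.IsAncestor (T.top v i) x) : T.top x i = T.top v i := by
  have hix : i ≤ T.ld x := (top_mem hi).2 ▸ T.ld_mono hx
  have h1 : T.IsAncestor (T.top x i) (T.top v i) := by
    have := top_isAncestor hx
    rwa [(top_mem hi).2] at this
  have h2 : T.IsAncestor (T.top v i) (T.top x i) := by
    have := top_isAncestor (h1.trans (top_mem hi).1)
    rwa [(top_mem hix).2] at this
  exact T.isAncestor_antisymm h1 h2

variable (T)

/-- If `ld` is constant from `t` to `u`, no node strictly below `t` on the way is light, so each
step down goes to the heavy child. -/
theorem exists_iterate_hv {t u : Fin m} (h : T.IsAncestor t u) (hl : T.ld t = T.ld u) :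
    ∃ k : ℕ, u = T.hv^[k] t := by
  classical
  induction u using RootedTree.induction_on (T := T.toRootedTree) with
  | root => exact ⟨0, (T.isAncestor_antisymm h (isAncestor_root t)).symm⟩
  | step c p hc ih =>
    rcases h.of_child hc with rfl | hp
    · exact ⟨0, rfl⟩
    · have h1 := T.ld_mono hp
      have h2 := T.ld_child hc
      have hnl : ¬ T.Light c := by
        intro hlc
        rw [if_pos hlc] at h2
        omega
      rw [if_neg hnl] at h2
      obtain ⟨k, hk⟩ := ih hp (by omega)
      refine ⟨k + 1, ?_⟩
      have : c = T.hv p := by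
        by_contra hne
        exact hnl ⟨hc.1, hc.2.symm ▸ hne⟩
      rw [Function.iterate_succ_apply', ← hk, this]

theorem isAncestor_iterate_hv (t : Fin m) (k : ℕ) : T.IsAncestor t (T.hv^[k] t) := by
  induction k with
  | zero => exact IsAncestor.refl _ _
  | succ k ih =>
    rw [Function.iterate_succ_apply']
    exact ih.trans (T.isAncestor_hv _)

/-- The nodes of a heavy path form a chain. -/
theorem heavy_path_total {t u u' : Fin m} (h : T.IsAncestor t u) (hl : T.ld t = T.ld u)
    (h' : T.IsAncestor t u') (hl' : T.ld t = T.ld u') :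
    T.IsAncestor u u' ∨ T.IsAncestor u' u := by
  obtain ⟨k, rfl⟩ := T.exists_iterate_hv h hl
  obtain ⟨l, rfl⟩ := T.exists_iterate_hv h' hl'
  rcases le_total k l with hkl | hkl
  · obtain ⟨d, rfl⟩ := Nat.exists_eq_add_of_le' hkl
    rw [Function.iterate_add_apply]
    exact Or.inl (T.isAncestor_iterate_hv _ _)
  · obtain ⟨d, rfl⟩ := Nat.exists_eq_add_of_le' hkl
    rw [Function.iterate_add_apply]
    exact Or.inr (T.isAncestor_iterate_hv _ _)

/-! ### The leaf order: depth first, heavy child last -/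

open Classical in
/-- Siblings are ordered by this key. -/
noncomputable def key (c : Fin m) : ℕ := if c = T.hv (T.parent c) then m else c

theorem key_inj {c c' p : Fin m} (hc : T.IsChild c p) (hc' : T.IsChild c' p)
    (h : T.key c = T.key c') : c = c' := by
  unfold key at h
  rw [hc.2, hc'.2] at h
  split_ifs at h with h1 h2 h2
  · exact h1.trans h2.symm
  · exact absurd h (ne_of_gt c'.2)
  · exact absurd h (ne_of_lt c.2)
  · exact Fin.ext h

/-- The number of leaves below the siblings that precede a node. -/
noncomputable def pre (c : Fin m) : ℕ :=
  ∑ c' ∈ (T.children (T.parent c)).filter (fun c' => T.key c' < T.key c), T.sz c'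

open Classical in
/-- The rank of the first leaf below a node. -/
noncomputable def pos (v : Fin m) : ℕ :=
  ∑ u ∈ Finset.univ.filter (fun u => T.IsAncestor u v ∧ u ≠ T.root), T.pre u

theorem pos_root : T.pos T.root = 0 := by
  classical
  refine Finset.sum_eq_zero fun u hu => ?_
  simp only [Finset.mem_filter, Finset.mem_univ, true_and] at hu
  exact absurd (T.isAncestor_antisymm hu.1 (isAncestor_root u)) hu.2

theorem pos_child {c p : Fin m} (hc : T.IsChild c p) : T.pos c = T.pos p + T.pre c := by
  classical
  have hcp : ¬ T.IsAncestor c p := fun h =>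
    absurd (T.weight_le_of_isAncestor h) (not_le.mpr (T.weight_lt _ _ hc))
  unfold pos
  rw [add_comm, ← Finset.sum_insert (by simp [hcp])]
  refine Finset.sum_congr (Finset.ext fun u => ?_) fun _ _ => rfl
  simp only [Finset.mem_filter, Finset.mem_univ, true_and, Finset.mem_insert,
    isAncestor_child_iff hc]
  constructor
  · rintro ⟨h | h, h'⟩
    · exact Or.inl h
    · exact Or.inr ⟨h, h'⟩
  · rintro (rfl | ⟨h, h'⟩)
    · exact ⟨Or.inl rfl, hc.1⟩
    · exact ⟨Or.inr h, h'⟩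

theorem pre_add_sz_le {c c' p : Fin m} (hc : T.IsChild c p) (hc' : T.IsChild c' p)
    (h : T.key c < T.key c') : T.pre c + T.sz c ≤ T.pre c' := by
  classical
  unfold pre
  rw [hc.2, hc'.2, add_comm, ← Finset.sum_insert (by simp)]
  refine Finset.sum_le_sum_of_subset fun x hx => ?_
  simp only [Finset.mem_insert, Finset.mem_filter, mem_children] at hx ⊢
  rcases hx with rfl | ⟨hx, hk⟩
  · exact ⟨hc, h⟩
  · exact ⟨hx, hk.trans h⟩

theorem pre_add_sz_le_parent {c p : Fin m} (hc : T.IsChild c p) : T.pre c + T.sz c ≤ T.sz p := by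
  classical
  unfold pre
  rw [hc.2, add_comm, ← Finset.sum_insert (by simp)]
  refine T.sum_sz_le p _ fun x hx => ?_
  simp only [Finset.mem_insert, Finset.mem_filter, mem_children] at hx ⊢
  rcases hx with rfl | ⟨hx, hk⟩
  · exact hc
  · exact hx

/-- The key `m` of the heavy child exceeds the keys of all its siblings, so all of them precede it.
-/
theorem pre_hv_add_sz {p : Fin m} (hp : ¬ T.IsLeaf p) :
    T.pre (T.hv p) + T.sz (T.hv p) = T.sz p := by
  classical
  have hc := T.isChild_hv hp
  unfold pre
  rw [hc.2, add_comm, ← Finset.sum_insert (by simp), ← T.sum_sz_children hp]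
  refine Finset.sum_congr (Finset.ext fun x => ?_) fun _ _ => rfl
  simp only [Finset.mem_insert, Finset.mem_filter, mem_children]
  constructor
  · rintro (rfl | ⟨hx, -⟩)
    · exact hc
    · exact hx
  · intro hx
    by_cases hxe : x = T.hv p
    · exact Or.inl hxe
    · refine Or.inr ⟨hx, ?_⟩
      unfold key
      rw [hx.2, hc.2, if_neg hxe, if_pos rfl]
      exact x.2

/-- One more than the rank of the last leaf below a node. -/
noncomputable def fin (v : Fin m) : ℕ := T.pos v + T.sz v

theorem pos_lt_fin (v : Fin m) : T.pos v < T.fin v := Nat.lt_add_of_pos_right (T.sz_pos v)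

theorem interval_mono {u v : Fin m} (h : T.IsAncestor u v) :
    T.pos u ≤ T.pos v ∧ T.fin v ≤ T.fin u := by
  induction v using RootedTree.induction_on (T := T.toRootedTree) with
  | root => rw [T.isAncestor_antisymm h (isAncestor_root u)]; exact ⟨le_rfl, le_rfl⟩
  | step c p hc ih =>
    rcases h.of_child hc with rfl | hp
    · exact ⟨le_rfl, le_rfl⟩
    · have h1 := ih hp
      have h2 := T.pos_child hc
      have h3 := T.pre_add_sz_le_parent hc
      unfold fin at *
      omega

/-- Where two root paths part, the two siblings have disjoint intervals, in the order of their keys.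
-/
theorem interval_trichotomy (u v : Fin m) :
    T.IsAncestor u v ∨ T.IsAncestor v u ∨ T.fin u ≤ T.pos v ∨ T.fin v ≤ T.pos u := by
  induction u using RootedTree.induction_on (T := T.toRootedTree) with
  | root => exact Or.inl (isAncestor_root v)
  | step c p hc ih =>
    rcases ih with h | h | h | h
    · rcases h.exists_child with rfl | ⟨c', hc', hv⟩
      · exact Or.inr (Or.inl hc.isAncestor)
      · by_cases hne : c = c'
        · exact Or.inl (hne ▸ hv)
        · have hm := T.interval_mono hv
          have h1 := T.pos_child hc
          have h2 := T.pos_child hc'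
          unfold fin at *
          rcases lt_trichotomy (T.key c) (T.key c') with hk | hk | hk
          · have := T.pre_add_sz_le hc hc' hk
            exact Or.inr (Or.inr (Or.inl (by omega)))
          · exact absurd (T.key_inj hc hc' hk) hne
          · have := T.pre_add_sz_le hc' hc hk
            exact Or.inr (Or.inr (Or.inr (by omega)))
    · exact Or.inr (Or.inl (h.trans hc.isAncestor))
    · exact Or.inr (Or.inr (Or.inl ((T.interval_mono hc.isAncestor).2.trans h)))
    · exact Or.inr (Or.inr (Or.inr (h.trans (T.interval_mono hc.isAncestor).1)))

/-- The rank of a leaf. -/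
noncomputable def rk (x : Fin n) : ℕ := T.pos (T.leaf x)

theorem fin_leaf (x : Fin n) : T.fin (T.leaf x) = T.rk x + 1 := by rw [fin, sz_leaf, rk]

theorem isAncestor_leaf_iff {u : Fin m} {x : Fin n} :
    T.IsAncestor u (T.leaf x) ↔ T.pos u ≤ T.rk x ∧ T.rk x < T.fin u := by
  constructor
  · intro h
    have := T.interval_mono h
    rw [fin_leaf] at this
    exact ⟨this.1, by omega⟩
  · rintro ⟨h1, h2⟩
    rcases T.interval_trichotomy u (T.leaf x) with h | h | h | h
    · exact h
    · rw [T.eq_of_isLeaf (T.isLeaf_leaf x) h]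
      exact IsAncestor.refl _ _
    · exact absurd h (not_le.mpr h2)
    · rw [fin_leaf] at h
      omega

theorem rk_injective : Function.Injective T.rk := by
  intro x y h
  have : T.IsAncestor (T.leaf x) (T.leaf y) := by
    rw [isAncestor_leaf_iff, ← h, fin_leaf]
    exact ⟨le_rfl, Nat.lt_succ_self _⟩
  exact T.leaf_injective (T.eq_of_isLeaf (T.isLeaf_leaf x) this).symm

theorem fin_le (v : Fin m) : T.fin v ≤ n := by
  have := (T.interval_mono (isAncestor_root v)).2
  rwa [fin, fin, pos_root, sz_root, zero_add] at this

/-- The heavy child comes last, so its interval ends where that of its parent ends. Through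
`fin_eq_of_heavy_path` this makes the leaves below any node of a heavy path a final segment of the
block. -/
theorem fin_hv (u : Fin m) : T.fin (T.hv u) = T.fin u := by
  by_cases hu : T.IsLeaf u
  · have : ¬ (T.children u).Nonempty := fun ⟨c, hc⟩ => hu c (mem_children.mp hc)
    rw [hv, dif_neg this]
  · have h1 := T.pos_child (T.isChild_hv hu)
    have h2 := T.pre_hv_add_sz hu
    unfold fin
    omega

theorem fin_eq_of_heavy_path {t u : Fin m} (h : T.IsAncestor t u) (hl : T.ld t = T.ld u) :
    T.fin u = T.fin t := by
  obtain ⟨k, rfl⟩ := T.exists_iterate_hv h hl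
  induction k with
  | zero => rfl
  | succ k ih =>
    rw [Function.iterate_succ_apply', fin_hv]
    have h1 := T.isAncestor_iterate_hv t k
    refine ih h1 (le_antisymm (T.ld_mono h1) (hl ▸ T.ld_mono ?_))
    rw [Function.iterate_succ_apply']
    exact T.isAncestor_hv _

end WeightedTree

/-! ### Blocks of leaves -/

namespace WeightedTree

variable {n m : ℕ} (T : WeightedTree n m)

/-- The first rank below the top of the heavy path of level `i` above `v`. -/
noncomputable def lo (v : Fin m) (i : ℕ) : ℕ := T.pos (T.top v i)

/-- One more than the last rank below the top of the heavy path of level `i` above `v`. -/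
noncomputable def hi (v : Fin m) (i : ℕ) : ℕ := T.fin (T.top v i)

/-- The first rank below the deepest ancestor of `v` on the heavy path of level `i`. -/
noncomputable def sub (v : Fin m) (i : ℕ) : ℕ := T.pos (T.ex v i)

/-- The leaves below the top of the heavy path of level `i` above `v`. -/
noncomputable def blk (v : Fin m) (i : ℕ) : Finset (Fin n) := T.below (T.top v i)

/-- The deepest ancestor of a leaf on its heavy path of level `i`. -/
noncomputable def exl (x : Fin n) (i : ℕ) : Fin m := T.ex (T.leaf x) i

variable {T} {v v' : Fin m} {i j : ℕ} {x y : Fin n}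

theorem mem_blk : x ∈ T.blk v i ↔ T.lo v i ≤ T.rk x ∧ T.rk x < T.hi v i := by
  rw [blk, mem_below, isAncestor_leaf_iff, lo, hi]

theorem lo_le_sub (h : i ≤ T.ld v) : T.lo v i ≤ T.sub v i :=
  (T.interval_mono (top_isAncestor_ex h)).1

theorem sub_le_pos (h : i ≤ T.ld v) : T.sub v i ≤ T.pos v := (T.interval_mono (ex_mem h).1).1

theorem fin_ex (h : i ≤ T.ld v) : T.fin (T.ex v i) = T.hi v i :=
  T.fin_eq_of_heavy_path (top_isAncestor_ex h) ((top_mem h).2.trans (ex_mem h).2.symm)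

theorem pos_lt_hi (h : i ≤ T.ld v) : T.pos v < T.hi v i :=
  (T.pos_lt_fin v).trans_le (T.interval_mono (top_mem h).1).2

theorem hi_le : T.hi v i ≤ n := T.fin_le _

theorem hi_eq : T.hi v i = T.lo v i + (T.blk v i).card := rfl

theorem card_blk_pos : 0 < (T.blk v i).card := T.sz_pos _

theorem card_blk_le : (T.blk v i).card ≤ n := T.sz_le _

theorem le_ld_of_mem_blk (h : i ≤ T.ld v) (hx : x ∈ T.blk v i) : i ≤ T.ld (T.leaf x) :=
  (top_mem h).2 ▸ T.ld_mono (mem_below.mp hx)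

theorem top_leaf_of_mem_blk (h : i ≤ T.ld v) (hx : x ∈ T.blk v i) :
    T.top (T.leaf x) i = T.top v i := top_eq_of_isAncestor h (mem_below.mp hx)

theorem top_eq_of_mem_blk (h : i ≤ T.ld v) (h' : i ≤ T.ld v') (hx : x ∈ T.blk v i)
    (hx' : x ∈ T.blk v' i) : T.top v i = T.top v' i :=
  (top_leaf_of_mem_blk h hx).symm.trans (top_leaf_of_mem_blk h' hx')

theorem mem_blk_leaf (h : i ≤ T.ld (T.leaf x)) : x ∈ T.blk (T.leaf x) i :=
  mem_below.mpr (top_mem h).1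

theorem top_top (h : i ≤ T.ld v) (hij : j ≤ i) : T.top (T.top v i) j = T.top v j := by
  refine top_eq_of_isAncestor (hij.trans h) ?_
  rcases hij.eq_or_lt with rfl | hlt
  · exact IsAncestor.refl _ _
  · exact (top_isAncestor_ex (hij.trans h)).trans (ex_isAncestor_top_succ hlt h)

theorem blk_subset (h : i ≤ T.ld v) (hij : j ≤ i) : T.blk v i ⊆ T.blk v j := by
  intro x hx
  rcases hij.eq_or_lt with rfl | hlt
  · exact hx
  · exact mem_below.mpr (((top_isAncestor_ex (hij.trans h)).trans
      (ex_isAncestor_top_succ hlt h)).trans (mem_below.mp hx))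

/-- Inside the block the upper bound on the rank is automatic, so lying below the exit is a single
comparison. -/
theorem ex_isAncestor_leaf_iff (h : i ≤ T.ld v) (hx : x ∈ T.blk v i) :
    T.IsAncestor (T.ex v i) (T.leaf x) ↔ T.sub v i ≤ T.rk x := by
  rw [isAncestor_leaf_iff, fin_ex h]
  exact ⟨fun h => h.1, fun h => ⟨h, (mem_blk.mp hx).2⟩⟩

theorem ex_isAncestor_exl (h : i ≤ T.ld v) (hx : x ∈ T.blk v i) (hs : T.sub v i ≤ T.rk x) :
    T.IsAncestor (T.ex v i) (T.exl x i) := by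
  have := isAncestor_ex ((ex_isAncestor_leaf_iff h hx).mpr hs)
  rwa [(ex_mem h).2] at this

theorem exl_isAncestor_leaf (h : i ≤ T.ld v) (hx : x ∈ T.blk v i) :
    T.IsAncestor (T.exl x i) (T.leaf x) := (ex_mem (le_ld_of_mem_blk h hx)).1

theorem top_isAncestor_exl (h : i ≤ T.ld v) (hx : x ∈ T.blk v i) :
    T.IsAncestor (T.top v i) (T.exl x i) :=
  top_leaf_of_mem_blk h hx ▸ top_isAncestor_ex (le_ld_of_mem_blk h hx)

theorem ld_exl (h : i ≤ T.ld v) (hx : x ∈ T.blk v i) : T.ld (T.exl x i) = i :=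
  (ex_mem (le_ld_of_mem_blk h hx)).2

theorem exl_total (h : i ≤ T.ld v) (hx : x ∈ T.blk v i) :
    T.IsAncestor (T.exl x i) (T.ex v i) ∨ T.IsAncestor (T.ex v i) (T.exl x i) :=
  T.heavy_path_total (top_isAncestor_exl h hx) ((top_mem h).2.trans (ld_exl h hx).symm)
    (top_isAncestor_ex h) ((top_mem h).2.trans (ex_mem h).2.symm)

theorem exl_isAncestor_ex (h : i ≤ T.ld v) (hx : x ∈ T.blk v i) (hs : T.rk x < T.sub v i) :
    T.IsAncestor (T.exl x i) (T.ex v i) := by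
  rcases exl_total h hx with h1 | h1
  · exact h1
  · have := (ex_isAncestor_leaf_iff h hx).mp (h1.trans (exl_isAncestor_leaf h hx))
    omega

/-- The interval of `exl x i` ends with the block, so it contains every leaf of the block that does
not precede `x`. -/
theorem exl_mono (h : i ≤ T.ld v) (hx : x ∈ T.blk v i) (hy : y ∈ T.blk v i)
    (hxy : T.rk x ≤ T.rk y) : T.IsAncestor (T.exl x i) (T.exl y i) := by
  have h1 : T.IsAncestor (T.exl x i) (T.leaf y) := by
    rw [isAncestor_leaf_iff, T.fin_eq_of_heavy_path (top_isAncestor_exl h hx)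
      ((top_mem h).2.trans (ld_exl h hx).symm)]
    exact ⟨((T.interval_mono (exl_isAncestor_leaf h hx)).1).trans hxy, (mem_blk.mp hy).2⟩
  have := isAncestor_ex h1
  rwa [ld_exl h hx] at this

/-- Such a leaf is below the exit of `v`. Had it left the path further down, it would be below the
heavy child and would come after `v`. Thus any leaf in this range of ranks reveals `ex v i`, which
is what `exists_group_table` needs. -/
theorem exl_eq_ex (h : i ≤ T.ld v) (hs : T.sub v i ≤ T.rk x) (hp : T.rk x < T.pos v) :
    T.exl x i = T.ex v i := by
  have hx : x ∈ T.blk v i := mem_blk.mpr ⟨(lo_le_sub h).trans hs, hp.trans (pos_lt_hi h)⟩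
  have h1 := ex_isAncestor_exl h hx hs
  refine T.isAncestor_antisymm ?_ h1
  have h2 := T.interval_mono (exl_isAncestor_leaf h hx)
  have h3 := T.fin_eq_of_heavy_path (top_isAncestor_exl h hx)
    ((top_mem h).2.trans (ld_exl h hx).symm)
  have h4 := pos_lt_hi h
  have h5 := T.interval_mono (u := T.exl x i) (v := v)
  rcases T.interval_trichotomy (T.exl x i) v with h6 | h6 | h6 | h6
  · have := isAncestor_ex h6
    rwa [ld_exl h hx] at this
  · have := (T.interval_mono h6).1
    unfold rk at hp
    omega
  · unfold hi at h4
    omega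
  · have := T.pos_lt_fin v
    unfold rk at hp
    omega

end WeightedTree

/-! ### Counting leaves in a block -/

/-- The number of elements of `B` of rank less than `p`. -/
def cnt {n : ℕ} (r : Fin n → ℕ) (B : Finset (Fin n)) (p : ℕ) : ℕ :=
  (B.filter fun x => r x < p).card

section cnt

variable {n : ℕ} {r : Fin n → ℕ} {B : Finset (Fin n)} {p p' s : ℕ} {x : Fin n}

theorem cnt_mono (h : p ≤ p') : cnt r B p ≤ cnt r B p' := by
  refine Finset.card_le_card fun x hx => ?_
  rw [Finset.mem_filter] at hx ⊢
  exact ⟨hx.1, hx.2.trans_le h⟩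

theorem cnt_le : cnt r B p ≤ B.card := Finset.card_filter_le _ _

theorem cnt_zero : cnt r B 0 = 0 := by simp [cnt]

theorem cnt_lt_cnt_iff : cnt r B p < cnt r B p' ↔ ∃ x ∈ B, p ≤ r x ∧ r x < p' := by
  constructor
  · intro h
    by_contra hne
    push Not at hne
    refine absurd h (not_lt.mpr (Finset.card_le_card fun x hx => ?_))
    rw [Finset.mem_filter] at hx ⊢
    refine ⟨hx.1, ?_⟩
    by_contra hp
    have := hne x hx.1 (not_lt.mp hp)
    omega
  · rintro ⟨x, hx, h1, h2⟩
    refine Finset.card_lt_card ⟨fun y hy => ?_, fun h => ?_⟩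
    · rw [Finset.mem_filter] at hy ⊢
      exact ⟨hy.1, by omega⟩
    · have := h (Finset.mem_filter.mpr ⟨hx, h2⟩)
      rw [Finset.mem_filter] at this
      omega

theorem cnt_succ (hr : Function.Injective r) (hx : x ∈ B) :
    cnt r B (r x + 1) = cnt r B (r x) + 1 := by
  unfold cnt
  rw [← Finset.card_insert_of_notMem (a := x) (by simp)]
  refine congrArg Finset.card (Finset.ext fun y => ?_)
  simp only [Finset.mem_filter, Finset.mem_insert, Nat.lt_succ_iff_lt_or_eq]
  constructor
  · rintro ⟨h, h' | h'⟩
    · exact Or.inr ⟨h, h'⟩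
    · exact Or.inl (hr h')
  · rintro (rfl | ⟨h, h'⟩)
    · exact ⟨hx, Or.inr rfl⟩
    · exact ⟨h, Or.inl h'⟩

/-- Every number below the count is the count of an element. -/
theorem exists_cnt_eq (hr : Function.Injective r) (h : cnt r B p ≤ s) (h' : s < cnt r B p') :
    ∃ x ∈ B, p ≤ r x ∧ r x < p' ∧ cnt r B (r x) = s := by
  induction p' with
  | zero => rw [cnt_zero] at h'; omega
  | succ q ih =>
    by_cases hq : s < cnt r B q
    · obtain ⟨x, hx, h1, h2, h3⟩ := ih hq
      exact ⟨x, hx, h1, by omega, h3⟩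
    · obtain ⟨x, hx, h1, h2⟩ := cnt_lt_cnt_iff.mp (lt_of_le_of_lt (not_lt.mp hq) h')
      have hxq : r x = q := by omega
      have h3 := cnt_succ hr hx
      rw [hxq] at h3
      refine ⟨x, hx, ?_, h2, by rw [hxq]; omega⟩
      rw [hxq]
      by_contra hlt
      have := cnt_mono (r := r) (B := B) (show q + 1 ≤ p by omega)
      omega

theorem cnt_lt_cnt_of_mem (hx : x ∈ B) (h : p ≤ r x) (h' : r x < p') :
    cnt r B p < cnt r B p' := cnt_lt_cnt_iff.mpr ⟨x, hx, h, h'⟩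

theorem not_mem_of_cnt_eq (h : cnt r B p = cnt r B p') (hx : x ∈ B) (h1 : p ≤ r x) : p' ≤ r x := by
  by_contra hlt
  have := cnt_lt_cnt_of_mem hx h1 (not_le.mp hlt)
  omega

theorem eq_of_cnt_eq (hr : Function.Injective r) {y : Fin n} (hx : x ∈ B) (hy : y ∈ B)
    (h : cnt r B (r x) = cnt r B (r y)) : x = y := by
  rcases lt_trichotomy (r x) (r y) with h1 | h1 | h1
  · have := cnt_lt_cnt_of_mem hx le_rfl h1
    omega
  · exact hr h1
  · have := cnt_lt_cnt_of_mem hy le_rfl h1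
    omega

end cnt

/-! ### Tables -/

/-- In the applications `key` forgets the nodes and keeps levels and a position in a list. The
content of each table lemma is therefore the hypothesis `hwd`, that the answer depends on nothing
else. -/
theorem exists_table {α : Type*} (key : α → ℕ × ℕ × ℕ) (val : α → ℕ) (W : ℕ) (hW : 0 < W)
    (hval : ∀ a, val a < W) (hwd : ∀ a b, key a = key b → val a = val b) :
    ∃ t : ℕ → ℕ → ℕ → ℕ, (∀ i j x, t i j x < W) ∧
      ∀ a, t (key a).1 (key a).2.1 (key a).2.2 = val a := by
  classical
  refine ⟨fun i j x => Function.extend key val (fun _ => 0) (i, j, x), fun i j x => ?_, fun a => ?_⟩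
  · beta_reduce
    by_cases h : ∃ a, key a = (i, j, x)
    · obtain ⟨a, ha⟩ := h
      rw [← ha, Function.FactorsThrough.extend_apply (fun a b => hwd a b)]
      exact hval a
    · rw [Function.extend_apply' _ _ _ h]
      exact hW
  · exact Function.FactorsThrough.extend_apply (fun a b => hwd a b) _ _

/-! ### Lists of leaves, gaps, and the tables addressed by gaps. -/

namespace WeightedTree

variable {n m m' : ℕ} (T : WeightedTree n m) (U : WeightedTree n m')

/-- The index of the gap before the rank `p` (in `T`) in the list of the leaves of the block of
level `j` of the node `u` of `U`, among all blocks of level `j`. -/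
noncomputable def gap (u : Fin m') (j p : ℕ) : ℕ := 4 * U.lo u j + cnt T.rk (U.blk u j) p

-- Blocks of one level are disjoint or equal intervals of ranks, so the address ranges that start at
-- `4 * lo` and have four times the length of the block do not overlap. The factor `4` leaves room
-- for positions beyond the end of a list and for the samples of the location table.
variable {U} in
theorem top_eq_of_index_eq {u u' : Fin m'} {j s s' : ℕ} (hu : j ≤ U.ld u) (hu' : j ≤ U.ld u')
    (hs : s < 4 * (U.blk u j).card) (hs' : s' < 4 * (U.blk u' j).card)
    (h : 4 * U.lo u j + s = 4 * U.lo u' j + s') : U.top u j = U.top u' j := by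
  have h1 := U.hi_eq (v := u) (i := j)
  have h2 := U.hi_eq (v := u') (i := j)
  have key : ∀ {w w' : Fin m'}, j ≤ U.ld w → j ≤ U.ld w' →
      U.IsAncestor (U.top w j) (U.top w' j) → U.top w j = U.top w' j := by
    intro w w' hw hw' ha
    rw [← top_eq_of_isAncestor hw ha, top_top hw' le_rfl]
  rcases U.interval_trichotomy (U.top u j) (U.top u' j) with h3 | h3 | h3 | h3
  · exact key hu hu' h3
  · exact (key hu' hu h3).symm
  · have : U.hi u j ≤ U.lo u' j := h3
    omega
  · have : U.hi u' j ≤ U.lo u j := h3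
    omega

variable {T U} in
theorem cnt_lt_four_mul {u : Fin m'} {j p : ℕ} :
    cnt T.rk (U.blk u j) p < 4 * (U.blk u j).card := by
  have h1 := cnt_le (r := T.rk) (B := U.blk u j) (p := p)
  have h2 := U.card_blk_pos (v := u) (i := j)
  omega

variable {T U} in
theorem gap_lt {u : Fin m'} {j p : ℕ} : T.gap U u j p + 1 < 4 * n := by
  have h1 := cnt_le (r := T.rk) (B := U.blk u j) (p := p)
  have h2 := U.hi_eq (v := u) (i := j)
  have h3 := U.hi_le (v := u) (i := j)
  have h4 := U.card_blk_pos (v := u) (i := j)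
  unfold gap
  omega

variable {T U} in
theorem top_eq_of_gap_eq {u u' : Fin m'} {j p p' : ℕ} (hu : j ≤ U.ld u) (hu' : j ≤ U.ld u')
    (h : T.gap U u j p = T.gap U u' j p') :
    U.lo u j = U.lo u' j ∧ U.hi u j = U.hi u' j ∧ U.blk u j = U.blk u' j ∧
      cnt T.rk (U.blk u j) p = cnt T.rk (U.blk u j) p' := by
  have ht := top_eq_of_index_eq hu hu' cnt_lt_four_mul cnt_lt_four_mul h
  have h1 : U.lo u j = U.lo u' j := by rw [lo, lo, ht]
  have h2 : U.blk u j = U.blk u' j := by rw [blk, blk, ht]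
  refine ⟨h1, by rw [hi, hi, ht], h2, ?_⟩
  unfold gap at h
  rw [h1, ← h2] at h
  omega

variable {T U} in
theorem gap_mono {u : Fin m'} {j p p' : ℕ} (h : p ≤ p') : T.gap U u j p ≤ T.gap U u j p' :=
  Nat.add_le_add_left (cnt_mono h) _

/-- Selecting in the lists of leaves. -/
theorem exists_select_table (W : ℕ) (hW : n + 2 ≤ W) : ∃ t : ℕ → ℕ → ℕ → ℕ,
    (∀ i j x, t i j x < W) ∧ ∀ u j, j ≤ U.ld u → ∀ s ≤ (U.blk u j).card + 1, ∀ p ≤ n,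
      (t 0 j (4 * U.lo u j + s) ≤ p ↔ s ≤ cnt T.rk (U.blk u j) p) := by
  classical
  -- The alternative `n < q` makes the search total: if the list has fewer than `s` leaves, the
  -- entry is `n + 1`, beyond every rank.
  have hex : ∀ B : Finset (Fin n), ∀ s, ∃ q, s ≤ cnt T.rk B q ∨ n < q := fun B s =>
    ⟨n + 1, Or.inr (Nat.lt_succ_self n)⟩
  obtain ⟨t, ht, hts⟩ := exists_table
    (α := {a : Fin m' × ℕ × ℕ // a.2.1 ≤ U.ld a.1 ∧ a.2.2 ≤ (U.blk a.1 a.2.1).card + 1})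
    (fun a => (0, a.1.2.1, 4 * U.lo a.1.1 a.1.2.1 + a.1.2.2))
    (fun a => Nat.find (hex (U.blk a.1.1 a.1.2.1) a.1.2.2)) W (by omega)
    (fun a => by
      have := Nat.find_min' (hex (U.blk a.1.1 a.1.2.1) a.1.2.2) (Or.inr (Nat.lt_succ_self n))
      omega)
    (by
      rintro ⟨⟨u, j, s⟩, hj, hs⟩ ⟨⟨u', j', s'⟩, hj', hs'⟩ h
      simp only [Prod.mk.injEq, true_and] at h hj hs hj' hs' ⊢
      obtain ⟨rfl, h⟩ := h
      have h1 := U.card_blk_pos (v := u) (i := j)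
      have h2 := U.card_blk_pos (v := u') (i := j)
      have htop := top_eq_of_index_eq hj hj' (by omega) (by omega) h
      have : s = s' := by
        rw [lo, lo, htop] at h
        omega
      subst this
      have hb : U.blk u j = U.blk u' j := by rw [blk, blk, htop]
      simp only [hb])
  refine ⟨t, ht, fun u j hj s hs p hp => ?_⟩
  rw [hts ⟨(u, j, s), hj, hs⟩]
  simp only
  constructor
  · intro h
    rcases Nat.find_spec (hex (U.blk u j) s) with h1 | h1
    · exact h1.trans (cnt_mono h)
    · omega
  · intro h
    exact Nat.find_min' (hex (U.blk u j) s) (Or.inl h)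

/-- The number of leaves of the parent block per entry of the location table. -/
noncomputable def grain (u : Fin m') (j : ℕ) : ℕ :=
  if j = 0 then 1 else (U.blk u (j - 1)).card / (U.blk u j).card

/-- The length of the range that the location table leaves for searching. -/
noncomputable def slack (u : Fin m') (j : ℕ) : ℕ := if j = 0 then n else U.grain u j

/-- The rank in the parent block. -/
noncomputable def prev (u : Fin m') (j p : ℕ) : ℕ :=
  if j = 0 then 0 else cnt T.rk (U.blk u (j - 1)) p

variable {U} in
theorem grain_pos {u : Fin m'} {j : ℕ} (hj : j ≤ U.ld u) : 0 < U.grain u j := by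
  unfold grain
  split_ifs with h
  · exact Nat.one_pos
  · exact Nat.div_pos (Finset.card_le_card (blk_subset hj (by omega))) U.card_blk_pos

-- Rounding the ratio of the block sizes down to `grain` loses less than a factor of two, so there
-- are fewer than twice as many samples as leaves in the block.
variable {T U} in
theorem prev_div_grain_lt {u : Fin m'} {j p : ℕ} (hj : j ≤ U.ld u) :
    T.prev U u j p / U.grain u j + 1 < 4 * (U.blk u j).card := by
  have h0 := U.card_blk_pos (v := u) (i := j)
  have hg := grain_pos hj
  unfold prev
  split_ifs with h
  · simp only [Nat.zero_div]; omega
  · have h1 : T.prev U u j p / U.grain u j < 2 * (U.blk u j).card := by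
      rw [Nat.div_lt_iff_lt_mul hg]
      have h2 := cnt_le (r := T.rk) (B := U.blk u (j - 1)) (p := p)
      have h3 : U.grain u j = (U.blk u (j - 1)).card / (U.blk u j).card := by simp [grain, h]
      have h4 := Nat.lt_mul_div_succ (U.blk u (j - 1)).card h0
      rw [← h3] at h4
      simp only [prev, if_neg h]
      nlinarith
    simp only [prev, if_neg h] at h1
    omega

/-- The leaves of `B'` have distinct counts, so an interval of `g` counts contains at most `g` of
them. This bounds the search between two consecutive samples. -/
theorem card_blk_le_of_mem {B B' : Finset (Fin n)} (hB : B ⊆ B') (a g : ℕ) :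
    (B.filter fun x => a ≤ cnt T.rk B' (T.rk x) ∧ cnt T.rk B' (T.rk x) < a + g).card ≤ g := by
  have : (B.filter fun x => a ≤ cnt T.rk B' (T.rk x) ∧ cnt T.rk B' (T.rk x) < a + g).card
      ≤ (Finset.Ico a (a + g)).card := by
    refine Finset.card_le_card_of_injOn (fun x => cnt T.rk B' (T.rk x)) ?_ ?_
    · intro x hx
      simp only [Finset.coe_filter, Set.mem_ofPred_eq] at hx
      simp only [Finset.coe_Ico, Set.mem_Ico]
      exact hx.2
    · intro x hx y hy hxy
      simp only [Finset.coe_filter, Set.mem_ofPred_eq] at hx hy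
      exact eq_of_cnt_eq T.rk_injective (hB hx.1) (hB hy.1) hxy
  simpa using this

/-- Locating a rank in a block, given its location in the parent block. -/
theorem exists_locate_table (W : ℕ) (hW : n < W) : ∃ t : ℕ → ℕ → ℕ → ℕ,
    (∀ i j x, t i j x < W) ∧ ∀ u j p, j ≤ U.ld u →
      t 0 j (4 * U.lo u j + T.prev U u j p / U.grain u j) ≤ cnt T.rk (U.blk u j) p ∧
      cnt T.rk (U.blk u j) p ≤ t 0 j (4 * U.lo u j + T.prev U u j p / U.grain u j + 1) ∧
      t 0 j (4 * U.lo u j + T.prev U u j p / U.grain u j + 1) ≤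
        t 0 j (4 * U.lo u j + T.prev U u j p / U.grain u j) + U.slack u j ∧
      t 0 j (4 * U.lo u j + T.prev U u j p / U.grain u j + 1) ≤ (U.blk u j).card := by
  classical
  obtain ⟨t, ht, hts⟩ := exists_table
    (α := {a : Fin m' × ℕ × ℕ // a.2.1 ≤ U.ld a.1 ∧ a.2.2 < 4 * (U.blk a.1 a.2.1).card})
    (fun a => (0, a.1.2.1, 4 * U.lo a.1.1 a.1.2.1 + a.1.2.2))
    -- Level `0` has no parent block; its samples are the two ends of the list, and everything in
    -- between remains to be searched. On the other levels, sample `s` counts the leaves of the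
    -- block before position `s * grain` of the parent list.
    (fun a => if a.1.2.1 = 0 then (if a.1.2.2 = 0 then 0 else (U.blk a.1.1 a.1.2.1).card) else
      ((U.blk a.1.1 a.1.2.1).filter fun x => cnt T.rk (U.blk a.1.1 (a.1.2.1 - 1)) (T.rk x)
        < a.1.2.2 * U.grain a.1.1 a.1.2.1).card) W (by omega)
    (fun a => by
      have h1 := U.card_blk_le (v := a.1.1) (i := a.1.2.1)
      split_ifs
      · omega
      · omega
      · exact ((Finset.card_filter_le _ _).trans h1).trans_lt hW)
    (by
      rintro ⟨⟨u, j, s⟩, hj, hs⟩ ⟨⟨u', j', s'⟩, hj', hs'⟩ h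
      simp only [Prod.mk.injEq, true_and] at h hj hs hj' hs' ⊢
      obtain ⟨rfl, h⟩ := h
      have htop := top_eq_of_index_eq hj hj' hs hs' h
      have : s = s' := by
        rw [lo, lo, htop] at h
        omega
      subst this
      have h1 : U.blk u j = U.blk u' j := by rw [blk, blk, htop]
      have h2 : U.blk u (j - 1) = U.blk u' (j - 1) := by
        rw [blk, blk, ← top_top hj (Nat.sub_le j 1), htop, top_top hj' (Nat.sub_le j 1)]
      have h3 : U.grain u j = U.grain u' j := by rw [grain, grain, h1, h2]
      rw [h1, h2, h3])
  refine ⟨t, ht, fun u j p hj => ?_⟩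
  have h0 := prev_div_grain_lt (T := T) (p := p) hj
  have e1 := hts ⟨(u, j, T.prev U u j p / U.grain u j), hj, by simp only; omega⟩
  have e2 := hts ⟨(u, j, T.prev U u j p / U.grain u j + 1), hj, h0⟩
  simp only [← add_assoc] at e1 e2
  rw [e1, e2]
  by_cases hj0 : j = 0
  · have : T.prev U u j p = 0 := if_pos hj0
    have h1 := U.card_blk_le (v := u) (i := j)
    simp only [hj0, if_true] at this h1 ⊢
    simp only [this, Nat.zero_div, if_true]
    refine ⟨Nat.zero_le _, ?_, ?_, ?_⟩
    · simpa using cnt_le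
    · simpa [slack] using h1
    · simp
  · simp only [if_neg hj0]
    have hsub := blk_subset hj (Nat.sub_le j 1)
    have hp : T.prev U u j p = cnt T.rk (U.blk u (j - 1)) p := if_neg hj0
    have hg := grain_pos hj
    set q := T.prev U u j p / U.grain u j with hq
    have hq1 : q * U.grain u j ≤ T.prev U u j p := Nat.div_mul_le_self _ _
    have hq2 : T.prev U u j p < (q + 1) * U.grain u j := by
      have := Nat.lt_mul_div_succ (T.prev U u j p) hg
      rwa [mul_comm] at this
    refine ⟨?_, ?_, ?_, ?_⟩
    · refine Finset.card_le_card fun x hx => ?_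
      rw [Finset.mem_filter] at hx ⊢
      refine ⟨hx.1, ?_⟩
      by_contra hlt
      have := cnt_mono (r := T.rk) (B := U.blk u (j - 1)) (not_lt.mp hlt)
      omega
    · refine Finset.card_le_card fun x hx => ?_
      rw [Finset.mem_filter] at hx ⊢
      refine ⟨hx.1, ?_⟩
      have := cnt_mono (r := T.rk) (B := U.blk u (j - 1)) hx.2.le
      omega
    · have h1 := T.card_blk_le_of_mem hsub (q * U.grain u j) (U.grain u j)
      have hsl : U.slack u j = U.grain u j := if_neg hj0
      rw [hsl]
      refine le_trans ?_ (Nat.add_le_add_left h1 _)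
      refine (Finset.card_le_card ?_).trans (Finset.card_union_le _ _)
      intro x hx
      rw [Finset.mem_union, Finset.mem_filter, Finset.mem_filter]
      rw [Finset.mem_filter] at hx
      have : (q + 1) * U.grain u j = q * U.grain u j + U.grain u j := by ring
      by_cases h : cnt T.rk (U.blk u (j - 1)) (T.rk x) < q * U.grain u j
      · exact Or.inl ⟨hx.1, h⟩
      · exact Or.inr ⟨hx.1, by omega, by omega⟩
    · exact Finset.card_filter_le _ _

/-- The leaves of the block of `u` of level `j` with ranks from `a` to below `b`. -/
noncomputable def band (u : Fin m') (j a b : ℕ) : Finset (Fin n) :=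
  (U.blk u j).filter fun x => a ≤ T.rk x ∧ T.rk x < b

variable {T U} in
theorem mem_band {u : Fin m'} {j a b : ℕ} {x : Fin n} :
    x ∈ T.band U u j a b ↔ x ∈ U.blk u j ∧ a ≤ T.rk x ∧ T.rk x < b := Finset.mem_filter

variable {T U} in
theorem band_nonempty_iff {u : Fin m'} {j a b : ℕ} :
    (T.band U u j a b).Nonempty ↔ cnt T.rk (U.blk u j) a < cnt T.rk (U.blk u j) b := by
  rw [cnt_lt_cnt_iff]
  exact ⟨fun ⟨x, hx⟩ => ⟨x, mem_band.mp hx⟩, fun ⟨x, hx⟩ => ⟨x, mem_band.mpr hx⟩⟩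

/-- From the gap of `pos v` to the gap of `sub v i`. -/
theorem exists_group_table (W : ℕ) (hW : 4 * n ≤ W) : ∃ t : ℕ → ℕ → ℕ → ℕ,
    (∀ i j x, t i j x < W) ∧ ∀ v i u j, i ≤ T.ld v → j ≤ U.ld u →
      (T.band U u j (T.sub v i) (T.pos v)).Nonempty →
      t i j (T.gap U u j (T.pos v)) = T.gap U u j (T.sub v i) := by
  have hn := T.n_pos
  obtain ⟨t, ht, hts⟩ := exists_table
    (α := {a : Fin m × ℕ × Fin m' × ℕ // a.2.1 ≤ T.ld a.1 ∧ a.2.2.2 ≤ U.ld a.2.2.1 ∧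
      (T.band U a.2.2.1 a.2.2.2 (T.sub a.1 a.2.1) (T.pos a.1)).Nonempty})
    (fun a => (a.1.2.1, a.1.2.2.2, T.gap U a.1.2.2.1 a.1.2.2.2 (T.pos a.1.1)))
    (fun a => T.gap U a.1.2.2.1 a.1.2.2.2 (T.sub a.1.1 a.1.2.1)) W (by omega)
    (fun a => by
      have := T.gap_lt (U := U) (u := a.1.2.2.1) (j := a.1.2.2.2) (p := T.sub a.1.1 a.1.2.1)
      omega)
    (by
      rintro ⟨⟨v, i, u, j⟩, hi, hj, hx⟩ ⟨⟨v', i', u', j'⟩, hi', hj', hx'⟩ h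
      simp only [Prod.mk.injEq] at h hj hj' hi hi' hx hx' ⊢
      obtain ⟨rfl, rfl, h⟩ := h
      obtain ⟨h1, -, h2, h3⟩ := top_eq_of_gap_eq hj hj' h
      obtain ⟨x, hx⟩ := hx
      obtain ⟨x', hx'⟩ := hx'
      rw [mem_band] at hx hx'
      rw [← h2] at hx'
      -- Since the gaps agree, no leaf of the list separates `pos v` from `pos v'`. So both
      -- witnesses precede both nodes, and the later one is not before either start.
      have key : ∃ y, T.sub v i ≤ T.rk y ∧ T.rk y < T.pos v ∧ T.sub v' i ≤ T.rk y ∧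
          T.rk y < T.pos v' := by
        have hp : T.rk x < T.pos v' := by
          by_contra hlt
          have := not_mem_of_cnt_eq h3.symm hx.1 (not_lt.mp hlt)
          omega
        have hp' : T.rk x' < T.pos v := by
          by_contra hlt
          have := not_mem_of_cnt_eq h3 hx'.1 (not_lt.mp hlt)
          omega
        rcases le_total (T.rk x) (T.rk x') with hle | hle
        · exact ⟨x', by omega, by omega, by omega, by omega⟩
        · exact ⟨x, by omega, by omega, by omega, by omega⟩
      obtain ⟨y, k1, k2, k3, k4⟩ := key
      have : T.sub v i = T.sub v' i := by
        rw [sub, sub, ← exl_eq_ex hi k1 k2, exl_eq_ex hi' k3 k4]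
      rw [this, gap, gap, h1, h2])
  exact ⟨t, ht, fun v i u j hi hj hx => hts ⟨(v, i, u, j), hi, hj, hx⟩⟩

/-- From the gap of `sub v i` to the gap of `lo v i`. -/
theorem exists_start_table (W : ℕ) (hW : 4 * n ≤ W) : ∃ t : ℕ → ℕ → ℕ → ℕ,
    (∀ i j x, t i j x < W) ∧ ∀ v i u j, i ≤ T.ld v → j ≤ U.ld u →
      (T.band U u j (T.lo v i) (T.sub v i)).Nonempty →
      t i j (T.gap U u j (T.sub v i)) = T.gap U u j (T.lo v i) := by
  have hn := T.n_pos
  obtain ⟨t, ht, hts⟩ := exists_table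
    (α := {a : Fin m × ℕ × Fin m' × ℕ // a.2.1 ≤ T.ld a.1 ∧ a.2.2.2 ≤ U.ld a.2.2.1 ∧
      (T.band U a.2.2.1 a.2.2.2 (T.lo a.1 a.2.1) (T.sub a.1 a.2.1)).Nonempty})
    (fun a => (a.1.2.1, a.1.2.2.2, T.gap U a.1.2.2.1 a.1.2.2.2 (T.sub a.1.1 a.1.2.1)))
    (fun a => T.gap U a.1.2.2.1 a.1.2.2.2 (T.lo a.1.1 a.1.2.1)) W (by omega)
    (fun a => by
      have := T.gap_lt (U := U) (u := a.1.2.2.1) (j := a.1.2.2.2) (p := T.lo a.1.1 a.1.2.1)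
      omega)
    (by
      rintro ⟨⟨v, i, u, j⟩, hi, hj, hx⟩ ⟨⟨v', i', u', j'⟩, hi', hj', hx'⟩ h
      simp only [Prod.mk.injEq] at h hj hj' hi hi' hx hx' ⊢
      obtain ⟨rfl, rfl, h⟩ := h
      obtain ⟨h1, -, h2, h3⟩ := top_eq_of_gap_eq hj hj' h
      obtain ⟨x, hx⟩ := hx
      obtain ⟨x', hx'⟩ := hx'
      rw [mem_band] at hx hx'
      rw [← h2] at hx'
      have q1 := (lo_le_sub hi).trans ((sub_le_pos hi).trans (pos_lt_hi hi).le)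
      have q2 := (sub_le_pos hi).trans_lt (pos_lt_hi hi)
      have q3 := (sub_le_pos hi').trans_lt (pos_lt_hi hi')
      -- Blocks of one level that share a leaf have the same top, so a common leaf suffices.
      have key : ∃ y, y ∈ T.blk v i ∧ y ∈ T.blk v' i := by
        have hp : T.rk x < T.sub v' i := by
          by_contra hlt
          have := not_mem_of_cnt_eq h3.symm hx.1 (not_lt.mp hlt)
          omega
        have hp' : T.rk x' < T.sub v i := by
          by_contra hlt
          have := not_mem_of_cnt_eq h3 hx'.1 (not_lt.mp hlt)
          omega
        rcases le_total (T.rk x) (T.rk x') with hle | hle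
        · exact ⟨x', mem_blk.mpr ⟨by omega, by omega⟩, mem_blk.mpr ⟨by omega, by omega⟩⟩
        · exact ⟨x, mem_blk.mpr ⟨by omega, by omega⟩, mem_blk.mpr ⟨by omega, by omega⟩⟩
      obtain ⟨y, k1, k2⟩ := key
      have : T.lo v i = T.lo v' i := by rw [lo, lo, top_eq_of_mem_blk hi hi' k1 k2]
      rw [this, gap, gap, h1, h2])
  exact ⟨t, ht, fun v i u j hi hj hx => hts ⟨(v, i, u, j), hi, hj, hx⟩⟩

-- The bands start at the same gap of the same list. The witness of smaller rank lies in both blocks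
-- of `T`, so the tops agree, and with them the ends of the bands. Whatever is computed from a band
-- may thus be tabulated by levels and gap.
variable {T U} in
theorem band_eq_of_gap_eq {v v' : Fin m} {u u' : Fin m'} {i j : ℕ} (hi : i ≤ T.ld v)
    (hi' : i ≤ T.ld v') (hj : j ≤ U.ld u) (hj' : j ≤ U.ld u')
    (hx : (T.band U u j (T.sub v i) (T.hi v i)).Nonempty)
    (hx' : (T.band U u' j (T.sub v' i) (T.hi v' i)).Nonempty)
    (h : T.gap U u j (T.sub v i) = T.gap U u' j (T.sub v' i)) :
    T.band U u j (T.sub v i) (T.hi v i) = T.band U u' j (T.sub v' i) (T.hi v' i) ∧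
      T.top v i = T.top v' i := by
  obtain ⟨h1, -, h2, h3⟩ := top_eq_of_gap_eq hj hj' h
  obtain ⟨x, hx⟩ := hx
  obtain ⟨x', hx'⟩ := hx'
  rw [mem_band] at hx hx'
  rw [← h2] at hx'
  have hp := not_mem_of_cnt_eq h3 hx.1 hx.2.1
  have hp' := not_mem_of_cnt_eq h3.symm hx'.1 hx'.2.1
  have q1 := lo_le_sub hi
  have q2 := lo_le_sub hi'
  have key : ∃ y, y ∈ T.blk v i ∧ y ∈ T.blk v' i := by
    rcases le_total (T.rk x) (T.rk x') with hle | hle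
    · exact ⟨x, mem_blk.mpr ⟨by omega, by omega⟩, mem_blk.mpr ⟨by omega, by omega⟩⟩
    · exact ⟨x', mem_blk.mpr ⟨by omega, by omega⟩, mem_blk.mpr ⟨by omega, by omega⟩⟩
  obtain ⟨y, k1, k2⟩ := key
  have htop := top_eq_of_mem_blk hi hi' k1 k2
  refine ⟨Finset.ext fun z => ?_, htop⟩
  have hhi : T.hi v i = T.hi v' i := by rw [WeightedTree.hi, WeightedTree.hi, htop]
  rw [mem_band, mem_band, ← h2, hhi]
  constructor
  · rintro ⟨a, b, c⟩
    exact ⟨a, not_mem_of_cnt_eq h3 a b, c⟩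
  · rintro ⟨a, b, c⟩
    exact ⟨a, not_mem_of_cnt_eq h3.symm a b, c⟩

open Classical in
/-- The element of maximal rank (in `U`) of a nonempty set of leaves. -/
noncomputable def last (d : Fin n) (s : Finset (Fin n)) : Fin n :=
  if h : s.Nonempty then (s.exists_max_image U.rk h).choose else d

variable {U} in
theorem last_mem {d : Fin n} {s : Finset (Fin n)} (h : s.Nonempty) : U.last d s ∈ s := by
  rw [last, dif_pos h]
  exact (s.exists_max_image U.rk h).choose_spec.1

variable {U} in
theorem le_last {d x : Fin n} {s : Finset (Fin n)} (hx : x ∈ s) : U.rk x ≤ U.rk (U.last d s) := by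
  have h : s.Nonempty := ⟨x, hx⟩
  rw [last, dif_pos h]
  exact (s.exists_max_image U.rk h).choose_spec.2 x hx

/-- The last leaf, with respect to `U`, of the block of `u` that is below `ex v i`. -/
noncomputable def best (v : Fin m) (i : ℕ) (u : Fin m') (j : ℕ) : Fin n :=
  U.last ⟨0, T.n_pos⟩ (T.band U u j (T.sub v i) (T.hi v i))

theorem exists_best_table (W : ℕ) (hW : 2 * n ≤ W) : ∃ t : ℕ → ℕ → ℕ → ℕ,
    (∀ i j x, t i j x < W) ∧ ∀ v i u j, i ≤ T.ld v → j ≤ U.ld u →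
      (T.band U u j (T.sub v i) (T.hi v i)).Nonempty →
      t i j (T.gap U u j (T.sub v i)) = U.exl (T.best U v i u j) j := by
  have hn := T.n_pos
  have hm := U.card_nodes_le
  obtain ⟨t, ht, hts⟩ := exists_table
    (α := {a : Fin m × ℕ × Fin m' × ℕ // a.2.1 ≤ T.ld a.1 ∧ a.2.2.2 ≤ U.ld a.2.2.1 ∧
      (T.band U a.2.2.1 a.2.2.2 (T.sub a.1 a.2.1) (T.hi a.1 a.2.1)).Nonempty})
    (fun a => (a.1.2.1, a.1.2.2.2, T.gap U a.1.2.2.1 a.1.2.2.2 (T.sub a.1.1 a.1.2.1)))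
    (fun a => U.exl (T.best U a.1.1 a.1.2.1 a.1.2.2.1 a.1.2.2.2) a.1.2.2.2) W (by omega)
    (fun a => by
      have := (U.exl (T.best U a.1.1 a.1.2.1 a.1.2.2.1 a.1.2.2.2) a.1.2.2.2).2
      omega)
    (by
      rintro ⟨⟨v, i, u, j⟩, hi, hj, hx⟩ ⟨⟨v', i', u', j'⟩, hi', hj', hx'⟩ h
      simp only [Prod.mk.injEq] at h hj hj' hi hi' hx hx' ⊢
      obtain ⟨rfl, rfl, h⟩ := h
      rw [best, best, (band_eq_of_gap_eq hi hi' hj hj' hx hx' h).1])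
  exact ⟨t, ht, fun v i u j hi hj hx => hts ⟨(v, i, u, j), hi, hj, hx⟩⟩

/-- From the gap of `sub v i` to the gap, in the other order, after the best leaf. -/
theorem exists_cross_table (W : ℕ) (hW : 4 * n ≤ W) : ∃ t : ℕ → ℕ → ℕ → ℕ,
    (∀ i j x, t i j x < W) ∧ ∀ v i u j, i ≤ T.ld v → j ≤ U.ld u →
      (T.band U u j (T.sub v i) (T.hi v i)).Nonempty →
      t j i (T.gap U u j (T.sub v i)) = U.gap T v i (U.rk (T.best U v i u j) + 1) := by
  have hn := T.n_pos
  obtain ⟨t, ht, hts⟩ := exists_table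
    (α := {a : Fin m × ℕ × Fin m' × ℕ // a.2.1 ≤ T.ld a.1 ∧ a.2.2.2 ≤ U.ld a.2.2.1 ∧
      (T.band U a.2.2.1 a.2.2.2 (T.sub a.1 a.2.1) (T.hi a.1 a.2.1)).Nonempty})
    (fun a => (a.1.2.2.2, a.1.2.1, T.gap U a.1.2.2.1 a.1.2.2.2 (T.sub a.1.1 a.1.2.1)))
    (fun a => U.gap T a.1.1 a.1.2.1
      (U.rk (T.best U a.1.1 a.1.2.1 a.1.2.2.1 a.1.2.2.2) + 1)) W (by omega)
    (fun a => by
      have := U.gap_lt (U := T) (u := a.1.1) (j := a.1.2.1)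
        (p := U.rk (T.best U a.1.1 a.1.2.1 a.1.2.2.1 a.1.2.2.2) + 1)
      omega)
    (by
      rintro ⟨⟨v, i, u, j⟩, hi, hj, hx⟩ ⟨⟨v', i', u', j'⟩, hi', hj', hx'⟩ h
      simp only [Prod.mk.injEq] at h hj hj' hi hi' hx hx' ⊢
      obtain ⟨rfl, rfl, h⟩ := h
      obtain ⟨h1, h2⟩ := band_eq_of_gap_eq hi hi' hj hj' hx hx' h
      rw [best, best, h1, gap, gap, blk, blk, lo, lo, h2])
  exact ⟨t, ht, fun v i u j hi hj hx => hts ⟨(v, i, u, j), hi, hj, hx⟩⟩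

/-- The exits of the leaves, by their position in the lists of leaves. -/
theorem exists_slots : ∃ e : ℕ → ℕ → ℕ → Fin m × Fin m', ∀ x i j, i ≤ T.ld (T.leaf x) →
    j ≤ U.ld (U.leaf x) → ∀ u, j ≤ U.ld u → x ∈ U.blk u j →
      e i j (T.gap U u j (T.rk x)) = (T.exl x i, U.exl x j) := by
  let α := {a : Fin n × ℕ × ℕ // a.2.1 ≤ T.ld (T.leaf a.1) ∧ a.2.2 ≤ U.ld (U.leaf a.1)}
  let key : α → ℕ × ℕ × ℕ := fun a =>
    (a.1.2.1, a.1.2.2, T.gap U (U.leaf a.1.1) a.1.2.2 (T.rk a.1.1))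
  let val : α → Fin m × Fin m' := fun a => (T.exl a.1.1 a.1.2.1, U.exl a.1.1 a.1.2.2)
  have hwd : Function.FactorsThrough val key := by
    rintro ⟨⟨x, i, j⟩, hi, hj⟩ ⟨⟨x', i', j'⟩, hi', hj'⟩ h
    simp only [key, val, Prod.mk.injEq] at h hi hi' hj hj' ⊢
    obtain ⟨rfl, rfl, h⟩ := h
    obtain ⟨-, -, h2, h3⟩ := top_eq_of_gap_eq hj hj' h
    -- The gap just before a leaf determines the leaf within its list.
    have := eq_of_cnt_eq T.rk_injective (mem_blk_leaf hj) (h2 ▸ mem_blk_leaf hj') h3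
    subst this
    exact ⟨rfl, rfl⟩
  refine ⟨fun i j s => Function.extend key val (fun _ => (T.root, U.root)) (i, j, s), ?_⟩
  intro x i j hi hj u hu hx
  have h1 : T.gap U u j (T.rk x) = T.gap U (U.leaf x) j (T.rk x) := by
    have := top_leaf_of_mem_blk hu hx
    rw [gap, gap, blk, blk, lo, lo, this]
  rw [h1]
  exact hwd.extend_apply _ ⟨(x, i, j), hi, hj⟩

end WeightedTree

/-! ### Structured programs -/

/-- The variables that exist for each of the two trees. -/
inductive SVar where
  | node | dep | pos | off | lvl | ex | sub | lo | hi | gap | has | mx | best | cnd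

def SVar.idx : SVar → ℕ
  | node => 0 | dep => 1 | pos => 2 | off => 3 | lvl => 4 | ex => 5 | sub => 6 | lo => 7
  | hi => 8 | gap => 9 | has => 10 | mx => 11 | best => 12 | cnd => 13

/-- The variables of the query program. -/
inductive Var where
  | zero | j | lim | base | l | h | mid | t | k | c | bb | n2 | kk | up | jj
  | s (b : Bool) (x : SVar)

/-- The `node` variables get the registers `0` and `1`, which hold the query at the start and the
answer at the end. -/
def Var.idx : Var → ℕ
  | .s b x => 2 * x.idx + b.toNat
  | zero => 28 | j => 29 | lim => 30 | base => 31 | l => 32 | h => 33 | mid => 34 | t => 35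
  | k => 36 | c => 37 | bb => 38 | n2 => 39 | kk => 40 | up => 41 | jj => 42

theorem SVar.idx_injective : Function.Injective SVar.idx := by
  intro x y h
  cases x <;> cases y <;> first | rfl | cases h

theorem SVar.idx_lt (x : SVar) : x.idx < 14 := by cases x <;> decide

theorem Var.idx_injective : Function.Injective Var.idx := by
  intro x y h
  have key : ∀ (b : Bool) (x : SVar), 2 * x.idx + b.toNat < 28 := fun b x => by
    have := x.idx_lt
    have := b.toNat_le
    omega
  cases x with
  | s b x =>
    cases y with
    | s b' y =>
      simp only [Var.idx] at h
      have h1 := b.toNat_le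
      have h2 := b'.toNat_le
      have h3 : b = b' := by
        cases b <;> cases b' <;> simp only [Bool.toNat_true, Bool.toNat_false] at h <;>
          first | rfl | omega
      subst h3
      rw [SVar.idx_injective (show x.idx = y.idx by omega)]
    | _ => have := key b x; simp only [Var.idx] at h; omega
  | _ =>
    cases y with
    | s b' y => have := key b' y; simp only [Var.idx] at h; omega
    | _ => first | rfl | cases h

theorem Var.idx_lt (x : Var) : x.idx < 100 := by
  cases x with
  | s b x =>
    have := x.idx_lt
    have := b.toNat_le
    simp only [Var.idx]
    omega
  | _ => decide

open Classical in
noncomputable instance : DecidableEq Var := Classical.decEq _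

/-- The tables that exist for each of the two trees. -/
inductive STab where
  | ex | sub | lo | hi | pos | ld | select | grain | locate | group | best

def STab.idx : STab → ℕ
  | ex => 0 | sub => 1 | lo => 2 | hi => 3 | pos => 4 | ld => 5 | select => 6 | grain => 7
  | locate => 8 | group => 9 | best => 10

/-- The tables in memory. -/
inductive Tab where
  | par | cross | start | seg (b : Bool) | sparse (b : Bool) | log | pow
  | s (b : Bool) (x : STab)

/-- `par` has number `0`, so its first entries are the first words of the memory and can be read
before `K` and `W` are known. -/
def Tab.idx : Tab → ℕ
  | par => 0 | cross => 1 | start => 2 | seg b => 3 + b.toNat | sparse b => 5 + b.toNat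
  | log => 7 | pow => 8 | .s b x => 9 + 2 * x.idx + b.toNat

theorem Tab.idx_lt (t : Tab) : t.idx < 31 := by
  cases t with
  | s b x => cases b <;> cases x <;> decide
  | seg b => cases b <;> decide
  | sparse b => cases b <;> decide
  | _ => decide

/-- The inverse of `Tab.idx`. -/
def Tab.ofIdx (k : ℕ) : Tab :=
  if k = 0 then par else if k = 1 then cross else if k = 2 then start
  else if k < 5 then seg (k == 4) else if k < 7 then sparse (k == 6)
  else if k = 7 then log else if k = 8 then pow
  else .s (k % 2 == 0) (match (k - 9) / 2 with
    | 0 => .ex | 1 => .sub | 2 => .lo | 3 => .hi | 4 => .pos | 5 => .ld | 6 => .select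
    | 7 => .grain | 8 => .locate | 9 => .group | _ => .best)

theorem Tab.ofIdx_idx (t : Tab) : Tab.ofIdx t.idx = t := by
  cases t with
  | s b x => cases b <;> cases x <;> rfl
  | seg b => cases b <;> rfl
  | sparse b => cases b <;> rfl
  | _ => rfl

/-- The number of a scratch table. -/
def scrIdx (b : Bool) : ℕ := 31 + b.toNat

/-- The number of tables. -/
def numTabs : ℕ := 33

/-- Word expressions. -/
inductive Ex where
  | lit (k : ℕ)
  | var (x : Var)
  | bin (o : WordOp) (a b : Ex)
  | tab (t : Tab) (a b c : Ex)
  | scr (b : Bool) (e : Ex)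

abbrev Ex.s (b : Bool) (x : SVar) : Ex := .var (.s b x)
abbrev Ex.j : Ex := .var .j
abbrev Ex.l : Ex := .var .l
abbrev Ex.h : Ex := .var .h
abbrev Ex.mid : Ex := .var .mid
abbrev Ex.t : Ex := .var .t
abbrev Ex.up : Ex := .var .up

/-- The value of a variable. -/
abbrev rd (x : Var) : Ex := .var x

instance : Add Ex := ⟨Ex.bin .add⟩
instance : Sub Ex := ⟨Ex.bin .sub⟩
instance : Mul Ex := ⟨Ex.bin .mul⟩
instance : Div Ex := ⟨Ex.bin .div⟩
instance : Mod Ex := ⟨Ex.bin .mod⟩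
instance (k : ℕ) : OfNat Ex k := ⟨Ex.lit k⟩

/-- Structured loop-free commands. -/
inductive Cmd where
  | skip
  | asg (x : Var) (e : Ex)
  | setScr (b : Bool) (a e : Ex)
  | seq (p q : Cmd)
  | ite (a b : Ex) (p q : Cmd)
  | loadW (d : ℕ) (e : Ex)
  | copyW (d s : ℕ)
  | addW (d a b : ℕ)
  | iteW (a b : ℕ) (p q : Cmd)

infixr:60 ";;" => Cmd.seq
infix:61 "≔" => Cmd.asg

/-- `t := t o (t + 1)` after computing the operands. -/
def binP (o : WordOp) (t : ℕ) (p q : Prog) : Prog := .seq p (.seq q (.op o t t (t + 1)))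

/-- Register `100` holds the number of levels and register `101` the table width. -/
def addrP (t : ℕ) (k : ℕ) (a b c : Prog) : Prog :=
  binP .add t (binP .mul t (binP .add t (binP .mul t (binP .add t (binP .mul t (.const t k)
    (.copy (t + 1) 100)) a) (.copy (t + 1) 100)) b) (.copy (t + 1) 101)) c

/-- Evaluation of an expression into register `t`. -/
def Ex.comp : Ex → ℕ → Prog
  | lit k, t => .const t k
  | var x, t => .copy t x.idx
  | bin o a b, t => binP o t (a.comp t) (b.comp (t + 1))
  | tab T a b c, t =>
    .seq (addrP t T.idx (a.comp (t + 1)) (b.comp (t + 1)) (c.comp (t + 1))) (.load t t)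
  | scr b e, t =>
    .seq (addrP t (scrIdx b) (.const (t + 1) 0) (.const (t + 1) 0) (e.comp (t + 1))) (.load t t)

def Ex.cost : Ex → ℕ
  | lit _ => 1
  | var _ => 1
  | bin _ a b => a.cost + (b.cost + 1)
  | tab _ a b c => a.cost + b.cost + c.cost + 11
  | scr _ e => e.cost + 13

def Cmd.comp : Cmd → Prog
  | skip => .skip
  | asg x e => .seq (e.comp 102) (.copy x.idx 102)
  | setScr b a e => .seq (addrP 102 (scrIdx b) (.const 103 0) (.const 103 0) (a.comp 103))
      (.seq (e.comp 103) (.store 102 103))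
  | seq p q => .seq p.comp q.comp
  | ite a b p q => .seq (a.comp 102) (.seq (b.comp 103) (.cond (.wordLt 102 103) p.comp q.comp))
  | loadW d e => .seq (e.comp 102) (.loadWeight d 102)
  | copyW d s => .copyWeight d s
  | addW d a b => .addWeight d a b
  | iteW a b p q => .cond (.weightLt a b) p.comp q.comp

def Cmd.cost : Cmd → ℕ
  | skip => 1
  | asg _ e => e.cost + 1
  | setScr _ a e => a.cost + e.cost + 13
  | seq p q => p.cost + q.cost
  | ite a b p q => a.cost + (b.cost + (1 + max p.cost q.cost))
  | loadW _ e => e.cost + 1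
  | copyW _ _ => 1
  | addW _ _ _ => 1
  | iteW _ _ p q => 1 + max p.cost q.cost

/-! ### Semantics of structured programs -/

/-- The address of an entry of a table. -/
def addr (K W t i j x : ℕ) : ℕ := ((t * K + i) * K + j) * W + x

theorem eq_of_mul_add_eq {W a b x y : ℕ} (hx : x < W) (hy : y < W) (h : a * W + x = b * W + y) :
    a = b ∧ x = y := by
  have hW : 0 < W := by omega
  have h1 : (a * W + x) / W = a := by
    rw [mul_comm, Nat.mul_add_div hW, Nat.div_eq_of_lt hx, add_zero]
  have h2 : (b * W + y) / W = b := by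
    rw [mul_comm, Nat.mul_add_div hW, Nat.div_eq_of_lt hy, add_zero]
  have h3 : a = b := by rw [← h1, h, h2]
  subst h3
  exact ⟨rfl, by omega⟩

theorem addr_inj {K W t i j x t' i' j' x' : ℕ} (hi : i < K) (hj : j < K) (hx : x < W)
    (hi' : i' < K) (hj' : j' < K) (hx' : x' < W)
    (h : addr K W t i j x = addr K W t' i' j' x') : t = t' ∧ i = i' ∧ j = j' ∧ x = x' := by
  obtain ⟨h1, h2⟩ := eq_of_mul_add_eq hx hx' h
  obtain ⟨h3, h4⟩ := eq_of_mul_add_eq hj hj' h1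
  obtain ⟨h5, h6⟩ := eq_of_mul_add_eq hi hi' h3
  exact ⟨h5, h6, h4, h2⟩

theorem mul_add_lt {W a x b : ℕ} (hx : x < W) (ha : a < b) : a * W + x < b * W := by
  have : (a + 1) * W ≤ b * W := Nat.mul_le_mul_right _ ha
  rw [add_mul, one_mul] at this
  omega

theorem addr_lt {K W t i j x : ℕ} (ht : t < numTabs) (hi : i < K) (hj : j < K) (hx : x < W) :
    addr K W t i j x < numTabs * K * K * W :=
  mul_add_lt hx (mul_add_lt hj (mul_add_lt hi ht))

/-- The unchanging part of the memory. -/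
structure Env (w : ℕ) where
  D : Storage w
  K : ℕ
  W : ℕ
  tab : Tab → ℕ → ℕ → ℕ → ℕ
  K_pos : 0 < K
  numWords_eq : D.numWords = numTabs * K * K * W
  fits : numTabs * K * K * W < 2 ^ w
  word_eq : ∀ t i j x, i < K → j < K → x < W →
    (D.word (addr K W t.idx i j x)).toNat = tab t i j x

/-- The values of the variables, the scratch memory and the weight registers. -/
structure AState where
  r : Var → ℕ
  scr : Bool → ℕ → ℕ
  f : ℕ → ℝ

namespace AState

noncomputable def set (A : AState) (x : Var) (v : ℕ) : AState :=
  { A with r := fun y => if y = x then v else A.r y }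

def setScr (A : AState) (b : Bool) (a v : ℕ) : AState :=
  { A with scr := fun b' a' => if b' = b ∧ a' = a then v else A.scr b' a' }

def setF (A : AState) (d : ℕ) (v : ℝ) : AState :=
  { A with f := fun i => if i = d then v else A.f i }

@[simp] theorem set_r (A : AState) (x y : Var) (v : ℕ) :
    (A.set x v).r y = if y = x then v else A.r y := rfl
@[simp] theorem set_scr (A : AState) (x : Var) (v : ℕ) : (A.set x v).scr = A.scr := rfl
@[simp] theorem set_f (A : AState) (x : Var) (v : ℕ) : (A.set x v).f = A.f := rfl
@[simp] theorem setScr_r (A : AState) (b : Bool) (a v : ℕ) : (A.setScr b a v).r = A.r := rfl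
@[simp] theorem setScr_scr (A : AState) (b b' : Bool) (a a' v : ℕ) :
    (A.setScr b a v).scr b' a' = if b' = b ∧ a' = a then v else A.scr b' a' := rfl
@[simp] theorem setScr_f (A : AState) (b : Bool) (a v : ℕ) : (A.setScr b a v).f = A.f := rfl
@[simp] theorem setF_r (A : AState) (d : ℕ) (v : ℝ) : (A.setF d v).r = A.r := rfl
@[simp] theorem setF_scr (A : AState) (d : ℕ) (v : ℝ) : (A.setF d v).scr = A.scr := rfl
@[simp] theorem setF_f (A : AState) (d i : ℕ) (v : ℝ) :
    (A.setF d v).f i = if i = d then v else A.f i := rfl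

end AState

/-- Operations on natural numbers. -/
def WordOp.nat : WordOp → ℕ → ℕ → ℕ
  | .add, x, y => x + y
  | .sub, x, y => x - y
  | .mul, x, y => x * y
  | .div, x, y => x / y
  | .mod, x, y => x % y
  | _, _, _ => 0

/-- The operation on words agrees with that on natural numbers. -/
def WordOp.Ok (w : ℕ) : WordOp → ℕ → ℕ → Prop
  | .add, x, y => x + y < 2 ^ w
  | .sub, x, y => y ≤ x
  | .mul, x, y => x * y < 2 ^ w
  | .div, _, _ => True
  | .mod, _, _ => True
  | _, _, _ => False

theorem WordOp.toNat_eval {w : ℕ} (o : WordOp) (x y : BitVec w) (h : o.Ok w x.toNat y.toNat) :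
    (o.eval x y).toNat = o.nat x.toNat y.toNat := by
  cases o with
  | add => simp only [WordOp.eval, WordOp.nat, BitVec.toNat_add]; exact Nat.mod_eq_of_lt h
  | sub =>
    simp only [WordOp.eval, WordOp.nat]
    exact BitVec.toNat_sub_of_le (BitVec.le_def.mpr h)
  | mul => simp only [WordOp.eval, WordOp.nat, BitVec.toNat_mul]; exact Nat.mod_eq_of_lt h
  | div => simp [WordOp.eval, WordOp.nat]
  | mod => simp [WordOp.eval, WordOp.nat]
  | _ => exact h.elim

section semantics

variable {w : ℕ} (E : Env w)

/-- The value of an expression. -/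
def Ex.val (A : AState) : Ex → ℕ
  | lit k => k
  | var x => A.r x
  | bin o a b => o.nat (a.val A) (b.val A)
  | tab t a b c => E.tab t (a.val A) (b.val A) (c.val A)
  | scr b e => A.scr b (e.val A)

/-- The evaluation of an expression succeeds without overflow. -/
def Ex.Ok (A : AState) : Ex → Prop
  | lit k => k < 2 ^ w
  | var _ => True
  | bin o a b => a.Ok A ∧ b.Ok A ∧ o.Ok w (a.val E A) (b.val E A)
  | tab _ a b c => a.Ok A ∧ b.Ok A ∧ c.Ok A ∧ a.val E A < E.K ∧ b.val E A < E.K ∧ c.val E A < E.W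
  | scr _ e => e.Ok A ∧ e.val E A < E.W

/-- The weakest precondition of a command. -/
def Cmd.wp : Cmd → (AState → Prop) → AState → Prop
  | skip, Q, A => Q A
  | asg x e, Q, A => e.Ok E A ∧ Q (A.set x (e.val E A))
  | setScr b a e, Q, A =>
    a.Ok E A ∧ e.Ok E A ∧ a.val E A < E.W ∧ Q (A.setScr b (a.val E A) (e.val E A))
  | seq p q, Q, A => p.wp (q.wp Q) A
  | ite a b p q, Q, A => a.Ok E A ∧ b.Ok E A ∧ (a.val E A < b.val E A → p.wp Q A) ∧
    (¬ a.val E A < b.val E A → q.wp Q A)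
  | loadW d e, Q, A =>
    e.Ok E A ∧ e.val E A < E.D.numWeights ∧ Q (A.setF d (E.D.weight (e.val E A)))
  | copyW d s, Q, A => Q (A.setF d (A.f s))
  | addW d a b, Q, A => Q (A.setF d (A.f a + A.f b))
  | iteW a b p q, Q, A => (A.f a < A.f b → p.wp Q A) ∧ (¬ A.f a < A.f b → q.wp Q A)

/-- The machine state `s` is described by `A`. -/
structure Rep (A : AState) (s : State w) : Prop where
  reg : ∀ x : Var, (s.reg x.idx).toNat = A.r x
  regK : (s.reg 100).toNat = E.K
  regW : (s.reg 101).toNat = E.W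
  wreg : s.wreg = A.f
  numWords : s.mem.numWords = E.D.numWords
  numWeights : s.mem.numWeights = E.D.numWeights
  weight : s.mem.weight = E.D.weight
  word : ∀ a, (∀ b x, x < E.W → a ≠ addr E.K E.W (scrIdx b) 0 0 x) → s.mem.word a = E.D.word a
  scr : ∀ b x, x < E.W → (s.mem.word (addr E.K E.W (scrIdx b) 0 0 x)).toNat = A.scr b x

/-- The states agree except for the registers from `t` on. -/
structure Agree (t : ℕ) (s s' : State w) : Prop where
  reg : ∀ x < t, s'.reg x = s.reg x
  mem : s'.mem = s.mem
  wreg : s'.wreg = s.wreg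

/-! ### Correctness and cost of compiled expressions and commands. -/

variable {E}

theorem Agree.trans {t t' : ℕ} {s s' s'' : State w} (h : Agree t s s') (h' : Agree t' s' s'')
    (ht : t ≤ t') : Agree t s s'' :=
  ⟨fun x hx => (h'.reg x (by omega)).trans (h.reg x hx), h'.mem.trans h.mem, h'.wreg.trans h.wreg⟩

theorem Rep.agree {A : AState} {t : ℕ} {s s' : State w} (h : Rep E A s) (ha : Agree t s s')
    (ht : 102 ≤ t) : Rep E A s' where
  reg x := by rw [ha.reg _ (by have := x.idx_lt; omega)]; exact h.reg x
  regK := by rw [ha.reg _ (by omega)]; exact h.regK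
  regW := by rw [ha.reg _ (by omega)]; exact h.regW
  wreg := ha.wreg.trans h.wreg
  numWords := by rw [ha.mem]; exact h.numWords
  numWeights := by rw [ha.mem]; exact h.numWeights
  weight := by rw [ha.mem]; exact h.weight
  word := by rw [ha.mem]; exact h.word
  scr := by rw [ha.mem]; exact h.scr

/-- The program `p` computes the value `v` into register `t` in time `c`. -/
def Computes (p : Prog) (t : ℕ) (s : State w) (v c : ℕ) : Prop :=
  ∃ s', Exec p s c s' ∧ Agree t s s' ∧ (s'.reg t).toNat = v

theorem Computes.const {t k : ℕ} {s : State w} (hk : k < 2 ^ w) :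
    Computes (.const t k) t s k 1 := by
  refine ⟨_, Exec.const s t k, ⟨fun x hx => ?_, rfl, rfl⟩, ?_⟩
  · exact Function.update_of_ne (by omega) _ _
  · simp [State.setReg, Nat.mod_eq_of_lt hk]

theorem Computes.copy {t r : ℕ} {s : State w} :
    Computes (.copy t r) t s (s.reg r).toNat 1 := by
  refine ⟨_, Exec.copy s t r, ⟨fun x hx => ?_, rfl, rfl⟩, ?_⟩
  · exact Function.update_of_ne (by omega) _ _
  · simp [State.setReg]

/-- The second operand only uses the registers from `t + 1` on, so the first one survives in
register `t`. -/
theorem Computes.bin {o : WordOp} {t v v' c c' : ℕ} {s : State w} {p q : Prog}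
    (hp : Computes p t s v c) (hq : ∀ s', Agree t s s' → Computes q (t + 1) s' v' c')
    (hok : o.Ok w v v') : Computes (binP o t p q) t s (o.nat v v') (c + (c' + 1)) := by
  obtain ⟨s1, h1, a1, e1⟩ := hp
  obtain ⟨s2, h2, a2, e2⟩ := hq s1 a1
  have e3 : (s2.reg t).toNat = v := by rw [a2.reg t (Nat.lt_succ_self t), e1]
  refine ⟨_, Exec.seq h1 (Exec.seq h2 (Exec.op s2 o t t (t + 1))), ⟨fun x hx => ?_, ?_, ?_⟩, ?_⟩
  · have := (a1.trans a2 (Nat.le_succ t)).reg x hx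
    simpa [State.setReg, Function.update_of_ne (show x ≠ t by omega)] using this
  · exact (a1.trans a2 (Nat.le_succ t)).mem
  · exact (a1.trans a2 (Nat.le_succ t)).wreg
  · simp only [State.setReg, Function.update_self]
    rw [WordOp.toNat_eval, e3, e2]
    rwa [e3, e2]

theorem Computes.load {t v c : ℕ} {s : State w} {p : Prog} (hp : Computes p t s v c)
    (hv : v < s.mem.numWords) :
    Computes (.seq p (.load t t)) t s (s.mem.word v).toNat (c + 1) := by
  obtain ⟨s1, h1, a1, e1⟩ := hp
  refine ⟨_, Exec.seq h1 (Exec.load s1 t t (by rw [e1, a1.mem]; exact hv)),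
    ⟨fun x hx => ?_, a1.mem, a1.wreg⟩, ?_⟩
  · have := a1.reg x hx
    simpa [State.setReg, Function.update_of_ne (show x ≠ t by omega)] using this
  · simp only [State.setReg, Function.update_self]
    rw [e1, a1.mem]

theorem Computes.addr {A : AState} {s : State w} {t k i j x ca cb cc : ℕ} {a b c : Prog}
    (ht : 102 ≤ t) (hs : Rep E A s) (hk : k < numTabs) (hi : i < E.K) (hj : j < E.K) (hx : x < E.W)
    (ha : ∀ s', Rep E A s' → Computes a (t + 1) s' i ca)
    (hb : ∀ s', Rep E A s' → Computes b (t + 1) s' j cb)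
    (hc : ∀ s', Rep E A s' → Computes c (t + 1) s' x cc) :
    Computes (addrP t k a b c) t s (addr E.K E.W k i j x) (ca + cb + cc + 10) := by
  have hlt := E.fits
  have hK : 0 < E.K := by omega
  have hW : 0 < E.W := by omega
  have k1 : k * E.K + i < numTabs * E.K := mul_add_lt hi hk
  have k2 : (k * E.K + i) * E.K + j < numTabs * E.K * E.K := mul_add_lt hj k1
  have k3 : ((k * E.K + i) * E.K + j) * E.W + x < numTabs * E.K * E.K * E.W := mul_add_lt hx k2
  have m2 : numTabs * E.K * E.K ≤ numTabs * E.K * E.K * E.W := Nat.le_mul_of_pos_right _ hW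
  have m1 : numTabs * E.K ≤ numTabs * E.K * E.K := Nat.le_mul_of_pos_right _ hK
  have m0 : numTabs ≤ numTabs * E.K := Nat.le_mul_of_pos_right _ hK
  have cK : ∀ s', Agree t s s' → Computes (.copy (t + 1) 100) (t + 1) s' E.K 1 := by
    intro s' ha
    rw [← (hs.agree ha ht).regK]
    exact Computes.copy
  have cW : ∀ s', Agree t s s' → Computes (.copy (t + 1) 101) (t + 1) s' E.W 1 := by
    intro s' ha
    rw [← (hs.agree ha ht).regW]
    exact Computes.copy
  have h1 := Computes.bin (o := .mul) (Computes.const (t := t) (s := s) (k := k) (by omega)) cK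
    (show k * E.K < 2 ^ w by omega)
  have h2 := Computes.bin (o := .add) h1 (fun s' h => ha s' (hs.agree h ht))
    (show k * E.K + i < 2 ^ w by omega)
  have h3 := Computes.bin (o := .mul) h2 cK (show (k * E.K + i) * E.K < 2 ^ w by omega)
  have h4 := Computes.bin (o := .add) h3 (fun s' h => hb s' (hs.agree h ht))
    (show (k * E.K + i) * E.K + j < 2 ^ w by omega)
  have h5 := Computes.bin (o := .mul) h4 cW
    (show ((k * E.K + i) * E.K + j) * E.W < 2 ^ w by omega)
  have h6 := Computes.bin (o := .add) h5 (fun s' h => hc s' (hs.agree h ht))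
    (show ((k * E.K + i) * E.K + j) * E.W + x < 2 ^ w by omega)
  have hcost : 1 + (1 + 1) + (ca + 1) + (1 + 1) + (cb + 1) + (1 + 1) + (cc + 1)
      = ca + cb + cc + 10 := by ring
  rw [hcost] at h6
  exact h6

theorem scrIdx_lt (b : Bool) : scrIdx b < numTabs := by cases b <;> decide

theorem Tab.idx_lt_scrIdx (t : Tab) (b : Bool) : t.idx < scrIdx b :=
  t.idx_lt.trans_le (Nat.le_add_right _ _)

theorem scrIdx_injective : Function.Injective scrIdx := by
  intro b b' h
  cases b <;> cases b' <;> first | rfl | cases h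

/-- Only the scratch tables are ever written, and their addresses are disjoint from those of all
other tables. -/
theorem Rep.tab {A : AState} {s : State w} (hs : Rep E A s) {t : Tab} {i j x : ℕ} (hi : i < E.K)
    (hj : j < E.K) (hx : x < E.W) :
    (s.mem.word (addr E.K E.W t.idx i j x)).toNat = E.tab t i j x := by
  rw [hs.word, E.word_eq t i j x hi hj hx]
  intro b y hy h
  have hK : 0 < E.K := by omega
  have := (addr_inj hi hj hx hK hK hy h).1
  have := t.idx_lt_scrIdx b
  omega

theorem Ex.computes (e : Ex) {A : AState} {t : ℕ} (ht : 102 ≤ t) {s : State w} (hs : Rep E A s)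
    (hok : e.Ok E A) : Computes (e.comp t) t s (e.val E A) e.cost := by
  induction e generalizing t s with
  | lit k => exact Computes.const hok
  | var x =>
    rw [show (Ex.var x).val E A = (s.reg x.idx).toNat from (hs.reg x).symm]
    exact Computes.copy
  | bin o a b iha ihb =>
    exact Computes.bin (iha ht hs hok.1)
      (fun s' h => ihb (by omega) (hs.agree h ht) hok.2.1) hok.2.2
  | tab T a b c iha ihb ihc =>
    obtain ⟨oa, ob, oc, ba, bb, bc⟩ := hok
    have h := Computes.addr (t := t) (k := T.idx) ht hs (T.idx_lt.trans (by decide)) ba bb bc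
      (fun s' h => iha (by omega) h oa) (fun s' h => ihb (by omega) h ob)
      (fun s' h => ihc (by omega) h oc)
    have h2 := h.load (by
      rw [hs.numWords, E.numWords_eq]
      exact addr_lt (T.idx_lt.trans (by decide)) ba bb bc)
    rw [hs.tab ba bb bc] at h2
    exact h2
  | scr b e ih =>
    obtain ⟨oe, be⟩ := hok
    have hw := E.fits
    have hlt : (0 : ℕ) < 2 ^ w := by omega
    have hK := E.K_pos
    have h := Computes.addr (t := t) (k := scrIdx b) ht hs (scrIdx_lt b) hK hK be
      (fun s' _ => Computes.const hlt) (fun s' _ => Computes.const hlt)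
      (fun s' h => ih (by omega) h oe)
    have h2 := h.load (by
      rw [hs.numWords, E.numWords_eq]
      exact addr_lt (scrIdx_lt b) hK hK be)
    rw [hs.scr b _ be] at h2
    have hcost : 1 + 1 + e.cost + 10 + 1 = e.cost + 13 := by ring
    rw [hcost] at h2
    exact h2

variable (E) in
/-- Started in a state described by `A`, the program halts within `T` steps in a state whose
description satisfies `Q`. -/
def Runs (p : Prog) (A : AState) (T : ℕ) (Q : AState → Prop) : Prop :=
  ∀ s, Rep E A s → ∃ t s' A', Exec p s t s' ∧ t ≤ T ∧ Rep E A' s' ∧ Q A'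

theorem Runs.mono {p : Prog} {A : AState} {T T' : ℕ} {Q Q' : AState → Prop} (h : Runs E p A T Q)
    (hT : T ≤ T') (hQ : ∀ A', Q A' → Q' A') : Runs E p A T' Q' := by
  intro s hs
  obtain ⟨t, s', A', h1, h2, h3, h4⟩ := h s hs
  exact ⟨t, s', A', h1, h2.trans hT, h3, hQ A' h4⟩

theorem Runs.seq {p q : Prog} {A : AState} {T T' : ℕ} {Q Q' : AState → Prop}
    (hp : Runs E p A T Q) (hq : ∀ A', Q A' → Runs E q A' T' Q') :
    Runs E (.seq p q) A (T + T') Q' := by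
  intro s hs
  obtain ⟨t, s', A', h1, h2, h3, h4⟩ := hp s hs
  obtain ⟨t', s'', A'', h1', h2', h3', h4'⟩ := hq A' h4 s' h3
  exact ⟨t + t', s'', A'', h1.seq h1', by omega, h3', h4'⟩

theorem Rep.set {A : AState} {s : State w} (hs : Rep E A s) (x : Var) (v : BitVec w) :
    Rep E (A.set x v.toNat) (s.setReg x.idx v) where
  reg y := by
    by_cases h : y = x
    · subst h; simp [State.setReg]
    · have : y.idx ≠ x.idx := fun h' => h (Var.idx_injective h')
      simp [State.setReg, Function.update_of_ne this, h, hs.reg]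
  regK := by
    have := x.idx_lt
    simp only [State.setReg]
    rw [Function.update_of_ne (by omega)]
    exact hs.regK
  regW := by
    have := x.idx_lt
    simp only [State.setReg]
    rw [Function.update_of_ne (by omega)]
    exact hs.regW
  wreg := hs.wreg
  numWords := hs.numWords
  numWeights := hs.numWeights
  weight := hs.weight
  word := hs.word
  scr := hs.scr

theorem Rep.setF {A : AState} {s : State w} (hs : Rep E A s) (d : ℕ) (v : ℝ) :
    Rep E (A.setF d v) (s.setWreg d v) where
  reg := hs.reg
  regK := hs.regK
  regW := hs.regW
  wreg := by
    funext i
    by_cases h : i = d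
    · subst h; simp [State.setWreg]
    · simp [State.setWreg, h, hs.wreg]
  numWords := hs.numWords
  numWeights := hs.numWeights
  weight := hs.weight
  word := hs.word
  scr := hs.scr

theorem Rep.setScr {A : AState} {s : State w} (hs : Rep E A s) (b : Bool) {a : ℕ} (ha : a < E.W)
    (v : BitVec w) :
    Rep E (A.setScr b a v.toNat) (s.setMem (addr E.K E.W (scrIdx b) 0 0 a) v) where
  reg := hs.reg
  regK := hs.regK
  regW := hs.regW
  wreg := hs.wreg
  numWords := hs.numWords
  numWeights := hs.numWeights
  weight := hs.weight
  word a' h := by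
    simp only [State.setMem]
    rw [Function.update_of_ne (h b a ha)]
    exact hs.word a' h
  scr b' a' ha' := by
    simp only [State.setMem, AState.setScr_scr]
    split_ifs with h
    · rw [h.1, h.2, Function.update_self]
    · rw [Function.update_of_ne, hs.scr b' a' ha']
      intro h'
      have := addr_inj E.K_pos E.K_pos ha' E.K_pos E.K_pos ha h'
      exact h ⟨scrIdx_injective this.1, this.2.2.2⟩

/-- Soundness of the weakest precondition, with time. Commands have no loops, so `cost` bounds the
time in every state. -/
theorem Cmd.runs (c : Cmd) {A : AState} {Q : AState → Prop} (h : c.wp E Q A) :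
    Runs E c.comp A c.cost Q := by
  induction c generalizing A Q with
  | skip => exact fun s hs => ⟨1, s, A, Exec.skip s, le_rfl, hs, h⟩
  | asg x e =>
    intro s hs
    obtain ⟨s', h1, h2, h3⟩ := e.computes le_rfl hs h.1
    have hs' := (hs.agree h2 le_rfl).set x (s'.reg 102)
    rw [h3] at hs'
    exact ⟨_, _, _, h1.seq (Exec.copy s' x.idx 102), le_rfl, hs', h.2⟩
  | setScr b a e =>
    intro s hs
    obtain ⟨oa, oe, ba, hQ⟩ := h
    have hlt : (0 : ℕ) < 2 ^ w := lt_of_le_of_lt (Nat.zero_le _) E.fits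
    have h := Computes.addr (t := 102) (k := scrIdx b) le_rfl hs (scrIdx_lt b) E.K_pos E.K_pos ba
      (fun s' _ => Computes.const hlt) (fun s' _ => Computes.const hlt)
      (fun s' h => a.computes (by omega) h oa)
    obtain ⟨s1, h1, a1, e1⟩ := h
    obtain ⟨s2, h2, a2, e2⟩ := e.computes (show 102 ≤ 103 by omega) (hs.agree a1 le_rfl) oe
    have hs2 := (hs.agree a1 le_rfl).agree a2 (by omega)
    have e3 : (s2.reg 102).toNat = addr E.K E.W (scrIdx b) 0 0 (a.val E A) := by
      rw [a2.reg 102 (by omega), e1]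
    have hs3 := hs2.setScr b ba (s2.reg 103)
    rw [e2] at hs3
    have hlt : (s2.reg 102).toNat < s2.mem.numWords := by
      rw [e3, hs2.numWords, E.numWords_eq]
      exact addr_lt (scrIdx_lt b) E.K_pos E.K_pos ba
    have hx := h1.seq (h2.seq (Exec.store s2 102 103 hlt))
    rw [e3] at hx
    refine ⟨_, _, _, hx, ?_, hs3, hQ⟩
    simp only [Cmd.cost]
    omega
  | seq p q ihp ihq => exact Runs.seq (ihp h) (fun A' h' => ihq h')
  | ite a b p q ihp ihq =>
    intro s hs
    obtain ⟨oa, ob, hp, hq⟩ := h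
    obtain ⟨s1, h1, a1, e1⟩ := a.computes le_rfl hs oa
    obtain ⟨s2, h2, a2, e2⟩ := b.computes (show 102 ≤ 103 by omega) (hs.agree a1 le_rfl) ob
    have hs2 := (hs.agree a1 le_rfl).agree a2 (by omega)
    have e3 : (s2.reg 102).toNat = a.val E A := by rw [a2.reg 102 (by omega), e1]
    by_cases hb : a.val E A < b.val E A
    · obtain ⟨t, s', A', k1, k2, k3, k4⟩ := ihp (hp hb) s2 hs2
      refine ⟨_, s', A', h1.seq (h2.seq (Exec.cond_true (b := .wordLt 102 103) ?_ k1)), ?_, k3, k4⟩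
      · simpa only [Test.Holds, e2, e3] using hb
      · simp only [Cmd.cost]; omega
    · obtain ⟨t, s', A', k1, k2, k3, k4⟩ := ihq (hq hb) s2 hs2
      refine ⟨_, s', A', h1.seq (h2.seq (Exec.cond_false (b := .wordLt 102 103) ?_ k1)), ?_, k3, k4⟩
      · simpa only [Test.Holds, e2, e3] using hb
      · simp only [Cmd.cost]; omega
  | loadW d e =>
    intro s hs
    obtain ⟨oe, be, hQ⟩ := h
    obtain ⟨s', h1, h2, h3⟩ := e.computes le_rfl hs oe
    have hs1 := hs.agree h2 le_rfl
    have hs' := hs1.setF d (s'.mem.weight (s'.reg 102).toNat)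
    have hx := Exec.loadWeight s' d 102 (by rw [h3, hs1.numWeights]; exact be)
    rw [h3, hs1.weight] at hs' hx
    exact ⟨_, _, _, h1.seq hx, le_rfl, hs', hQ⟩
  | copyW d a =>
    intro s hs
    have hs' := hs.setF d (s.wreg a)
    rw [hs.wreg] at hs'
    have hx := Exec.copyWeight s d a
    rw [hs.wreg] at hx
    exact ⟨_, _, _, hx, le_rfl, hs', h⟩
  | addW d a b =>
    intro s hs
    have hs' := hs.setF d (s.wreg a + s.wreg b)
    rw [hs.wreg] at hs'
    have hx := Exec.addWeight s d a b
    rw [hs.wreg] at hx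
    exact ⟨_, _, _, hx, le_rfl, hs', h⟩
  | iteW a b p q ihp ihq =>
    intro s hs
    by_cases hb : A.f a < A.f b
    · obtain ⟨t, s', A', k1, k2, k3, k4⟩ := ihp (h.1 hb) s hs
      refine ⟨_, s', A', Exec.cond_true (b := .weightLt a b) ?_ k1, ?_, k3, k4⟩
      · simpa only [Test.Holds, hs.wreg] using hb
      · simp only [Cmd.cost]; omega
    · obtain ⟨t, s', A', k1, k2, k3, k4⟩ := ihq (h.2 hb) s hs
      refine ⟨_, s', A', Exec.cond_false (b := .weightLt a b) ?_ k1, ?_, k3, k4⟩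
      · simpa only [Test.Holds, hs.wreg] using hb
      · simp only [Cmd.cost]; omega

/-- `while x < y do p` -/
def whileLt (x y : Var) (p : Prog) : Prog := .loop (.wordLt x.idx y.idx) p

/-- The invariant carries a bound on the remaining running time. -/
theorem Runs.whileLt {x y : Var} {p : Prog} {Q : AState → Prop} (Inv : ℕ → AState → Prop)
    (hdone : ∀ τ A, Inv τ A → ¬ A.r x < A.r y → 1 ≤ τ ∧ Q A)
    (hstep : ∀ τ A, Inv τ A → A.r x < A.r y →
      ∃ T, Runs E p A T fun A' => ∃ τ', Inv τ' A' ∧ 1 + T + τ' ≤ τ)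
    {τ : ℕ} {A : AState} (h : Inv τ A) : Runs E (HIA.whileLt x y p) A τ Q := by
  -- Every round pays at least for its test, so the remaining time is also the termination measure.
  induction τ using Nat.strong_induction_on generalizing A with
  | _ τ ih =>
    intro s hs
    by_cases hb : A.r x < A.r y
    · obtain ⟨T, hT⟩ := hstep τ A h hb
      obtain ⟨t, s', A', h1, h2, h3, τ', h4, h5⟩ := hT s hs
      obtain ⟨t', s'', A'', k1, k2, k3, k4⟩ := ih τ' (by omega) h4 s' h3
      refine ⟨_, s'', A'', Exec.loop_step ?_ h1 k1, by omega, k3, k4⟩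
      simpa only [Test.Holds, hs.reg] using hb
    · obtain ⟨h1, h2⟩ := hdone τ A h hb
      refine ⟨1, s, A, Exec.loop_done ?_, h1, hs, h2⟩
      simpa only [Test.Holds, hs.reg] using hb

/-- `if x < y then p else q` -/
def ifLt (x y : Var) (p q : Prog) : Prog := .cond (.wordLt x.idx y.idx) p q

theorem Runs.ifLt {x y : Var} {p q : Prog} {A : AState} {T : ℕ} {Q : AState → Prop}
    (hp : A.r x < A.r y → Runs E p A T Q) (hq : ¬ A.r x < A.r y → Runs E q A T Q) :
    Runs E (HIA.ifLt x y p q) A (1 + T) Q := by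
  intro s hs
  by_cases hb : A.r x < A.r y
  · obtain ⟨t, s', A', h1, h2, h3, h4⟩ := hp hb s hs
    refine ⟨_, s', A', Exec.cond_true ?_ h1, by omega, h3, h4⟩
    simpa only [Test.Holds, hs.reg] using hb
  · obtain ⟨t, s', A', h1, h2, h3, h4⟩ := hq hb s hs
    refine ⟨_, s', A', Exec.cond_false ?_ h1, by omega, h3, h4⟩
    simpa only [Test.Holds, hs.reg] using hb

end semantics

/-! ### The query program -/

namespace Query

def consider : Cmd :=
  .loadW 1 (rd (.s false .off) + rd (.s false .cnd)) ;;
  .loadW 2 (rd (.s true .off) + rd (.s true .cnd)) ;;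
  .addW 1 1 2 ;;
  .iteW 0 1 (.copyW 0 1 ;; .s false .best ≔ .s false .cnd ;; .s true .best ≔ .s true .cnd) .skip

/-- If the list has a leaf with rank from `sub` to below `pos`, the table `group` leads from the gap
of `pos` to that of `sub`. Otherwise the two gaps coincide, and the band is empty unless it has a
leaf of rank at least `pos`. -/
def loadSide (b : Bool) : Cmd :=
  .s b .ex ≔ .tab (.s b .ex) (.s b .lvl) 0 (.s b .node) ;;
  .s b .sub ≔ .tab (.s b .sub) (.s b .lvl) 0 (.s b .node) ;;
  .s b .lo ≔ .tab (.s b .lo) (.s b .lvl) 0 (.s b .node) ;;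
  .s b .hi ≔ .tab (.s b .hi) (.s b .lvl) 0 (.s b .node) ;;
  .s b .gap ≔ .scr b (.s (!b) .lvl) ;;
  .ite (.s b .sub) (.tab (.s b .select) 0 (.s (!b) .lvl) (.s b .gap))
    (.s b .gap ≔ .tab (.s b .group) (.s b .lvl) (.s (!b) .lvl) (.s b .gap) ;;
      .s b .mx ≔ .tab (.s b .best) (.s b .lvl) (.s (!b) .lvl) (.s b .gap) ;;
      .s b .has ≔ 1)
    (.ite (.s b .hi) (.tab (.s b .select) 0 (.s (!b) .lvl) (rd (.s b .gap) + 1))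
      (.s b .has ≔ 0)
      (.s b .mx ≔ .tab (.s b .best) (.s b .lvl) (.s (!b) .lvl) (.s b .gap) ;;
        .s b .has ≔ 1))

/-- The exit of one side is paired, on the other side, with the lighter of two nodes of one heavy
path: the exit of the best leaf and that of the query node. -/
def tryCand (b : Bool) : Cmd :=
  .ite 0 (.s b .has)
    (.loadW 1 (rd (.s (!b) .off) + rd (.s b .mx)) ;;
      .loadW 2 (rd (.s (!b) .off) + rd (.s (!b) .ex)) ;;
      .s b .cnd ≔ .s b .ex ;;
      .s (!b) .cnd ≔ .s b .mx ;;
      .iteW 2 1 (.s (!b) .cnd ≔ .s (!b) .ex) .skip ;;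
      consider)
    .skip

/-- The range ends where the leaves below the first exit begin. It starts after the best leaf of the
second side, or with the block if there is none. If the list has no leaf between `lo` and `sub`, it
is empty in the latter case. -/
def rangeStart : Cmd :=
  .h ≔ .s false .gap ;;
  .ite 0 (.s true .has)
    (.l ≔ .tab .cross (.s false .lvl) (.s true .lvl) (.s true .gap))
    (.ite (.s false .lo) (.tab (.s false .select) 0 (.s true .lvl) (.s false .gap))
      (.l ≔ .tab .start (.s false .lvl) (.s true .lvl) (.s false .gap))
      (.l ≔ .s false .gap))

def considerTab (t : Bool → Tab) (e : Ex) : Cmd :=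
  .s false .cnd ≔ .tab (t false) (.s false .lvl) (.s true .lvl) e ;;
  .s true .cnd ≔ .tab (t true) (.s false .lvl) (.s true .lvl) e ;;
  consider

/-- Bottom-up query of a segment tree: an odd left end is a right child and is taken alone, and so
is the node before an odd right end; then both ends move to their parents. -/
def stepL : Cmd :=
  .ite 0 (rd .l % 2) (considerTab .seg .l ;; .l ≔ rd .l + 1) .skip

def stepH : Cmd :=
  .ite 0 (rd .h % 2) (.h ≔ rd .h - 1 ;; considerTab .seg .h) .skip

def rangeBody : Cmd :=
  .ite .l .h (stepL ;; stepH ;; .l ≔ rd .l / 2 ;; .h ≔ rd .h / 2) .skip ;;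
  .c ≔ rd .c + 1

/-- A range of whole blocks of `2 ^ blockDepth n` slots is left, if anything. Two possibly
overlapping ranges whose length is a power of two cover it. -/
def rangeFinish : Cmd :=
  .ite .l .h
    (.t ≔ rd .h - rd .l ;;
      .k ≔ .tab .log 0 0 .t ;;
      .t ≔ .tab .pow 0 0 .t ;;
      considerTab .sparse (rd .l * rd .kk + rd .k) ;;
      considerTab .sparse ((rd .h - rd .t) * rd .kk + rd .k))
    .skip

def rangeInit : Cmd :=
  .l ≔ rd .l + rd .n2 ;; .h ≔ rd .h + rd .n2 ;; .c ≔ 0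

def rangeMax : Prog :=
  .seq rangeInit.comp (.seq (whileLt .c .bb rangeBody.comp) rangeFinish.comp)

/-- `jj` is one more than the level in the second tree, so the walk can end at `jj = 0` without
negative levels. -/
def cellInit : Cmd := .s true .lvl ≔ rd .jj - 1

def cellCands : Cmd :=
  loadSide false ;; loadSide true ;; tryCand false ;; tryCand true ;; rangeStart

def cell : Prog := .seq cellCands.comp (ifLt .l .h rangeMax Cmd.skip.comp)

/-- `up` records whether the blocks of levels `i + 1` and `j` share a leaf. Such a leaf is sought
before the gap of the query node and then after it. -/
def nextCell : Cmd :=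
  .up ≔ 0 ;;
  .ite (.s false .lvl) (.s false .dep)
    (.t ≔ .scr false (.s true .lvl) ;;
      .ite (.tab (.s false .lo) (rd (.s false .lvl) + 1) 0 (.s false .node))
        (.tab (.s false .select) 0 (.s true .lvl) .t)
        (.up ≔ 1)
        (.ite (.tab (.s false .hi) (rd (.s false .lvl) + 1) 0 (.s false .node))
          (.tab (.s false .select) 0 (.s true .lvl) (rd .t + 1))
          .skip
          (.up ≔ 1)))
    .skip ;;
  .ite 0 .up (.s false .lvl ≔ rd (.s false .lvl) + 1) (.jj ≔ rd .jj - 1)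

def walkInit : Cmd := .s false .lvl ≔ 0 ;; .jj ≔ rd (.s true .dep) + 1

def walk : Prog :=
  .seq walkInit.comp (whileLt .zero .jj (.seq cellInit.comp (.seq cell nextCell.comp)))

/-- Binary search for the number of leaves of the list before the query node: this number is at most
`mid` exactly if the entry of `select` for `mid + 1` exceeds `pos`. -/
def search (b : Bool) : Cmd :=
  .mid ≔ (rd .l + rd .h) / 2 ;;
  .ite (.s b .pos) (.tab (.s b .select) 0 .j (rd .base + (rd .mid + 1)))
    (.h ≔ .mid) (.l ≔ rd .mid + 1)

def locateInit (b : Bool) : Cmd :=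
  .j ≔ 0 ;; .l ≔ 0 ;; .lim ≔ rd (.s (!b) .dep) + 1

/-- On entry `l` still holds the position in the list of the preceding level, which selects the
sample to start from. -/
def locateStart (b : Bool) : Cmd :=
  .base ≔ 4 * Ex.tab (.s (!b) .lo) .j 0 (.s (!b) .node) ;;
  .t ≔ rd .base + rd .l / Ex.tab (.s b .grain) .j 0 (.s (!b) .node) ;;
  .l ≔ .tab (.s b .locate) 0 .j .t ;;
  .h ≔ .tab (.s b .locate) 0 .j (rd .t + 1)

def locateEnd (b : Bool) : Cmd :=
  .setScr b .j (rd .base + rd .l) ;; .j ≔ rd .j + 1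

def locate (b : Bool) : Prog :=
  .seq (locateInit b).comp (whileLt .j .lim
    (.seq (locateStart b).comp (.seq (whileLt .l .h (search b).comp) (locateEnd b).comp)))

/-- The scratch tables are zero between queries, so zeroing the entries used restores the memory. -/
def eraseBody (b : Bool) : Cmd := .setScr b .j 0 ;; .j ≔ rd .j + 1

def erase (b : Bool) : Prog :=
  .seq (locateInit b).comp (whileLt .j .lim (eraseBody b).comp)

def initSide (b : Bool) : Cmd :=
  .s b .dep ≔ .tab (.s b .ld) 0 0 (.s b .node) ;;
  .s b .pos ≔ .tab (.s b .pos) 0 0 (.s b .node)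

/-- The two roots are ancestors of everything and serve as the initial best pair. -/
def initGlobal : Cmd :=
  .s false .off ≔ 0 ;;
  .s true .off ≔ .tab .par 0 0 2 ;;
  .n2 ≔ .tab .par 0 0 3 ;;
  .bb ≔ .tab .par 0 0 4 ;;
  .kk ≔ .tab .par 0 0 5 ;;
  .s false .best ≔ .tab .par 0 0 6 ;;
  .s true .best ≔ .tab .par 0 0 7 ;;
  .loadW 0 (rd (.s false .off) + rd (.s false .best)) ;;
  .loadW 1 (rd (.s true .off) + rd (.s true .best)) ;;
  .addW 0 0 1

def init : Cmd := initSide false ;; initSide true ;; initGlobal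

def output : Cmd :=
  .s false .node ≔ .s false .best ;; .s true .node ≔ .s true .best

/-- Load the number of levels and the table width. -/
def prologue : Prog :=
  .seq (.const 102 0) (.seq (.load 100 102) (.seq (.const 102 1) (.load 101 102)))

def main : Prog :=
  .seq init.comp (.seq (locate false) (.seq (locate true) (.seq walk
    (.seq (erase false) (.seq (erase true) output.comp)))))

def program : Prog := .seq prologue main

end Query

/-! ### What the tables contain -/

/-- The depth of the heap for range maxima. -/
def heapDepth (n : ℕ) : ℕ := Nat.log 2 n + 3

/-- The number of levels of a sparse table. -/
def sparseDepth (n : ℕ) : ℕ := Nat.log 2 n + 5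

/-- The logarithm of the block length for range maxima. -/
def blockDepth (n : ℕ) : ℕ := Nat.log 2 (sparseDepth n) + 1

/-- The combined weight of two nodes. -/
noncomputable def wsum {n : ℕ} {m : Bool → ℕ} (T : ∀ b, WeightedTree n (m b))
    (u : ∀ b, Fin (m b)) : ℝ := (T false).weight (u false) + (T true).weight (u true)

/-- The contents of the tables; `e` gives the exits of the leaves by their position in the lists. -/
structure Spec {w n : ℕ} {m : Bool → ℕ} (E : Env w) (T : ∀ b, WeightedTree n (m b))
    (e : ℕ → ℕ → ℕ → ∀ b, Fin (m b)) : Prop where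
  K_eq : E.K = Nat.log 2 n + 2
  W_eq : E.W = 2 ^ (Nat.log 2 n + 5)
  numWeights : E.D.numWeights = m false + m true
  weight : ∀ b (u : Fin (m b)),
    E.D.weight ((if b then m false else 0) + u) = (T b).weight u
  scr : ∀ b x, x < E.W → E.D.word (addr E.K E.W (scrIdx b) 0 0 x) = 0
  par_levels : E.tab .par 0 0 0 = E.K
  par_width : E.tab .par 0 0 1 = E.W
  par_off : E.tab .par 0 0 2 = m false
  par_heap : E.tab .par 0 0 3 = 2 ^ heapDepth n
  par_block : E.tab .par 0 0 4 = blockDepth n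
  par_sparse : E.tab .par 0 0 5 = sparseDepth n
  par_root : ∀ b, E.tab .par 0 0 (if b then 7 else 6) = (T b).root
  ex : ∀ b i (u : Fin (m b)), E.tab (.s b .ex) i 0 u = (T b).ex u i
  sub : ∀ b i (u : Fin (m b)), E.tab (.s b .sub) i 0 u = (T b).sub u i
  lo : ∀ b i (u : Fin (m b)), E.tab (.s b .lo) i 0 u = (T b).lo u i
  hi : ∀ b i (u : Fin (m b)), E.tab (.s b .hi) i 0 u = (T b).hi u i
  pos : ∀ b (u : Fin (m b)), E.tab (.s b .pos) 0 0 u = (T b).pos u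
  ld : ∀ b (u : Fin (m b)), E.tab (.s b .ld) 0 0 u = (T b).ld u
  grain : ∀ b j (u : Fin (m !b)), j ≤ (T !b).ld u → E.tab (.s b .grain) j 0 u = (T !b).grain u j
  select : ∀ b u j, j ≤ (T !b).ld u → ∀ s ≤ ((T !b).blk u j).card + 1, ∀ p ≤ n,
    (E.tab (.s b .select) 0 j (4 * (T !b).lo u j + s) ≤ p ↔
      s ≤ cnt (T b).rk ((T !b).blk u j) p)
  locate : ∀ b u j p, j ≤ (T !b).ld u →
    E.tab (.s b .locate) 0 j (4 * (T !b).lo u j + (T b).prev (T !b) u j p / (T !b).grain u j) ≤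
      cnt (T b).rk ((T !b).blk u j) p ∧
    cnt (T b).rk ((T !b).blk u j) p ≤
      E.tab (.s b .locate) 0 j
        (4 * (T !b).lo u j + (T b).prev (T !b) u j p / (T !b).grain u j + 1) ∧
    E.tab (.s b .locate) 0 j
        (4 * (T !b).lo u j + (T b).prev (T !b) u j p / (T !b).grain u j + 1) ≤
      E.tab (.s b .locate) 0 j (4 * (T !b).lo u j + (T b).prev (T !b) u j p / (T !b).grain u j)
        + (T !b).slack u j ∧
    E.tab (.s b .locate) 0 j
        (4 * (T !b).lo u j + (T b).prev (T !b) u j p / (T !b).grain u j + 1) ≤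
      ((T !b).blk u j).card
  group : ∀ b v i u j, i ≤ (T b).ld v → j ≤ (T !b).ld u →
    ((T b).band (T !b) u j ((T b).sub v i) ((T b).pos v)).Nonempty →
    E.tab (.s b .group) i j ((T b).gap (T !b) u j ((T b).pos v)) =
      (T b).gap (T !b) u j ((T b).sub v i)
  best : ∀ b v i u j, i ≤ (T b).ld v → j ≤ (T !b).ld u →
    ((T b).band (T !b) u j ((T b).sub v i) ((T b).hi v i)).Nonempty →
    E.tab (.s b .best) i j ((T b).gap (T !b) u j ((T b).sub v i)) =
      (T !b).exl ((T b).best (T !b) v i u j) j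
  cross : ∀ v i u j, i ≤ (T true).ld v → j ≤ (T false).ld u →
    ((T true).band (T false) u j ((T true).sub v i) ((T true).hi v i)).Nonempty →
    E.tab .cross j i ((T true).gap (T false) u j ((T true).sub v i)) =
      (T false).gap (T true) v i ((T false).rk ((T true).best (T false) v i u j) + 1)
  start : ∀ v i u j, i ≤ (T false).ld v → j ≤ (T true).ld u →
    ((T false).band (T true) u j ((T false).lo v i) ((T false).sub v i)).Nonempty →
    E.tab .start i j ((T false).gap (T true) u j ((T false).sub v i)) =
      (T false).gap (T true) u j ((T false).lo v i)
  slots : ∀ x i j, i ≤ (T false).ld ((T false).leaf x) → j ≤ (T true).ld ((T true).leaf x) →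
    ∀ u, j ≤ (T true).ld u → x ∈ (T true).blk u j →
      e i j ((T false).gap (T true) u j ((T false).rk x)) false = (T false).exl x i ∧
      e i j ((T false).gap (T true) u j ((T false).rk x)) true = (T true).exl x j
  seg : ∀ i j c u, c ≤ heapDepth n → 2 ^ (heapDepth n - c) ≤ u →
    u < 2 ^ (heapDepth n - c + 1) →
    ∃ s, u * 2 ^ c ≤ 2 ^ heapDepth n + s ∧ 2 ^ heapDepth n + s < (u + 1) * 2 ^ c ∧
      (∀ b, E.tab (.seg b) i j u = e i j s b) ∧
      ∀ s', u * 2 ^ c ≤ 2 ^ heapDepth n + s' → 2 ^ heapDepth n + s' < (u + 1) * 2 ^ c →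
        wsum T (e i j s') ≤ wsum T (e i j s)
  sparse : ∀ i j l k, k < sparseDepth n →
    2 ^ (heapDepth n - blockDepth n) ≤ l → l < 2 ^ (heapDepth n - blockDepth n + 1) →
    ∃ s, l * 2 ^ blockDepth n ≤ 2 ^ heapDepth n + s ∧
      2 ^ heapDepth n + s < (l + 2 ^ k) * 2 ^ blockDepth n ∧
      (∀ b, E.tab (.sparse b) i j (l * sparseDepth n + k) = e i j s b) ∧
      ∀ s', l * 2 ^ blockDepth n ≤ 2 ^ heapDepth n + s' →
        2 ^ heapDepth n + s' < (l + 2 ^ k) * 2 ^ blockDepth n →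
        wsum T (e i j s') ≤ wsum T (e i j s)
  log : ∀ x < E.W, E.tab .log 0 0 x = Nat.log 2 x
  pow : ∀ x < E.W, 0 < x → E.tab .pow 0 0 x = 2 ^ Nat.log 2 x

/-! ### Evaluation lemmas -/

section simps

variable {w : ℕ} (E : Env w) (A : AState)

theorem Ex.val_add (a b : Ex) : (a + b).val E A = a.val E A + b.val E A := rfl
theorem Ex.val_sub (a b : Ex) : (a - b).val E A = a.val E A - b.val E A := rfl
theorem Ex.val_mul (a b : Ex) : (a * b).val E A = a.val E A * b.val E A := rfl
theorem Ex.val_div (a b : Ex) : (a / b).val E A = a.val E A / b.val E A := rfl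
theorem Ex.val_mod (a b : Ex) : (a % b).val E A = a.val E A % b.val E A := rfl
theorem Ex.val_ofNat (k : ℕ) : (no_index (OfNat.ofNat k) : Ex).val E A = OfNat.ofNat k := rfl
theorem Ex.val_var (x : Var) : (Ex.var x).val E A = A.r x := rfl
theorem Ex.val_tab (t : Tab) (a b c : Ex) :
    (Ex.tab t a b c).val E A = E.tab t (a.val E A) (b.val E A) (c.val E A) := rfl
theorem Ex.val_scr (b : Bool) (e : Ex) : (Ex.scr b e).val E A = A.scr b (e.val E A) := rfl

theorem Ex.ok_add (a b : Ex) :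
    (a + b).Ok E A ↔ a.Ok E A ∧ b.Ok E A ∧ a.val E A + b.val E A < 2 ^ w := Iff.rfl
theorem Ex.ok_sub (a b : Ex) :
    (a - b).Ok E A ↔ a.Ok E A ∧ b.Ok E A ∧ b.val E A ≤ a.val E A := Iff.rfl
theorem Ex.ok_mul (a b : Ex) :
    (a * b).Ok E A ↔ a.Ok E A ∧ b.Ok E A ∧ a.val E A * b.val E A < 2 ^ w := Iff.rfl
theorem Ex.ok_div (a b : Ex) : (a / b).Ok E A ↔ a.Ok E A ∧ b.Ok E A :=
  ⟨fun h => ⟨h.1, h.2.1⟩, fun h => ⟨h.1, h.2, trivial⟩⟩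
theorem Ex.ok_mod (a b : Ex) : (a % b).Ok E A ↔ a.Ok E A ∧ b.Ok E A :=
  ⟨fun h => ⟨h.1, h.2.1⟩, fun h => ⟨h.1, h.2, trivial⟩⟩
theorem Ex.ok_ofNat (k : ℕ) : (no_index (OfNat.ofNat k) : Ex).Ok E A ↔
    OfNat.ofNat k < 2 ^ w := Iff.rfl
theorem Ex.ok_var (x : Var) : (Ex.var x).Ok E A ↔ True := Iff.rfl
theorem Ex.ok_tab (t : Tab) (a b c : Ex) : (Ex.tab t a b c).Ok E A ↔
    a.Ok E A ∧ b.Ok E A ∧ c.Ok E A ∧ a.val E A < E.K ∧ b.val E A < E.K ∧ c.val E A < E.W := Iff.rfl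
theorem Ex.ok_scr (b : Bool) (e : Ex) :
    (Ex.scr b e).Ok E A ↔ e.Ok E A ∧ e.val E A < E.W := Iff.rfl

/-- All overflow checks rest on this. The memory has `numTabs = 33` tables of at least `E.W` words
each, and its size is below `2 ^ w`. -/
theorem Env.lt_two_pow {x : ℕ} (hx : x ≤ 32 * E.W) : x < 2 ^ w := by
  have h1 : numTabs * 1 * 1 * E.W ≤ numTabs * E.K * E.K * E.W := by
    have := E.K_pos
    gcongr <;> omega
  have := E.fits
  unfold numTabs at *
  omega

end simps

/-! ### Candidates -/

/-- The variables that are set once. -/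
def Var.static : Var → Bool
  | zero | bb | n2 | kk => true
  | s _ .node | s _ .dep | s _ .pos | s _ .off => true
  | _ => false

section

variable {w n : ℕ} {m : Bool → ℕ} {E : Env w} {T : ∀ b, WeightedTree n (m b)}
  {e : ℕ → ℕ → ℕ → ∀ b, Fin (m b)} {v : ∀ b, Fin (m b)} {A A' A'' : AState}

/-- The values of the variables that are set once. -/
structure Base (T : ∀ b, WeightedTree n (m b)) (v : ∀ b, Fin (m b)) (A : AState) : Prop where
  zero : A.r .zero = 0
  node : ∀ b, A.r (.s b .node) = v b
  dep : ∀ b, A.r (.s b .dep) = (T b).ld (v b)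
  pos : ∀ b, A.r (.s b .pos) = (T b).pos (v b)
  off : ∀ b, A.r (.s b .off) = if b then m false else 0
  n2 : A.r .n2 = 2 ^ heapDepth n
  bb : A.r .bb = blockDepth n
  kk : A.r .kk = sparseDepth n

/-- The states agree except for the variables in `S` and the weights. -/
structure Frame (S : List Var) (A A' : AState) : Prop where
  r : ∀ x, x ∉ S → A'.r x = A.r x
  scr : A'.scr = A.scr

theorem Frame.refl (S : List Var) (A : AState) : Frame S A A := ⟨fun _ _ => rfl, rfl⟩

theorem Frame.trans {S S' : List Var} (h : Frame S A A') (h' : Frame S' A' A'') :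
    Frame (S ++ S') A A'' :=
  ⟨fun x hx => by
    rw [List.mem_append, not_or] at hx
    exact (h'.r x hx.2).trans (h.r x hx.1), h'.scr.trans h.scr⟩

theorem Frame.mono {S S' : List Var} (h : Frame S A A') (hS : ∀ x ∈ S, x ∈ S') :
    Frame S' A A' := ⟨fun x hx => h.r x fun hx' => hx (hS x hx'), h.scr⟩

theorem Base.congr (h : Base T v A) (key : ∀ x : Var, x.static = true → A'.r x = A.r x) :
    Base T v A' where
  zero := by rw [key _ rfl, h.zero]
  node b := by rw [key _ rfl, h.node]
  dep b := by rw [key _ rfl, h.dep]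
  pos b := by rw [key _ rfl, h.pos]
  off b := by rw [key _ rfl, h.off]
  n2 := by rw [key _ rfl, h.n2]
  bb := by rw [key _ rfl, h.bb]
  kk := by rw [key _ rfl, h.kk]

theorem Base.frame {S : List Var} (h : Base T v A) (hf : Frame S A A')
    (hS : ∀ x ∈ S, x.static = false) : Base T v A' :=
  h.congr fun x hx => hf.r x fun hx' => by
    rw [hS x hx'] at hx
    cases hx

/-- The nodes are ancestors of `v` that are induced together. -/
def Valid (T : ∀ b, WeightedTree n (m b)) (v u : ∀ b, Fin (m b)) : Prop :=
  ∃ x, ∀ b, (T b).IsAncestor (u b) (v b) ∧ (T b).IsAncestor (u b) ((T b).leaf x)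

/-- The best pair so far is valid, and weight register `0` holds its weight. -/
def Good (T : ∀ b, WeightedTree n (m b)) (v : ∀ b, Fin (m b)) (A : AState) : Prop :=
  ∃ u : ∀ b, Fin (m b), Valid T v u ∧ (∀ b, A.r (.s b .best) = u b) ∧ A.f 0 = wsum T u

/-- The best pair of `A'` is at least as good as that of `A`. -/
structure Improves (T : ∀ b, WeightedTree n (m b)) (v : ∀ b, Fin (m b)) (A A' : AState) : Prop where
  good : Good T v A'
  le : A.f 0 ≤ A'.f 0

theorem Good.congr (h : Good T v A) (hr : ∀ b, A'.r (.s b .best) = A.r (.s b .best))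
    (hf : A'.f 0 = A.f 0) : Good T v A' := by
  obtain ⟨u, h1, h2, h3⟩ := h
  exact ⟨u, h1, fun b => (hr b).trans (h2 b), hf.trans h3⟩

theorem Spec.two_mul_le (H : Spec E T e) : 16 * n ≤ E.W := by
  rw [H.W_eq]
  have := Nat.lt_pow_succ_log_self (b := 2) (by norm_num) n
  have h : 2 ^ (Nat.log 2 n + 5) = 16 * 2 ^ (Nat.log 2 n).succ := by
    rw [Nat.succ_eq_add_one, pow_succ, pow_add]; ring
  omega

theorem Spec.W_ge (H : Spec E T e) : 32 ≤ E.W := by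
  rw [H.W_eq, pow_add]
  have := Nat.one_le_two_pow (n := Nat.log 2 n)
  omega

theorem node_lt (H : Spec E T e) (b : Bool) (u : Fin (m b)) : 8 * (u : ℕ) < E.W := by
  have h1 := (T b).card_nodes_le
  have h2 := H.two_mul_le
  have h3 := u.2
  omega

theorem off_lt (H : Spec E T e) (b : Bool) : 8 * (if b then m false else 0) ≤ E.W := by
  have h1 := (T false).card_nodes_le
  have h2 := H.two_mul_le
  split_ifs <;> omega

theorem off_add_lt (H : Spec E T e) (b : Bool) (u : Fin (m b)) :
    (if b then m false else 0) + (u : ℕ) < E.D.numWeights := by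
  rw [H.numWeights]
  have := u.2
  cases b
  · simp only [Bool.false_eq_true, if_false]; omega
  · simp only [if_true]; omega

open Query

theorem wp_consider (H : Spec E T e) (hB : Base T v A) (hG : Good T v A) {u : ∀ b, Fin (m b)}
    (hu : Valid T v u) (hc : ∀ b, A.r (.s b .cnd) = u b) {Q : AState → Prop}
    (hQ : ∀ A', Frame [.s false .best, .s true .best] A A' → Improves T v A A' →
      wsum T u ≤ A'.f 0 → Q A') : consider.wp E Q A := by
  have b1 := E.lt_two_pow (x := (if false = true then m false else 0) + u false) (by
    have := off_lt H false; have := node_lt H false (u false); omega)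
  have b2 := E.lt_two_pow (x := (if true = true then m false else 0) + u true) (by
    have := off_lt H true; have := node_lt H true (u true); omega)
  have k1 := off_add_lt H false (u false)
  have k2 := off_add_lt H true (u true)
  have w1 := H.weight false (u false)
  have w2 := H.weight true (u true)
  simp only [Bool.false_eq_true, if_false, if_true, zero_add] at b1 b2 k1 k2 w1 w2
  simp only [consider, Cmd.wp, rd, Ex.s, Ex.val_add, Ex.val_var, Ex.ok_add, Ex.ok_var,
    AState.setF_r, hc, hB.off, true_and, Bool.false_eq_true, if_false, if_true, zero_add]
  refine ⟨b1, k1, b2, k2, ?_⟩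
  simp only [w1, w2, AState.setF_f, AState.setF_r, AState.set_r,
    OfNat.ofNat_ne_one, OfNat.one_ne_ofNat, zero_ne_one, if_true,
    if_false, hc]
  constructor
  · intro hlt
    refine hQ _ ⟨fun x hx => ?_, rfl⟩ ⟨⟨u, hu, fun b => ?_, ?_⟩, ?_⟩ ?_
    · simp only [List.mem_cons, List.not_mem_nil, or_false, not_or] at hx
      simp [hx.1, hx.2]
    · cases b <;> simp
    · simp [wsum]
    · simpa using hlt.le
    · simp [wsum]
  · intro hlt
    refine hQ _ ⟨fun x hx => rfl, rfl⟩ ⟨hG.congr (fun _ => rfl) ?_, ?_⟩ ?_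
    · simp
    · simp
    · simpa [wsum] using hlt

/-- Loading a candidate from a table. -/
theorem wp_considerTab (H : Spec E T e) (hB : Base T v A) (hG : Good T v A) {t : Bool → Tab}
    {ix : Ex} {i j : ℕ} (hi : A.r (.s false .lvl) = i) (hj : A.r (.s true .lvl) = j)
    (hiK : i < E.K) (hjK : j < E.K) (hok : ix.Ok E A) (hlt : ix.val E A < E.W)
    (hix : ∀ x, ix.val E (A.set (.s false .cnd) x) = ix.val E A ∧ ix.Ok E (A.set (.s false .cnd) x))
    {u : ∀ b, Fin (m b)} (hu : Valid T v u) (hc : ∀ b, E.tab (t b) i j (ix.val E A) = u b)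
    {Q : AState → Prop}
    (hQ : ∀ A', Frame [.s false .best, .s true .best, .s false .cnd, .s true .cnd] A A' →
      Improves T v A A' → wsum T u ≤ A'.f 0 → Q A') : (considerTab t ix).wp E Q A := by
  simp only [considerTab, Cmd.wp, Ex.s, Ex.val_var, Ex.ok_var, Ex.ok_tab, Ex.val_tab, hi, hj,
    AState.set_r, Var.s.injEq, reduceCtorEq, and_false, if_false, true_and, hix, hc]
  refine ⟨⟨hok, hiK, hjK, hlt⟩, ⟨hiK, hjK, hlt⟩, ?_⟩
  have hf : Frame [.s false .cnd, .s true .cnd] A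
      ((A.set (.s false .cnd) (u false)).set (.s true .cnd) (u true)) :=
    ⟨fun x hx => by
      simp only [List.mem_cons, List.not_mem_nil, or_false, not_or] at hx
      simp [hx.1, hx.2], rfl⟩
  refine wp_consider H (hB.frame hf (by simp [Var.static])) (hG.congr (fun b => ?_) rfl) hu
    (fun b => ?_) fun A' h1 h2 h3 => hQ A' ?_ ⟨h2.good, h2.le⟩ h3
  · simp
  · cases b <;> simp
  · exact (hf.trans h1).mono (by simp)

/-! ### The block structure along a heavy path -/

/-- What is known about a side after loading it. -/
structure Side (T : ∀ b, WeightedTree n (m b)) (v : ∀ b, Fin (m b)) (b : Bool) (i j : ℕ)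
    (A : AState) : Prop where
  ex : A.r (.s b .ex) = (T b).ex (v b) i
  lo : A.r (.s b .lo) = (T b).lo (v b) i
  gap : A.r (.s b .gap) = (T b).gap (T !b) (v !b) j ((T b).sub (v b) i)
  has : (A.r (.s b .has) = 0 ∧
      ¬ ((T b).band (T !b) (v !b) j ((T b).sub (v b) i) ((T b).hi (v b) i)).Nonempty) ∨
    (A.r (.s b .has) = 1 ∧
      ((T b).band (T !b) (v !b) j ((T b).sub (v b) i) ((T b).hi (v b) i)).Nonempty ∧
      A.r (.s b .mx) = (T !b).exl ((T b).best (T !b) (v b) i (v !b) j) j)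

theorem Side.frame {S : List Var} {b : Bool} {i j : ℕ} (h : Side T v b i j A) (hf : Frame S A A')
    (hS : ∀ x ∈ S, x ≠ .s b .ex ∧ x ≠ .s b .lo ∧ x ≠ .s b .gap ∧ x ≠ .s b .has ∧ x ≠ .s b .mx) :
    Side T v b i j A' := by
  have e1 := hf.r (.s b .ex) fun hx => (hS _ hx).1 rfl
  have e2 := hf.r (.s b .lo) fun hx => (hS _ hx).2.1 rfl
  have e3 := hf.r (.s b .gap) fun hx => (hS _ hx).2.2.1 rfl
  have e4 := hf.r (.s b .has) fun hx => (hS _ hx).2.2.2.1 rfl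
  have e5 := hf.r (.s b .mx) fun hx => (hS _ hx).2.2.2.2 rfl
  constructor
  · rw [e1, h.ex]
  · rw [e2, h.lo]
  · rw [e3, h.gap]
  · rw [e4, e5]; exact h.has

theorem ld_lt (H : Spec E T e) {b : Bool} {u : Fin (m b)} {i : ℕ} (h : i ≤ (T b).ld u) :
    i + 1 < E.K := by
  rw [H.K_eq]
  have := (T b).ld_le_log u
  omega

/-- For `d = 0` this tests whether the list has a leaf with rank from `q` to below `p`. For `d = 1`
and `p ≤ q` it tests whether it has none with rank from `p` to below `q`. -/
theorem select_lt_iff (H : Spec E T e) {b : Bool} {u : Fin (m !b)} {j p q d : ℕ}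
    (hj : j ≤ (T !b).ld u) (hd : d ≤ 1) (hq : q ≤ n) :
    q < E.tab (.s b .select) 0 j ((T b).gap (T !b) u j p + d) ↔
      cnt (T b).rk ((T !b).blk u j) q < cnt (T b).rk ((T !b).blk u j) p + d := by
  have h1 := cnt_le (r := (T b).rk) (B := (T !b).blk u j) (p := p)
  have h2 := H.select b u j hj (cnt (T b).rk ((T !b).blk u j) p + d) (by omega) q hq
  rw [← not_le, ← not_le, not_iff_not, ← h2, WeightedTree.gap, add_assoc]

theorem wp_loadSide (H : Spec E T e) (hB : Base T v A) {b : Bool} {i j : ℕ}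
    (hi : A.r (.s b .lvl) = i) (hj : A.r (.s (!b) .lvl) = j) (hil : i ≤ (T b).ld (v b))
    (hjl : j ≤ (T !b).ld (v !b))
    (hscr : A.scr b j = (T b).gap (T !b) (v !b) j ((T b).pos (v b))) {Q : AState → Prop}
    (hQ : ∀ A', Frame [.s b .ex, .s b .sub, .s b .lo, .s b .hi, .s b .gap, .s b .has, .s b .mx] A A' →
      A'.f = A.f → Side T v b i j A' → Q A') : (loadSide b).wp E Q A := by
  have hiK := ld_lt H hil
  have hjK := ld_lt H hjl
  have hK := E.K_pos
  have hW := H.two_mul_le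
  have hW' := H.W_ge
  have hn := (T b).n_pos
  have hv := node_lt H b (v b)
  have hjW : j < E.W := by
    have := (T !b).ld_le_log (v !b)
    have := Nat.log_le_self 2 n
    omega
  have hg := (T b).gap_lt (U := T !b) (u := v !b) (j := j) (p := (T b).pos (v b))
  have hg' := (T b).gap_lt (U := T !b) (u := v !b) (j := j) (p := (T b).sub (v b) i)
  have c0 := E.lt_two_pow (x := 0) (by omega)
  have c1 := E.lt_two_pow (x := 1) (by omega)
  have c2 := E.lt_two_pow (x := (T b).gap (T !b) (v !b) j ((T b).pos (v b)) + 1) (by omega)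
  have l1 := WeightedTree.sub_le_pos hil
  have l2 := WeightedTree.pos_lt_hi hil
  have l3 := WeightedTree.hi_le (T := T b) (v := v b) (i := i)
  have s1 := select_lt_iff H (b := b) (p := (T b).pos (v b)) hjl (Nat.zero_le 1)
    (show (T b).sub (v b) i ≤ n by omega)
  have s2 := select_lt_iff H (b := b) (p := (T b).pos (v b)) hjl le_rfl l3
  rw [add_zero, add_zero] at s1
  simp only [loadSide, Cmd.wp, Ex.s, rd, Ex.val_var, Ex.ok_var, Ex.ok_tab, Ex.val_tab, Ex.ok_ofNat,
    Ex.val_ofNat, Ex.ok_scr, Ex.val_scr, Ex.ok_add, Ex.val_add, hi, hj, hB.node, hscr,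
    H.ex, H.sub, H.lo, H.hi,
    AState.set_r, AState.set_scr, Var.s.injEq, reduceCtorEq, and_false, if_false, if_true,
    true_and, s1, s2, Bool.not_eq_self]
  have fr : ∀ A' : AState, A'.scr = A.scr → (∀ x, x ∉ ([.s b .ex, .s b .sub, .s b .lo, .s b .hi,
      .s b .gap, .s b .has, .s b .mx] : List Var) → A'.r x = A.r x) →
      Frame [.s b .ex, .s b .sub, .s b .lo, .s b .hi, .s b .gap, .s b .has, .s b .mx] A A' :=
    fun A' h1 h2 => ⟨h2, h1⟩
  refine ⟨⟨c0, by omega, hK, by omega⟩, ⟨c0, by omega, hK, by omega⟩,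
    ⟨c0, by omega, hK, by omega⟩, ⟨c0, by omega, hK, by omega⟩, hjW,
    ⟨c0, hK, by omega, by omega⟩, fun h => ?_, fun h => ⟨⟨c0, ⟨c1, c2⟩, hK, by omega, by omega⟩,
      fun h' => ⟨c0, ?_⟩, fun h' => ⟨⟨by omega, by omega, by omega⟩, c1, ?_⟩⟩⟩
  · have hb := WeightedTree.band_nonempty_iff.mpr h
    have hb' : ((T b).band (T !b) (v !b) j ((T b).sub (v b) i) ((T b).hi (v b) i)).Nonempty :=
      WeightedTree.band_nonempty_iff.mpr (h.trans_le (cnt_mono l2.le))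
    rw [H.group b (v b) i (v !b) j hil hjl hb, H.best b (v b) i (v !b) j hil hjl hb']
    refine ⟨⟨by omega, by omega, by omega⟩, ⟨by omega, by omega, by omega⟩, c1,
      hQ _ (fr _ rfl fun x hx => ?_) rfl ⟨?_, ?_, ?_, Or.inr ⟨?_, hb', ?_⟩⟩⟩
    · simp only [List.mem_cons, List.not_mem_nil, or_false, not_or] at hx
      simp [hx]
    all_goals simp
  · refine hQ _ (fr _ rfl fun x hx => ?_) rfl ⟨?_, ?_, ?_, Or.inl ⟨?_, ?_⟩⟩
    · simp only [List.mem_cons, List.not_mem_nil, or_false, not_or] at hx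
      simp [hx]
    · simp
    · simp
    · have := cnt_mono (r := (T b).rk) (B := (T !b).blk (v !b) j) l1
      simp only [AState.set_r, Var.s.injEq, reduceCtorEq, and_false, if_false, if_true,
        WeightedTree.gap]
      omega
    · simp
    · rw [WeightedTree.band_nonempty_iff]
      omega
  -- No leaf of the list has a rank from `sub` to below `pos`, so the gap at hand is already that of
  -- `sub`.
  · have e1 : (T b).gap (T !b) (v !b) j ((T b).pos (v b))
        = (T b).gap (T !b) (v !b) j ((T b).sub (v b) i) := by
      have := cnt_mono (r := (T b).rk) (B := (T !b).blk (v !b) j) l1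
      unfold WeightedTree.gap
      omega
    have hb' : ((T b).band (T !b) (v !b) j ((T b).sub (v b) i) ((T b).hi (v b) i)).Nonempty := by
      rw [WeightedTree.band_nonempty_iff]
      have := cnt_mono (r := (T b).rk) (B := (T !b).blk (v !b) j) l1
      omega
    rw [e1, H.best b (v b) i (v !b) j hil hjl hb']
    refine hQ _ (fr _ rfl fun x hx => ?_) rfl ⟨?_, ?_, ?_, Or.inr ⟨?_, hb', ?_⟩⟩
    · simp only [List.mem_cons, List.not_mem_nil, or_false, not_or] at hx
      simp [hx]
    all_goals simp

end

/-! ### Choosing the lighter of two exits on one heavy path. -/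

namespace WeightedTree

variable {n m : ℕ} {T : WeightedTree n m} {v c : Fin m} {i : ℕ} {x : Fin n}

/-- Of two comparable exits, the lighter one is an ancestor of both end points. -/
theorem isAncestor_of_eq_exl (h : i ≤ T.ld v) (hx : x ∈ T.blk v i) (hc : c = T.exl x i)
    (hw : T.weight (T.exl x i) ≤ T.weight (T.ex v i)) :
    T.IsAncestor c v ∧ T.IsAncestor c (T.leaf x) := by
  subst hc
  refine ⟨?_, exl_isAncestor_leaf h hx⟩
  rcases exl_total h hx with h1 | h1
  · exact h1.trans (ex_mem h).1
  · by_cases hne : T.ex v i = T.exl x i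
    · exact hne ▸ (ex_mem h).1
    · exact absurd (T.weight_lt_of_isAncestor h1 hne) (not_lt.mpr hw)

theorem isAncestor_of_eq_ex (h : i ≤ T.ld v) (hx : x ∈ T.blk v i) (hc : c = T.ex v i)
    (hw : T.weight (T.ex v i) ≤ T.weight (T.exl x i)) :
    T.IsAncestor c v ∧ T.IsAncestor c (T.leaf x) := by
  subst hc
  refine ⟨(ex_mem h).1, ?_⟩
  rcases exl_total h hx with h1 | h1
  · by_cases hne : T.exl x i = T.ex v i
    · exact hne ▸ exl_isAncestor_leaf h hx
    · exact absurd (T.weight_lt_of_isAncestor h1 hne) (not_lt.mpr hw)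
  · exact h1.trans (exl_isAncestor_leaf h hx)

end WeightedTree

section

variable {w n : ℕ} {m : Bool → ℕ} {E : Env w} {T : ∀ b, WeightedTree n (m b)}
  {e : ℕ → ℕ → ℕ → ∀ b, Fin (m b)} {v : ∀ b, Fin (m b)} {A A' A'' : AState}

theorem exists_pair (b : Bool) (a : Fin (m b)) (c : Fin (m !b)) :
    ∃ u : ∀ b, Fin (m b), u b = a ∧ u (!b) = c := by
  cases b
  · exact ⟨fun b => Bool.rec a c b, rfl, rfl⟩
  · exact ⟨fun b => Bool.rec c a b, rfl, rfl⟩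

theorem forall_side {P : Bool → Prop} (b : Bool) (h : P b) (h' : P !b) : ∀ b, P b := by
  cases b
  · exact Bool.forall_bool.mpr ⟨h, h'⟩
  · exact Bool.forall_bool.mpr ⟨h', h⟩

theorem wsum_eq (T : ∀ b, WeightedTree n (m b)) (u : ∀ b, Fin (m b)) (b : Bool) :
    wsum T u = (T b).weight (u b) + (T !b).weight (u !b) := by
  cases b
  · rfl
  · exact add_comm _ _

open Query

theorem Improves.trans (h : Improves T v A A') (h' : Improves T v A' A'') : Improves T v A A'' :=
  ⟨h'.good, h.le.trans h'.le⟩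

theorem wp_tryCand (H : Spec E T e) (hB : Base T v A) (hG : Good T v A) {b : Bool} {i j : ℕ}
    (hil : i ≤ (T b).ld (v b)) (hjl : j ≤ (T !b).ld (v !b)) (hs : Side T v b i j A)
    (hs' : A.r (.s (!b) .ex) = (T !b).ex (v !b) j) {Q : AState → Prop}
    (hQ : ∀ A', Frame [.s b .cnd, .s (!b) .cnd, .s false .best, .s true .best] A A' →
      Improves T v A A' →
      (((T b).band (T !b) (v !b) j ((T b).sub (v b) i) ((T b).hi (v b) i)).Nonempty →
        (T b).weight ((T b).ex (v b) i) +
          min ((T !b).weight ((T !b).exl ((T b).best (T !b) (v b) i (v !b) j) j))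
            ((T !b).weight ((T !b).ex (v !b) j)) ≤ A'.f 0) → Q A') :
    (tryCand b).wp E Q A := by
  have hW := H.W_ge
  have c0 := E.lt_two_pow (x := 0) (by omega)
  set z := (T b).best (T !b) (v b) i (v !b) j with hz
  have b1 := E.lt_two_pow (x := (if (!b) = true then m false else 0) + (T !b).exl z j) (by
    have := off_lt H (!b); have := node_lt H (!b) ((T !b).exl z j); omega)
  have b2 := E.lt_two_pow (x := (if (!b) = true then m false else 0) + (T !b).ex (v !b) j) (by
    have := off_lt H (!b); have := node_lt H (!b) ((T !b).ex (v !b) j); omega)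
  have k1 := off_add_lt H (!b) ((T !b).exl z j)
  have k2 := off_add_lt H (!b) ((T !b).ex (v !b) j)
  have w1 := H.weight (!b) ((T !b).exl z j)
  have w2 := H.weight (!b) ((T !b).ex (v !b) j)
  simp only [tryCand, Cmd.wp, Ex.s, rd, Ex.val_var, Ex.ok_var, Ex.ok_ofNat, Ex.val_ofNat, Ex.ok_add,
    Ex.val_add, true_and]
  rcases hs.has with ⟨h0, hne⟩ | ⟨h1, hne, hmx⟩
  · rw [h0]
    exact ⟨c0, fun h => absurd h (lt_irrefl _),
      fun _ => hQ A (Frame.refl _ _) ⟨hG, le_rfl⟩ fun h => absurd h hne⟩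
  rw [h1]
  rw [← hz] at hmx
  refine ⟨c0, fun _ => ?_, fun h => absurd Nat.one_pos h⟩
  -- The best leaf witnesses that the candidate is induced: it is below the exit of `v b`, and the
  -- lighter exit of the other side is above both this leaf and `v !b`.
  have hzb := WeightedTree.last_mem (U := T !b) (d := ⟨0, (T b).n_pos⟩) hne
  rw [← WeightedTree.best, ← hz, WeightedTree.mem_band] at hzb
  have hzv : z ∈ (T b).blk (v b) i :=
    WeightedTree.mem_blk.mpr ⟨(WeightedTree.lo_le_sub hil).trans hzb.2.1, hzb.2.2⟩
  have hval : (T b).IsAncestor ((T b).ex (v b) i) (v b) ∧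
      (T b).IsAncestor ((T b).ex (v b) i) ((T b).leaf z) :=
    ⟨(WeightedTree.ex_mem hil).1, (WeightedTree.ex_isAncestor_leaf_iff hil hzv).mpr hzb.2.1⟩
  simp only [AState.setF_f, AState.setF_r, AState.set_r, AState.set_f,
    hmx, hs.ex, hs', hB.off, b1, b2, k1, k2, w1, w2, true_and, Var.s.injEq, reduceCtorEq, and_false,
    if_false, if_true, OfNat.ofNat_ne_one, OfNat.one_ne_ofNat,
    Bool.not_eq_self]
  constructor
  · intro hlt
    obtain ⟨u, hu, hu'⟩ := exists_pair (m := m) b ((T b).ex (v b) i) ((T !b).ex (v !b) j)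
    have hV : Valid T v u := ⟨z, forall_side b (hu ▸ hval)
      (WeightedTree.isAncestor_of_eq_ex hjl hzb.1 hu' hlt.le)⟩
    refine wp_consider H (v := v) (Base.frame (S := [.s b .cnd, .s (!b) .cnd]) hB ⟨?_, ?_⟩ ?_)
      (hG.congr ?_ ?_) hV (forall_side b ?_ ?_) ?_
    · intro x hx
      simp only [List.mem_cons, List.not_mem_nil, or_false, not_or] at hx
      simp [hx]
    · rfl
    · simp [Var.static]
    · simp
    · simp
    · simp [hu]
    · simp [hu']
    · intro A' hf hI hle
      refine hQ A' ⟨fun x hx => ?_, ?_⟩ ⟨hI.good, le_trans (by simp) hI.le⟩ fun _ => ?_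
      · simp only [List.mem_cons, List.not_mem_nil, or_false, not_or] at hx
        rw [hf.r x (by simp [hx])]
        simp [hx]
      · rw [hf.scr]; rfl
      · rw [wsum_eq T u b, hu, hu'] at hle
        exact le_trans (add_le_add_right (min_le_right _ _) _) hle
  · intro hlt
    obtain ⟨u, hu, hu'⟩ := exists_pair (m := m) b ((T b).ex (v b) i) ((T !b).exl z j)
    have hV : Valid T v u := ⟨z, forall_side b (hu ▸ hval)
      (WeightedTree.isAncestor_of_eq_exl hjl hzb.1 hu' (not_lt.mp hlt))⟩
    refine wp_consider H (v := v) (Base.frame (S := [.s b .cnd, .s (!b) .cnd]) hB ⟨?_, ?_⟩ ?_)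
      (hG.congr ?_ ?_) hV (forall_side b ?_ ?_) ?_
    · intro x hx
      simp only [List.mem_cons, List.not_mem_nil, or_false, not_or] at hx
      simp [hx]
    · rfl
    · simp [Var.static]
    · simp
    · simp
    · simp [hu]
    · simp [hu']
    · intro A' hf hI hle
      refine hQ A' ⟨fun x hx => ?_, ?_⟩ ⟨hI.good, le_trans (by simp) hI.le⟩ fun _ => ?_
      · simp only [List.mem_cons, List.not_mem_nil, or_false, not_or] at hx
        rw [hf.r x (by simp [hx])]
        simp [hx]
      · rw [hf.scr]; rfl
      · rw [wsum_eq T u b, hu, hu'] at hle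
        exact le_trans (add_le_add_right (min_le_left _ _) _) hle

end

/-! ### Range maxima -/

/-- Blocks are longer than the sparse table has levels, which keeps its addresses below the width of
a table. -/
theorem lt_two_pow_sparseDepth (n : ℕ) : sparseDepth n < 2 ^ blockDepth n :=
  Nat.lt_pow_succ_log_self (by norm_num) _

theorem blockDepth_le (n : ℕ) : blockDepth n ≤ heapDepth n := by
  unfold blockDepth heapDepth sparseDepth
  have : Nat.log 2 (Nat.log 2 n + 5) < Nat.log 2 n + 3 := by
    refine Nat.log_lt_of_lt_pow (by omega) ?_
    have := Nat.lt_two_pow_self (n := Nat.log 2 n)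
    rw [pow_add]
    omega
  omega

/-- All gaps are below `4 * n`, so every slot is a leaf of the heap. -/
theorem four_mul_lt (n : ℕ) : 4 * n < 2 ^ heapDepth n := by
  have := Nat.lt_pow_succ_log_self (b := 2) (by norm_num) n
  unfold heapDepth
  have h : 2 ^ (Nat.log 2 n + 3) = 4 * 2 ^ (Nat.log 2 n).succ := by
    rw [Nat.succ_eq_add_one, pow_succ, pow_add]; ring
  omega

section

variable {w n : ℕ} {m : Bool → ℕ} {E : Env w} {T : ∀ b, WeightedTree n (m b)}
  {e : ℕ → ℕ → ℕ → ∀ b, Fin (m b)} {v : ∀ b, Fin (m b)} {A A' A'' : AState}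

/-- What is known about the two levels of a cell. -/
structure Levels (E : Env w) (i j : ℕ) (A : AState) : Prop where
  lvl : A.r (.s false .lvl) = i
  lvl' : A.r (.s true .lvl) = j
  lt : i < E.K
  lt' : j < E.K

theorem Levels.frame {i j : ℕ} {S : List Var} (h : Levels E i j A) (hf : Frame S A A')
    (hS : ∀ x ∈ S, x ≠ .s false .lvl ∧ x ≠ .s true .lvl) : Levels E i j A' :=
  ⟨(hf.r _ fun hx => (hS _ hx).1 rfl).trans h.lvl, (hf.r _ fun hx => (hS _ hx).2 rfl).trans h.lvl',
    h.lt, h.lt'⟩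

/-- The slots from `l₀` to below `h₀` that have not been considered yet are the leaves of the heap
below the nodes `l, …, h - 1`, which are `c` levels up. -/
structure Range (T : ∀ b, WeightedTree n (m b)) (s : ℕ → ∀ b, Fin (m b)) (l₀ h₀ c l h : ℕ)
    (f : ℝ) : Prop where
  lower : l < h → 2 ^ heapDepth n + l₀ ≤ l * 2 ^ c
  upper : l < h → h * 2 ^ c ≤ 2 ^ heapDepth n + h₀
  cover : ∀ x, l₀ ≤ x → x < h₀ →
    wsum T (s x) ≤ f ∨ (l * 2 ^ c ≤ 2 ^ heapDepth n + x ∧ 2 ^ heapDepth n + x < h * 2 ^ c)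

variable {s : ℕ → ∀ b, Fin (m b)} {l₀ h₀ c l h : ℕ} {f f' : ℝ}

/-- A nonempty range stays within the leaves of the heap, so its nodes belong to the row that is `c`
levels above them. Entries of `seg` are specified for such nodes only. -/
theorem Range.bounds (hR : Range T s l₀ h₀ c l h f) (hc : c ≤ heapDepth n) (hh : h₀ ≤ 4 * n)
    (hl : l < h) : 2 ^ (heapDepth n - c) ≤ l ∧ h ≤ 2 ^ (heapDepth n - c + 1) := by
  have h1 := hR.lower hl
  have h2 := hR.upper hl
  have h3 := four_mul_lt n
  have h4 : 2 ^ heapDepth n = 2 ^ (heapDepth n - c) * 2 ^ c := by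
    rw [← pow_add]; congr 1; omega
  have h5 : 2 ^ (heapDepth n - c + 1) * 2 ^ c = 2 * 2 ^ heapDepth n := by
    rw [h4, pow_succ]; ring
  have h6 : 0 < 2 ^ c := by positivity
  constructor
  · refine Nat.le_of_mul_le_mul_right (c := 2 ^ c) ?_ h6
    omega
  · refine Nat.le_of_mul_le_mul_right (c := 2 ^ c) ?_ h6
    omega

theorem Range.all (hR : Range T s l₀ h₀ c l h f) (hl : ¬ l < h) {x : ℕ} (hx : l₀ ≤ x)
    (hx' : x < h₀) : wsum T (s x) ≤ f := by
  rcases hR.cover x hx hx' with h1 | ⟨h1, h2⟩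
  · exact h1
  · have := Nat.mul_le_mul_right (2 ^ c) (not_lt.mp hl)
    omega

theorem Range.sub (hR : Range T s l₀ h₀ c l h f) (hf : f ≤ f') {l' h' : ℕ} (h1 : l ≤ l')
    (h2 : h' ≤ h)
    (hc : ∀ x, (l * 2 ^ c ≤ 2 ^ heapDepth n + x ∧ 2 ^ heapDepth n + x < h * 2 ^ c) →
      wsum T (s x) ≤ f' ∨ (l' * 2 ^ c ≤ 2 ^ heapDepth n + x ∧ 2 ^ heapDepth n + x < h' * 2 ^ c)) :
    Range T s l₀ h₀ c l' h' f' where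
  lower hl := (hR.lower (by omega)).trans (Nat.mul_le_mul_right _ h1)
  upper hl := (Nat.mul_le_mul_right _ h2).trans (hR.upper (by omega))
  cover x hx hx' := (hR.cover x hx hx').elim (fun h => Or.inl (h.trans hf)) (hc x)

theorem Range.half (hR : Range T s l₀ h₀ c (2 * l) (2 * h) f) :
    Range T s l₀ h₀ (c + 1) l h f where
  lower hl := (hR.lower (by omega)).trans (le_of_eq (by ring))
  upper hl := (le_of_eq (by ring)).trans (hR.upper (by omega))
  cover x hx hx' := by
    rw [show l * 2 ^ (c + 1) = 2 * l * 2 ^ c by ring, show h * 2 ^ (c + 1) = 2 * h * 2 ^ c by ring]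
    exact hR.cover x hx hx'

/-- Once the range is empty everything has been considered, so the remaining rounds may change the
level freely. -/
theorem Range.skip (hR : Range T s l₀ h₀ c l h f) (hl : ¬ l < h) (c' : ℕ) :
    Range T s l₀ h₀ c' l h f :=
  ⟨fun h => absurd h hl, fun h => absurd h hl, fun _ hx hx' => Or.inl (hR.all hl hx hx')⟩

open Query

/-- The state during the computation of a range maximum. -/
structure RangeState (E : Env w) (T : ∀ b, WeightedTree n (m b))
    (e : ℕ → ℕ → ℕ → ∀ b, Fin (m b)) (v : ∀ b, Fin (m b)) (i j l₀ h₀ c l h : ℕ)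
    (A₀ A : AState) : Prop where
  base : Base T v A
  levels : Levels E i j A
  rl : A.r .l = l
  rh : A.r .h = h
  rc : A.r .c = c
  frame : Frame [.l, .h, .c, .t, .k, .s false .cnd, .s true .cnd, .s false .best, .s true .best]
    A₀ A
  improves : Improves T v A₀ A
  range : Range T (e i j) l₀ h₀ c l h (A.f 0)

variable {i j : ℕ} {A₀ : AState}

/-- Considering the best slot below a node of the heap or below a range of nodes. -/
theorem RangeState.wp_considerTab (H : Spec E T e)
    (hV : ∀ x, l₀ ≤ x → x < h₀ → Valid T v (e i j x)) (hS : RangeState E T e v i j l₀ h₀ c l h A₀ A) {a b : ℕ} (hab : a < b) (ha : l ≤ a)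
    (hb : b ≤ h) {t : Bool → Tab} {ix : Ex}
    (hok : ix.Ok E A) (hlt : ix.val E A < E.W)
    (hix : ∀ x, ix.val E (A.set (.s false .cnd) x) = ix.val E A ∧ ix.Ok E (A.set (.s false .cnd) x))
    (htab : ∃ x, a * 2 ^ c ≤ 2 ^ heapDepth n + x ∧ 2 ^ heapDepth n + x < b * 2 ^ c ∧
      (∀ b, E.tab (t b) i j (ix.val E A) = e i j x b) ∧
      ∀ x', a * 2 ^ c ≤ 2 ^ heapDepth n + x' → 2 ^ heapDepth n + x' < b * 2 ^ c →
        wsum T (e i j x') ≤ wsum T (e i j x))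
    {Q : AState → Prop}
    (hQ : ∀ A', RangeState E T e v i j l₀ h₀ c l h A₀ A' →
      (∀ x, a * 2 ^ c ≤ 2 ^ heapDepth n + x → 2 ^ heapDepth n + x < b * 2 ^ c →
        wsum T (e i j x) ≤ A'.f 0) →
      Frame [.s false .best, .s true .best, .s false .cnd, .s true .cnd] A A' →
      A.f 0 ≤ A'.f 0 → Q A') :
    (considerTab t ix).wp E Q A := by
  obtain ⟨x, h1, h2, h3, h4⟩ := htab
  have h5 := hS.range.lower (by omega)
  have h6 := hS.range.upper (by omega)
  have h7 := Nat.mul_le_mul_right (2 ^ c) ha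
  have h8 := Nat.mul_le_mul_right (2 ^ c) hb
  refine HIA.wp_considerTab H hS.base hS.improves.good hS.levels.lvl hS.levels.lvl' hS.levels.lt
    hS.levels.lt' hok hlt hix (hV x (by omega) (by omega)) h3 fun A' hf hI hle => hQ A'
    ⟨hS.base.frame hf (by simp [Var.static]), hS.levels.frame hf (by simp), ?_, ?_, ?_,
      (hS.frame.trans hf).mono (by simp), hS.improves.trans hI, ?_⟩
    (fun x' k1 k2 => (h4 x' k1 k2).trans hle) hf hI.le
  · rw [hf.r _ (by simp), hS.rl]
  · rw [hf.r _ (by simp), hS.rh]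
  · rw [hf.r _ (by simp), hS.rc]
  · exact hS.range.sub hI.le le_rfl le_rfl fun _ h => Or.inr h

theorem RangeState.set {l' h' c' : ℕ} (hS : RangeState E T e v i j l₀ h₀ c l h A₀ A)
    (hf : Frame [.l, .h, .c, .t, .k] A A') (hf' : A'.f = A.f) (hl : A'.r .l = l') (hh : A'.r .h = h')
    (hc : A'.r .c = c') (hR : Range T (e i j) l₀ h₀ c' l' h' (A.f 0)) :
    RangeState E T e v i j l₀ h₀ c' l' h' A₀ A' where
  base := hS.base.frame hf (by simp [Var.static])
  levels := hS.levels.frame hf (by simp)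
  rl := hl
  rh := hh
  rc := hc
  frame := (hS.frame.trans hf).mono (by simp)
  improves := ⟨hS.improves.good.congr (fun b => hf.r _ (by simp)) (by rw [hf']),
    by rw [hf']; exact hS.improves.le⟩
  range := by rw [hf']; exact hR

theorem two_pow_heapDepth_le (H : Spec E T e) : 4 * 2 ^ heapDepth n = E.W := by
  rw [H.W_eq, heapDepth, show Nat.log 2 n + 5 = 2 + (Nat.log 2 n + 3) by omega, pow_add _ 2]
  norm_num

theorem Range.le_W (H : Spec E T e) (hR : Range T s l₀ h₀ c l h f) (hh : h₀ ≤ 4 * n)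
    (hl : l < h) : 2 * h ≤ E.W := by
  have h1 := hR.upper hl
  have h2 := four_mul_lt n
  have h3 := two_pow_heapDepth_le H
  have h4 : h * 1 ≤ h * 2 ^ c := Nat.mul_le_mul_left _ Nat.one_le_two_pow
  omega

theorem RangeState.wp_stepL (H : Spec E T e) (hh : h₀ ≤ 4 * n) (hc : c ≤ heapDepth n)
    (hV : ∀ x, l₀ ≤ x → x < h₀ → Valid T v (e i j x))
    (hS : RangeState E T e v i j l₀ h₀ c l h A₀ A) (hl : l < h) {Q : AState → Prop}
    (hQ : ∀ A' l', l' % 2 = 0 → l' ≤ h → l' ≤ l + 1 →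
      RangeState E T e v i j l₀ h₀ c l' h A₀ A' → Q A') : stepL.wp E Q A := by
  have hW := H.W_ge
  have hb := hS.range.le_W H hh hl
  obtain ⟨b1, b2⟩ := hS.range.bounds hc hh hl
  have c0 := E.lt_two_pow (x := 0) (by omega)
  have c1 := E.lt_two_pow (x := 1) (by omega)
  have c2 := E.lt_two_pow (x := 2) (by omega)
  have c3 := E.lt_two_pow (x := l + 1) (by omega)
  simp only [stepL, Cmd.wp, rd, Ex.l, Ex.val_var, Ex.ok_var, Ex.ok_ofNat, Ex.val_ofNat,
    Ex.ok_mod, Ex.val_mod, Ex.ok_add, Ex.val_add, true_and, hS.rl]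
  refine ⟨c0, c2, fun h0 => ?_, fun h0 => hQ A l (by omega) hl.le (by omega) hS⟩
  refine hS.wp_considerTab H hV (a := l) (b := l + 1) (by omega) le_rfl (by omega)
    ((Ex.ok_var E A .l).mpr trivial) (by rw [Ex.val_var, hS.rl]; omega) (fun x => ⟨by simp [Ex.val_var], (Ex.ok_var ..).mpr trivial⟩)
    ?_ fun A' hS' hcov hf _ => ?_
  · rw [Ex.val_var, hS.rl]
    exact H.seg i j c l hc b1 (by omega)
  · rw [hS'.rl]
    refine ⟨⟨c1, c3⟩, hQ _ (l + 1) (by omega) (by omega) le_rfl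
      (hS'.set ⟨fun x hx => ?_, rfl⟩ rfl (by simp) (by simp [hS'.rh]) (by simp [hS'.rc]) ?_)⟩
    · simp only [List.mem_cons, List.not_mem_nil, or_false, not_or] at hx
      simp [hx]
    · refine hS'.range.sub le_rfl (Nat.le_succ l) le_rfl fun x hx => ?_
      by_cases hx' : 2 ^ heapDepth n + x < (l + 1) * 2 ^ c
      · exact Or.inl (hcov x hx.1 hx')
      · exact Or.inr ⟨not_lt.mp hx', hx.2⟩

theorem RangeState.wp_stepH (H : Spec E T e) (hh : h₀ ≤ 4 * n) (hc : c ≤ heapDepth n)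
    (hV : ∀ x, l₀ ≤ x → x < h₀ → Valid T v (e i j x))
    (hS : RangeState E T e v i j l₀ h₀ c l h A₀ A) (hl : l ≤ h) (hl2 : l % 2 = 0)
    (hhW : 2 * h ≤ E.W) {Q : AState → Prop}
    (hQ : ∀ A' h', h' % 2 = 0 → l ≤ h' → h' ≤ h →
      RangeState E T e v i j l₀ h₀ c l h' A₀ A' → Q A') : stepH.wp E Q A := by
  have hW := H.W_ge
  have c0 := E.lt_two_pow (x := 0) (by omega)
  have c1 := E.lt_two_pow (x := 1) (by omega)
  have c2 := E.lt_two_pow (x := 2) (by omega)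
  simp only [stepH, Cmd.wp, rd, Ex.h, Ex.val_var, Ex.ok_var, Ex.ok_ofNat, Ex.val_ofNat,
    Ex.ok_mod, Ex.val_mod, Ex.ok_sub, Ex.val_sub, true_and, hS.rh]
  refine ⟨c0, c2, fun h0 => ⟨⟨c1, by omega⟩, ?_⟩, fun h0 => hQ A h (by omega) hl le_rfl hS⟩
  -- `h` is odd here and `l` is even.
  have hlt : l < h := by
    rcases hl.eq_or_lt with rfl | h
    · omega
    · exact h
  obtain ⟨b1, b2⟩ := hS.range.bounds hc hh hlt
  obtain ⟨k, rfl⟩ : ∃ k, h = k + 1 := ⟨h - 1, by omega⟩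
  rw [Nat.add_sub_cancel]
  set B := A.set .h k with hB
  -- The register is decremented before the node is considered.
  have hx := H.seg i j c k hc (by omega) (by omega)
  obtain ⟨x, h1, h2, h3, h4⟩ := hx
  have h5 := hS.range.lower hlt
  have h6 := hS.range.upper hlt
  have h7 := Nat.mul_le_mul_right (2 ^ c) (show l ≤ k by omega)
  have hfB : Frame [.l, .h, .c, .t, .k] A B := ⟨fun y hy => by
    simp only [List.mem_cons, List.not_mem_nil, or_false, not_or] at hy
    simp [hB, hy], rfl⟩
  have hlv := hS.levels.frame hfB (by simp)
  have hkB : B.r .h = k := by simp [hB]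
  refine HIA.wp_considerTab H (hS.base.frame hfB (by simp [Var.static]))
    (hS.improves.good.congr (fun b => hfB.r _ (by simp)) rfl) hlv.lvl hlv.lvl' hlv.lt hlv.lt'
    ((Ex.ok_var ..).mpr trivial) (by rw [Ex.val_var, hkB]; omega) (fun x => ⟨by simp [Ex.val_var], (Ex.ok_var ..).mpr trivial⟩)
    (hV x (by omega) (by omega)) (by rw [Ex.val_var, hkB]; exact h3)
    fun A' hf hI hle => hQ A' k (by omega) (by omega) (by omega)
      ⟨(hS.base.frame hfB (by simp [Var.static])).frame hf (by simp [Var.static]),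
        hlv.frame hf (by simp), ?_, ?_, ?_, (hS.frame.trans (hfB.trans hf)).mono (by simp),
        hS.improves.trans ⟨hI.good, hI.le⟩, ?_⟩
  · rw [hf.r _ (by simp), ← hS.rl]; simp [hB]
  · rw [hf.r _ (by simp), hkB]
  · rw [hf.r _ (by simp), ← hS.rc]; simp [hB]
  · refine hS.range.sub hI.le le_rfl (Nat.le_succ k) fun x' hx' => ?_
    by_cases hlt : 2 ^ heapDepth n + x' < k * 2 ^ c
    · exact Or.inr ⟨hx'.1, hlt⟩
    · exact Or.inl ((h4 x' (not_lt.mp hlt) hx'.2).trans hle)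

end

/-! ### Range maxima: the loop over heap levels and the final lookup in the sparse table. -/

section

variable {w n : ℕ} {m : Bool → ℕ} {E : Env w} {T : ∀ b, WeightedTree n (m b)}
  {e : ℕ → ℕ → ℕ → ∀ b, Fin (m b)} {v : ∀ b, Fin (m b)} {A A' A'' A₀ : AState}
  {i j l₀ h₀ c l h : ℕ}

open Query

theorem RangeState.wp_rangeBody (H : Spec E T e) (hh : h₀ ≤ 4 * n) (hc : c < blockDepth n)
    (hV : ∀ x, l₀ ≤ x → x < h₀ → Valid T v (e i j x))
    (hS : RangeState E T e v i j l₀ h₀ c l h A₀ A) {Q : AState → Prop}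
    (hQ : ∀ A' l' h', RangeState E T e v i j l₀ h₀ (c + 1) l' h' A₀ A' → Q A') :
    rangeBody.wp E Q A := by
  have hW := H.W_ge
  have hb := blockDepth_le n
  have hN := (Nat.lt_two_pow_self (n := heapDepth n))
  have hN' := two_pow_heapDepth_le H
  have c1 := E.lt_two_pow (x := 1) (by omega)
  have c2 := E.lt_two_pow (x := 2) (by omega)
  have c3 := E.lt_two_pow (x := c + 1) (by omega)
  simp only [rangeBody, Cmd.wp, rd, Ex.l, Ex.h, Ex.val_var, Ex.ok_var, Ex.ok_ofNat, Ex.val_ofNat,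
    Ex.ok_div, Ex.val_div, Ex.ok_add, Ex.val_add, true_and, hS.rl, hS.rh]
  refine ⟨fun hlt => ?_, fun hlt => ?_⟩
  · have hlW := hS.range.le_W H hh hlt
    refine hS.wp_stepL H hh (by omega) hV hlt fun A1 l1 k1 k2 k3 hS1 => ?_
    refine hS1.wp_stepH H hh (by omega) hV k2 k1 hlW fun A2 h2 k4 k5 k6 hS2 => ?_
    obtain ⟨l', rfl⟩ : ∃ l', l1 = 2 * l' := ⟨l1 / 2, by omega⟩
    obtain ⟨h', rfl⟩ : ∃ h', h2 = 2 * h' := ⟨h2 / 2, by omega⟩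
    simp only [AState.set_r, reduceCtorEq, if_false, hS2.rl, hS2.rh, hS2.rc]
    refine ⟨c2, c2, ⟨c1, c3⟩, hQ _ l' h' (hS2.set ⟨fun x hx => ?_, rfl⟩ rfl ?_ ?_ ?_ hS2.range.half)⟩
    · simp only [List.mem_cons, List.not_mem_nil, or_false, not_or] at hx
      simp [hx]
    · simp
    · simp
    · simp
  · rw [hS.rc]
    refine ⟨⟨c1, c3⟩, hQ _ l h (hS.set ⟨fun x hx => ?_, rfl⟩ rfl ?_ ?_ ?_ (hS.range.skip hlt _))⟩
    · simp only [List.mem_cons, List.not_mem_nil, or_false, not_or] at hx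
      simp [hx]
    · simp [hS.rl]
    · simp [hS.rh]
    · simp

theorem RangeState.wp_rangeFinish (H : Spec E T e) (hh : h₀ ≤ 4 * n)
    (hV : ∀ x, l₀ ≤ x → x < h₀ → Valid T v (e i j x))
    (hS : RangeState E T e v i j l₀ h₀ (blockDepth n) l h A₀ A) {Q : AState → Prop}
    (hQ : ∀ A', Frame [.l, .h, .c, .t, .k, .s false .cnd, .s true .cnd, .s false .best,
      .s true .best] A₀ A' → Improves T v A₀ A' →
      (∀ x, l₀ ≤ x → x < h₀ → wsum T (e i j x) ≤ A'.f 0) → Q A') :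
    rangeFinish.wp E Q A := by
  have hW := H.W_ge
  have hK := E.K_pos
  have c0 := E.lt_two_pow (x := 0) (by omega)
  have hb := blockDepth_le n
  have hN' := two_pow_heapDepth_le H
  simp only [rangeFinish, Cmd.wp, rd, Ex.l, Ex.h, Ex.t, Ex.val_var, Ex.ok_var, Ex.ok_ofNat,
    Ex.val_ofNat, Ex.ok_tab, Ex.val_tab, Ex.ok_sub, Ex.val_sub, true_and, hS.rl, hS.rh,
    AState.set_r, reduceCtorEq, if_true, if_false]
  refine ⟨fun hlt => ?_, fun hlt => hQ A hS.frame hS.improves fun x hx hx' => hS.range.all hlt hx hx'⟩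
  have hlW := hS.range.le_W H hh hlt
  obtain ⟨b1, b2⟩ := hS.range.bounds hb hh hlt
  have hd : 0 < h - l := by omega
  have hdW : h - l < E.W := by omega
  rw [H.log _ hdW, H.pow _ hdW hd]
  -- With `2 ^ k ≤ h - l < 2 * 2 ^ k`, the range of length `2 ^ k` from `l` and the one that ends at
  -- `h` lie in the remaining range and cover it.
  set k := Nat.log 2 (h - l) with hk
  have hk1 : 2 ^ k ≤ h - l := Nat.pow_log_le_self 2 hd.ne'
  have hk2 : h - l < 2 ^ k * 2 := by
    rw [← pow_succ]; exact Nat.lt_pow_succ_log_self (by norm_num) _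
  have hkS : k < sparseDepth n := by
    refine Nat.log_lt_of_lt_pow hd.ne' (hdW.trans_le ?_)
    rw [H.W_eq, sparseDepth]
  -- Replacing the factor `sparseDepth n` by the larger `2 ^ blockDepth n` turns the address into a
  -- position in the heap, where `upper` bounds it by half the width.
  have hidx : ∀ a, a < h → a * sparseDepth n + k < E.W := by
    intro a ha
    have h1 : a * sparseDepth n + sparseDepth n ≤ h * sparseDepth n := by
      rw [← Nat.succ_mul]; exact Nat.mul_le_mul_right _ ha
    have h2 : h * sparseDepth n ≤ h * 2 ^ blockDepth n :=
      Nat.mul_le_mul_left _ (lt_two_pow_sparseDepth n).le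
    have h3 := hS.range.upper hlt
    have h4 := four_mul_lt n
    omega
  refine ⟨by omega, ⟨c0, c0, hK, hK, hdW⟩, ⟨c0, c0, hK, hK, hdW⟩, ?_⟩
  have hS1 : RangeState E T e v i j l₀ h₀ (blockDepth n) l h A₀
      (((A.set .t (h - l)).set .k k).set .t (2 ^ k)) := by
    refine hS.set ⟨fun x hx => ?_, rfl⟩ rfl ?_ ?_ ?_ hS.range
    · simp only [List.mem_cons, List.not_mem_nil, or_false, not_or] at hx
      simp [hx]
    · simp [hS.rl]
    · simp [hS.rh]
    · simp [hS.rc]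
  have hok : ∀ {B : AState} {a : ℕ} {ix : Ex}, B.r .kk = sparseDepth n → B.r .k = k → a < h →
      ix.Ok E B → ix.val E B = a → (ix * rd .kk + rd .k).Ok E B ∧
      (ix * rd .kk + rd .k).val E B = a * sparseDepth n + k := by
    intro B a ix h1 h2 h3 h4 h5
    have := hidx a h3
    simp only [rd, Ex.ok_add, Ex.ok_mul, Ex.ok_var, Ex.val_var, Ex.val_add, Ex.val_mul, h1, h2, h5,
      h4, true_and, and_true]
    exact ⟨E.lt_two_pow (by omega), E.lt_two_pow (by omega)⟩
  have o1 := hok (ix := rd .l) hS1.base.kk (by simp) hlt ((Ex.ok_var ..).mpr trivial) hS1.rl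
  refine hS1.wp_considerTab H hV (a := l) (b := l + 2 ^ k) (by omega) le_rfl
    (by omega) o1.1 ?_ (fun x => ⟨?_, ?_⟩) ?_ fun A2 hS2 hcov hf2 _ => ?_
  · rw [o1.2]; exact hidx l hlt
  · simp [rd, Ex.val_add, Ex.val_mul, Ex.val_var]
  · have := o1.1
    simpa [rd, Ex.ok_add, Ex.ok_mul, Ex.ok_var, Ex.val_add, Ex.val_mul, Ex.val_var] using this
  · rw [o1.2]
    exact H.sparse i j l k hkS b1 (by omega)
  · have ht : A2.r .t = 2 ^ k := by rw [hf2.r _ (by simp)]; simp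
    have hkk : A2.r .k = k := by rw [hf2.r _ (by simp)]; simp
    have o2 := hok (B := A2) (ix := rd .h - rd .t) (a := h - 2 ^ k) hS2.base.kk hkk (by omega)
      (by simp only [rd, Ex.ok_sub, Ex.ok_var, Ex.val_var, ht, hS2.rh, true_and]; omega)
      (by simp only [rd, Ex.val_sub, Ex.val_var, ht, hS2.rh])
    refine hS2.wp_considerTab H hV (a := h - 2 ^ k) (b := h - 2 ^ k + 2 ^ k) (by omega) (by omega)
      (by omega) o2.1 ?_ (fun x => ⟨?_, ?_⟩) ?_ fun A3 hS3 hcov' hf3 hle => ?_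
    · rw [o2.2]; exact hidx _ (by omega)
    · simp [rd, Ex.val_add, Ex.val_mul, Ex.val_var, Ex.val_sub]
    · have := o2.1
      simpa [rd, Ex.ok_add, Ex.ok_mul, Ex.ok_var, Ex.ok_sub, Ex.val_add, Ex.val_mul, Ex.val_var,
        Ex.val_sub] using this
    · rw [o2.2]
      exact H.sparse i j (h - 2 ^ k) k hkS (by omega) (by omega)
    · refine hQ A3 hS3.frame hS3.improves fun x hx hx' => ?_
      rcases hS3.range.cover x hx hx' with h1 | ⟨h1, h2⟩
      · exact h1
      · by_cases h3 : 2 ^ heapDepth n + x < (l + 2 ^ k) * 2 ^ blockDepth n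
        · exact (hcov x h1 h3).trans hle
        · refine hcov' x ?_ ?_
          · refine (Nat.mul_le_mul_right _ ?_).trans (not_lt.mp h3)
            omega
          · rwa [Nat.sub_add_cancel (by omega)]

/-- The running time of the range maximum. -/
def rangeTime (n : ℕ) : ℕ :=
  rangeInit.cost + (blockDepth n * (1 + rangeBody.cost) + 1 + rangeFinish.cost)

theorem runs_rangeMax (H : Spec E T e) (hh : h₀ ≤ 4 * n)
    (hV : ∀ x, l₀ ≤ x → x < h₀ → Valid T v (e i j x)) (hB : Base T v A) (hL : Levels E i j A)
    (hG : Good T v A) (hl : A.r .l = l₀) (hh' : A.r .h = h₀) (hlt : l₀ < h₀) :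
    Runs E rangeMax A (rangeTime n) fun A' => Frame [.l, .h, .c, .t, .k, .s false .cnd,
      .s true .cnd, .s false .best, .s true .best] A A' ∧ Improves T v A A' ∧
      ∀ x, l₀ ≤ x → x < h₀ → wsum T (e i j x) ≤ A'.f 0 := by
  have hW := H.W_ge
  have h4 := four_mul_lt n
  have hN' := two_pow_heapDepth_le H
  have c0 := E.lt_two_pow (x := 0) (by omega)
  have c1 := E.lt_two_pow (x := l₀ + 2 ^ heapDepth n) (by omega)
  have c2 := E.lt_two_pow (x := h₀ + 2 ^ heapDepth n) (by omega)
  refine Runs.seq (Q := fun A' => RangeState E T e v i j l₀ h₀ 0 (l₀ + 2 ^ heapDepth n)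
    (h₀ + 2 ^ heapDepth n) A A') (Cmd.runs _ ?_) fun A1 hS => Runs.seq
      (Q := fun A' => ∃ l h, RangeState E T e v i j l₀ h₀ (blockDepth n) l h A A') ?_
      fun A2 ⟨l, h, hS⟩ => Cmd.runs _ (hS.wp_rangeFinish H hh hV fun A' h1 h2 h3 => ⟨h1, h2, h3⟩)
  · simp only [rangeInit, Cmd.wp, rd, Ex.val_var, Ex.ok_var, Ex.ok_ofNat, Ex.val_ofNat, Ex.ok_add,
      Ex.val_add, true_and, hl, hh', hB.n2, AState.set_r, reduceCtorEq, if_false]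
    refine ⟨c1, c2, c0, ?_⟩
    have hf : Frame [.l, .h, .c] A (((A.set .l (l₀ + 2 ^ heapDepth n)).set .h
        (h₀ + 2 ^ heapDepth n)).set .c 0) := ⟨fun x hx => by
      simp only [List.mem_cons, List.not_mem_nil, or_false, not_or] at hx
      simp [hx], rfl⟩
    refine ⟨hB.frame hf (by simp [Var.static]), hL.frame hf (by simp), by simp, by simp, by simp,
      hf.mono (by simp), ⟨hG.congr (fun b => hf.r _ (by simp)) rfl, le_rfl⟩,
      ⟨fun _ => ?_, fun _ => ?_, fun x hx hx' => Or.inr ⟨?_, ?_⟩⟩⟩ <;> omega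
  · refine Runs.whileLt (fun τ A' => ∃ c l h, c ≤ blockDepth n ∧
      τ = (blockDepth n - c) * (1 + rangeBody.cost) + 1 ∧
      RangeState E T e v i j l₀ h₀ c l h A A') ?_ ?_ ⟨0, _, _, Nat.zero_le _, rfl, hS⟩
    · rintro τ A' ⟨c, l, h, hc, rfl, hS⟩ hn
      rw [hS.rc, hS.base.bb] at hn
      obtain rfl : c = blockDepth n := by omega
      exact ⟨by omega, l, h, hS⟩
    · rintro τ A' ⟨c, l, h, hc, rfl, hS⟩ hn
      rw [hS.rc, hS.base.bb] at hn
      refine ⟨_, Cmd.runs _ (hS.wp_rangeBody H hh hn hV fun A'' l' h' hS' =>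
        ⟨_, ⟨c + 1, l', h', hn, rfl, hS'⟩, ?_⟩)⟩
      obtain ⟨d, hd⟩ : ∃ d, blockDepth n - c = d + 1 := ⟨blockDepth n - c - 1, by omega⟩
      rw [hd, show blockDepth n - (c + 1) = d by omega]
      ring_nf
      omega

end

/-! ### Cells -/

section

variable {w n : ℕ} {m : Bool → ℕ} {E : Env w} {T : ∀ b, WeightedTree n (m b)}
  {e : ℕ → ℕ → ℕ → ∀ b, Fin (m b)} {v : ∀ b, Fin (m b)} {A A' A'' A₀ : AState} {i j : ℕ}

/-- The leaves of the block of level `j` of `v !b` that are below the exit of level `i` of `v b`. -/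
noncomputable abbrev sideBand (T : ∀ b, WeightedTree n (m b)) (v : ∀ b, Fin (m b)) (b : Bool)
    (i j : ℕ) : Finset (Fin n) :=
  (T b).band (T !b) (v !b) j ((T b).sub (v b) i) ((T b).hi (v b) i)

/-- The last leaf of `sideBand`. -/
noncomputable abbrev sideBest (T : ∀ b, WeightedTree n (m b)) (v : ∀ b, Fin (m b)) (b : Bool)
    (i j : ℕ) : Fin n := (T b).best (T !b) (v b) i (v !b) j

/-- The combined weight of the candidate on a side. -/
noncomputable def sideWeight (T : ∀ b, WeightedTree n (m b)) (v : ∀ b, Fin (m b)) (b : Bool)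
    (i j : ℕ) : ℝ :=
  (T b).weight ((T b).ex (v b) i) + min ((T !b).weight ((T !b).exl (sideBest T v b i j) j))
    ((T !b).weight ((T !b).ex (v !b) j))

open Classical in
/-- The first rank after the candidate of the second side. -/
noncomputable def rangeFrom (T : ∀ b, WeightedTree n (m b)) (v : ∀ b, Fin (m b)) (i j : ℕ) : ℕ :=
  if (sideBand T v true j i).Nonempty then (T false).rk (sideBest T v true j i) + 1
  else (T false).lo (v false) i

/-- The value of the pair of exits of a leaf. -/
noncomputable def leafWeight (T : ∀ b, WeightedTree n (m b)) (v : ∀ b, Fin (m b)) (i j : ℕ)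
    (x : Fin n) : ℝ :=
  min ((T false).weight ((T false).exl x i)) ((T false).weight ((T false).ex (v false) i)) +
    min ((T true).weight ((T true).exl x j)) ((T true).weight ((T true).ex (v true) j))

/-- All pairs of ancestors of levels `i` and `j` have been considered. -/
def CellDone (T : ∀ b, WeightedTree n (m b)) (v : ∀ b, Fin (m b)) (i j : ℕ) (f : ℝ) : Prop :=
  ∀ x ∈ (T false).blk (v false) i, x ∈ (T true).blk (v true) j → leafWeight T v i j x ≤ f

theorem CellDone.mono {f f' : ℝ} (h : CellDone T v i j f) (hf : f ≤ f') : CellDone T v i j f' :=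
  fun x hx hx' => (h x hx hx').trans hf

theorem sideBest_mem {b : Bool} (h : (sideBand T v b i j).Nonempty) :
    sideBest T v b i j ∈ sideBand T v b i j := WeightedTree.last_mem h

theorem le_rangeFrom :
    (T false).lo (v false) i ≤ rangeFrom T v i j := by
  unfold rangeFrom
  split_ifs with h
  · have := (WeightedTree.mem_band.mp (sideBest_mem h)).1
    have := (WeightedTree.mem_blk.mp this).1
    exact this.trans (Nat.le_succ _)
  · exact le_rfl

/-- The best leaf of the second side is the last of its band in the order of the first tree, so no
leaf after it is below the second exit. This is what makes the pairs in the range independent of the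
query. -/
theorem rk_lt_sub_of_rangeFrom_le {x : Fin n}
    (hx : x ∈ (T false).blk (v false) i) (hx' : x ∈ (T true).blk (v true) j)
    (h : rangeFrom T v i j ≤ (T false).rk x) : (T true).rk x < (T true).sub (v true) j := by
  by_contra hlt
  have hmem : x ∈ sideBand T v true j i :=
    WeightedTree.mem_band.mpr ⟨hx, not_lt.mp hlt, (WeightedTree.mem_blk.mp hx').2⟩
  have hne : (sideBand T v true j i).Nonempty := ⟨x, hmem⟩
  have h1 : (T false).rk x ≤ (T false).rk (sideBest T v true j i) :=
    WeightedTree.le_last (U := T false) hmem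
  rw [rangeFrom, if_pos hne] at h
  omega

/-- The slots between the candidate of the second side and the exit of the first. -/
theorem exists_of_slot (hi : i ≤ (T false).ld (v false)) {s : ℕ}
    (h : (T false).gap (T true) (v true) j (rangeFrom T v i j) ≤ s)
    (h' : s < (T false).gap (T true) (v true) j ((T false).sub (v false) i)) :
    ∃ x ∈ (T false).blk (v false) i, x ∈ (T true).blk (v true) j ∧
      (T false).gap (T true) (v true) j ((T false).rk x) = s ∧
      (T false).rk x < (T false).sub (v false) i ∧
      (T true).rk x < (T true).sub (v true) j := by
  have hge := le_rangeFrom (T := T) (v := v) (i := i) (j := j)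
  unfold WeightedTree.gap at h h' ⊢
  obtain ⟨x, hx, h1, h2, h3⟩ := exists_cnt_eq (T false).rk_injective
    (B := (T true).blk (v true) j) (p := rangeFrom T v i j)
    (p' := (T false).sub (v false) i) (s := s - 4 * (T true).lo (v true) j) (show _ ≤ _ by omega) (show _ < _ by omega)
  have hx' : x ∈ (T false).blk (v false) i := WeightedTree.mem_blk.mpr ⟨hge.trans h1,
    h2.trans_le ((WeightedTree.sub_le_pos hi).trans (WeightedTree.pos_lt_hi hi).le)⟩
  exact ⟨x, hx', hx, by omega, h2, rk_lt_sub_of_rangeFrom_le hx' hx h1⟩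

/-- A slot of the range belongs to a leaf whose exits are above those of the query nodes in both
trees; that leaf is the common descendant. -/
theorem valid_of_slot (H : Spec E T e) (hi : i ≤ (T false).ld (v false))
    (hj : j ≤ (T true).ld (v true)) {s : ℕ}
    (h : (T false).gap (T true) (v true) j (rangeFrom T v i j) ≤ s)
    (h' : s < (T false).gap (T true) (v true) j ((T false).sub (v false) i)) :
    Valid T v (e i j s) := by
  obtain ⟨x, hx, hx', rfl, h1, h2⟩ := exists_of_slot hi h h'
  obtain ⟨e1, e2⟩ := H.slots x i j (WeightedTree.le_ld_of_mem_blk hi hx)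
    (WeightedTree.le_ld_of_mem_blk hj hx') (v true) hj hx'
  refine ⟨x, forall_side false ⟨?_, ?_⟩ ⟨?_, ?_⟩⟩
  · rw [e1]
    exact (WeightedTree.exl_isAncestor_ex hi hx h1).trans (WeightedTree.ex_mem hi).1
  · rw [e1]
    exact WeightedTree.exl_isAncestor_leaf hi hx
  · refine e2 ▸ ?_
    exact (WeightedTree.exl_isAncestor_ex hj hx' h2).trans (WeightedTree.ex_mem hj).1
  · refine e2 ▸ ?_
    exact WeightedTree.exl_isAncestor_leaf hj hx'

/-- The three kinds of candidates suffice. -/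
theorem cellDone_of_candidates (H : Spec E T e) (hi : i ≤ (T false).ld (v false))
    (hj : j ≤ (T true).ld (v true)) {f : ℝ}
    (h1 : (sideBand T v false i j).Nonempty → sideWeight T v false i j ≤ f)
    (h2 : (sideBand T v true j i).Nonempty → sideWeight T v true j i ≤ f)
    (h3 : ∀ s, (T false).gap (T true) (v true) j (rangeFrom T v i j) ≤ s →
      s < (T false).gap (T true) (v true) j ((T false).sub (v false) i) → wsum T (e i j s) ≤ f) :
    CellDone T v i j f := by
  intro x hx hx'
  -- For a leaf below the first exit only the second exit matters, which is deepest for the last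
  -- leaf in the order of the second tree.
  by_cases k1 : (T false).sub (v false) i ≤ (T false).rk x
  · have hmem : x ∈ sideBand T v false i j :=
      WeightedTree.mem_band.mpr ⟨hx', k1, (WeightedTree.mem_blk.mp hx).2⟩
    have hne : (sideBand T v false i j).Nonempty := ⟨x, hmem⟩
    refine le_trans ?_ (h1 hne)
    refine add_le_add (min_le_right _ _) (min_le_min_right _ ?_)
    exact (T true).weight_le_of_isAncestor (WeightedTree.exl_mono hj hx'
      (WeightedTree.mem_band.mp (sideBest_mem hne)).1 (WeightedTree.le_last (U := T true) hmem))
  -- The same with the two trees exchanged.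
  by_cases k2 : (T true).sub (v true) j ≤ (T true).rk x
  · have hmem : x ∈ sideBand T v true j i :=
      WeightedTree.mem_band.mpr ⟨hx, k2, (WeightedTree.mem_blk.mp hx').2⟩
    have hne : (sideBand T v true j i).Nonempty := ⟨x, hmem⟩
    refine le_trans ?_ (h2 hne)
    rw [sideWeight, add_comm]
    refine add_le_add (min_le_min_right _ ?_) (min_le_right _ _)
    exact (T false).weight_le_of_isAncestor (WeightedTree.exl_mono hi hx
      (WeightedTree.mem_band.mp (sideBest_mem hne)).1 (WeightedTree.le_last (U := T false) hmem))
  by_cases k3 : rangeFrom T v i j ≤ (T false).rk x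
  · have hs := h3 ((T false).gap (T true) (v true) j ((T false).rk x))
      (WeightedTree.gap_mono k3)
      (Nat.add_lt_add_left (cnt_lt_cnt_of_mem hx' le_rfl (not_le.mp k1)) _)
    obtain ⟨e1, e2⟩ := H.slots x i j (WeightedTree.le_ld_of_mem_blk hi hx)
      (WeightedTree.le_ld_of_mem_blk hj hx') (v true) hj hx'
    rw [wsum, e1, e2] at hs
    exact (add_le_add (min_le_left _ _) (min_le_left _ _)).trans hs
  -- A leaf before the range does not come after the best leaf of the second side, so its first exit
  -- is no heavier, and its second minimum is at most the weight of the second exit. Without a best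
  -- leaf the range starts with the block.
  · unfold rangeFrom at k3
    split_ifs at k3 with hne
    · refine le_trans ?_ (h2 hne)
      rw [sideWeight, add_comm]
      refine add_le_add (min_le_min_right _ ?_) (min_le_right _ _)
      exact (T false).weight_le_of_isAncestor (WeightedTree.exl_mono hi hx
        (WeightedTree.mem_band.mp (sideBest_mem hne)).1 (by omega))
    · exact absurd (WeightedTree.mem_blk.mp hx).1 k3

open Query

theorem wp_rangeStart (H : Spec E T e) (hL : Levels E i j A) (hi : i ≤ (T false).ld (v false))
    (hj : j ≤ (T true).ld (v true)) (hf : Side T v false i j A) (ht : Side T v true j i A)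
    {Q : AState → Prop}
    (hQ : ∀ A', Frame [.l, .h] A A' → A'.f = A.f →
      A'.r .l = (T false).gap (T true) (v true) j (rangeFrom T v i j) →
      A'.r .h = (T false).gap (T true) (v true) j ((T false).sub (v false) i) → Q A') :
    rangeStart.wp E Q A := by
  have hW := H.two_mul_le
  have hW' := H.W_ge
  have hK := E.K_pos
  have hn := (T false).n_pos
  have c0 := E.lt_two_pow (x := 0) (by omega)
  have hiK := hL.lt
  have hjK := hL.lt'
  have g1 := (T false).gap_lt (U := T true) (u := v true) (j := j) (p := (T false).sub (v false) i)
  have g2 := (T true).gap_lt (U := T false) (u := v false) (j := i) (p := (T true).sub (v true) j)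
  have l1 := WeightedTree.lo_le_sub hi
  have l2 := (WeightedTree.sub_le_pos hi).trans (WeightedTree.pos_lt_hi hi).le
  have l3 := WeightedTree.hi_le (T := T false) (v := v false) (i := i)
  have s1 : (T false).lo (v false) i < E.tab (.s false .select) 0 j
      ((T false).gap (T true) (v true) j ((T false).sub (v false) i)) ↔
      cnt (T false).rk ((T true).blk (v true) j) ((T false).lo (v false) i) <
        cnt (T false).rk ((T true).blk (v true) j) ((T false).sub (v false) i) :=
    select_lt_iff H (b := false) (d := 0) hj (Nat.zero_le 1) (by omega)
  have ef : A.r (.s false .gap)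
      = (T false).gap (T true) (v true) j ((T false).sub (v false) i) := hf.gap
  have et : A.r (.s true .gap)
      = (T true).gap (T false) (v false) i ((T true).sub (v true) j) := ht.gap
  simp only [rangeStart, Cmd.wp, Ex.s, Ex.val_var, Ex.ok_var, Ex.ok_ofNat, Ex.val_ofNat,
    Ex.ok_tab, Ex.val_tab, true_and, AState.set_r, reduceCtorEq, if_false,
    ef, et, hL.lvl, hL.lvl', hf.lo, s1]
  have fr : ∀ A' : AState, A'.scr = A.scr → (∀ x, x ∉ ([.l, .h] : List Var) → A'.r x = A.r x) →
      Frame [.l, .h] A A' := fun A' h1 h2 => ⟨h2, h1⟩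
  have hrf : ¬ (sideBand T v true j i).Nonempty → rangeFrom T v i j = (T false).lo (v false) i :=
    fun h => by rw [rangeFrom, if_neg h]
  rcases ht.has with ⟨h0, hne⟩ | ⟨h1, hne, -⟩
  · rw [h0]
    refine ⟨c0, fun h => absurd h (lt_irrefl _), fun _ => ⟨⟨c0, hK, hjK, by omega⟩, fun hlt => ?_,
      fun hge => ?_⟩⟩
    · refine ⟨⟨hiK, hjK, by omega⟩, hQ _ (fr _ rfl fun x hx => ?_) rfl ?_ (by simp)⟩
      · simp only [List.mem_cons, List.not_mem_nil, or_false, not_or] at hx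
        simp [hx]
      · simp only [AState.set_r, if_true]
        rw [hrf hne]
        exact H.start (v false) i (v true) j hi hj (WeightedTree.band_nonempty_iff.mpr hlt)
    · refine hQ _ (fr _ rfl fun x hx => ?_) rfl ?_ (by simp)
      · simp only [List.mem_cons, List.not_mem_nil, or_false, not_or] at hx
        simp [hx]
      · simp only [AState.set_r, if_true]
        rw [hrf hne]
        have := cnt_mono (r := (T false).rk) (B := (T true).blk (v true) j) l1
        unfold WeightedTree.gap
        omega
  · rw [h1]
    refine ⟨c0, fun _ => ⟨⟨hiK, hjK, by omega⟩, hQ _ (fr _ rfl fun x hx => ?_) rfl ?_ (by simp)⟩,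
      fun h => absurd Nat.one_pos h⟩
    · simp only [List.mem_cons, List.not_mem_nil, or_false, not_or] at hx
      simp [hx]
    · simp only [AState.set_r, if_true]
      rw [rangeFrom, if_pos hne]
      exact H.cross (v true) j (v false) i hj hi hne

/-- The scratch memory holds the gaps of the query nodes. -/
def Located (T : ∀ b, WeightedTree n (m b)) (v : ∀ b, Fin (m b)) (A : AState) : Prop :=
  ∀ b j, j ≤ (T !b).ld (v !b) → A.scr b j = (T b).gap (T !b) (v !b) j ((T b).pos (v b))

/-- The variables that are changed by a cell. -/
def cellVars : List Var :=
  [.s false .ex, .s false .sub, .s false .lo, .s false .hi, .s false .gap, .s false .has,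
    .s false .mx, .s false .cnd, .s false .best, .s true .ex, .s true .sub, .s true .lo,
    .s true .hi, .s true .gap, .s true .has, .s true .mx, .s true .cnd, .s true .best,
    .l, .h, .c, .t, .k]

theorem wp_cellCands (H : Spec E T e) (hB : Base T v A) (hG : Good T v A) (hL : Levels E i j A)
    (hi : i ≤ (T false).ld (v false)) (hj : j ≤ (T true).ld (v true)) (hloc : Located T v A)
    {Q : AState → Prop}
    (hQ : ∀ A', Frame cellVars A A' → Improves T v A A' →
      ((sideBand T v false i j).Nonempty → sideWeight T v false i j ≤ A'.f 0) →
      ((sideBand T v true j i).Nonempty → sideWeight T v true j i ≤ A'.f 0) →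
      A'.r .l = (T false).gap (T true) (v true) j (rangeFrom T v i j) →
      A'.r .h = (T false).gap (T true) (v true) j ((T false).sub (v false) i) → Q A') :
    cellCands.wp E Q A := by
  refine wp_loadSide H hB (b := false) hL.lvl hL.lvl' hi hj (hloc false j hj)
    fun A1 hf1 e1 hs1 => ?_
  refine wp_loadSide H (hB.frame hf1 (by simp [Var.static])) (b := true)
    ((hf1.r _ (by simp)).trans hL.lvl') ((hf1.r _ (by simp)).trans hL.lvl) hj hi
    (by rw [hf1.scr]; exact hloc true i hi) fun A2 hf2 e2 hs2 => ?_
  have hf12 := hf1.trans hf2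
  have hs1' := hs1.frame hf2 (by simp)
  have hB2 := hB.frame hf12 (by simp [Var.static])
  refine wp_tryCand H hB2
    (hG.congr (fun b => hf12.r _ (by simp)) (by rw [e2, e1])) (b := false) hi hj hs1' hs2.ex
    fun A3 hf3 hI3 h3 => ?_
  have hB3 := hB2.frame hf3 (by simp [Var.static])
  refine wp_tryCand H hB3 hI3.good (b := true) hj hi (hs2.frame hf3 (by simp))
    ((hf3.r _ (by simp)).trans hs1'.ex) fun A4 hf4 hI4 h4 => ?_
  have hf := (hf12.trans hf3).trans hf4
  have hI := hI3.trans hI4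
  refine wp_rangeStart H (hL.frame hf (by simp)) hi hj ((hs1'.frame hf3 (by simp)).frame hf4 (by simp))
    ((hs2.frame hf3 (by simp)).frame hf4 (by simp)) fun A5 hf5 e5 hl hh => ?_
  refine hQ A5 ((hf.trans hf5).mono (by simp [cellVars]))
    ⟨hI.good.congr (fun b => hf5.r _ (by simp)) (by rw [e5]), ?_⟩ (fun hne => ?_) (fun hne => ?_) hl hh
  · rw [e5, ← e1, ← e2]; exact hI.le
  · rw [e5]; exact (h3 hne).trans hI4.le
  · rw [e5]; exact h4 hne

/-- The running time of a cell. -/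
def cellTime (n : ℕ) : ℕ := cellCands.cost + (1 + (rangeTime n + Cmd.skip.cost))

theorem runs_cell (H : Spec E T e) (hB : Base T v A) (hG : Good T v A) (hL : Levels E i j A)
    (hi : i ≤ (T false).ld (v false)) (hj : j ≤ (T true).ld (v true)) (hloc : Located T v A) :
    Runs E cell A (cellTime n) fun A' =>
      Frame cellVars A A' ∧ Improves T v A A' ∧ CellDone T v i j (A'.f 0) := by
  refine Runs.seq (Q := fun A' => Frame cellVars A A' ∧ Improves T v A A' ∧
    ((sideBand T v false i j).Nonempty → sideWeight T v false i j ≤ A'.f 0) ∧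
      ((sideBand T v true j i).Nonempty → sideWeight T v true j i ≤ A'.f 0) ∧
      A'.r .l = (T false).gap (T true) (v true) j (rangeFrom T v i j) ∧
      A'.r .h = (T false).gap (T true) (v true) j ((T false).sub (v false) i))
    (Cmd.runs _ (wp_cellCands H hB hG hL hi hj hloc
      fun A' h1 h2 h3 h4 h5 h6 => ⟨h1, h2, h3, h4, h5, h6⟩)) ?_
  rintro A1 ⟨hf, hI, h1, h2, h3, h4⟩
  refine Runs.ifLt (fun hlt => ?_) (fun hge => ?_)
  · have hg := (T false).gap_lt (U := T true) (u := v true) (j := j)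
      (p := (T false).sub (v false) i)
    rw [h3, h4] at hlt
    refine (runs_rangeMax H (by omega) (fun s k1 k2 => valid_of_slot H hi hj k1 k2)
      (hB.frame hf (by simp [Var.static, cellVars])) (hL.frame hf (by simp [cellVars])) hI.good h3 h4
      hlt).mono (Nat.le_add_right _ _) ?_
    rintro A2 ⟨hf2, hI2, hcov⟩
    exact ⟨(hf.trans hf2).mono (by simp [cellVars]), hI.trans hI2, cellDone_of_candidates H hi hj
      (fun hne => (h1 hne).trans hI2.le) (fun hne => (h2 hne).trans hI2.le) hcov⟩
  · refine (Cmd.runs .skip (Q := fun A' => A' = A1) rfl).mono (Nat.le_add_left _ _) ?_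
    rintro A2 rfl
    rw [h3, h4] at hge
    exact ⟨hf, hI, cellDone_of_candidates H hi hj h1 h2 fun s k1 k2 => absurd (k1.trans_lt k2) hge⟩

end

/-! ### The walk over the cells -/

section

variable {w n : ℕ} {m : Bool → ℕ} {E : Env w} {T : ∀ b, WeightedTree n (m b)}
  {e : ℕ → ℕ → ℕ → ∀ b, Fin (m b)} {v : ∀ b, Fin (m b)} {A A' A'' A₀ : AState} {i j jj : ℕ}

/-- Some leaf belongs to both blocks. -/
def Meet (T : ∀ b, WeightedTree n (m b)) (v : ∀ b, Fin (m b)) (i j : ℕ) : Prop :=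
  ∃ x ∈ (T false).blk (v false) i, x ∈ (T true).blk (v true) j

/-- Blocks shrink as the level grows, so the cells with a common leaf form a staircase. -/
theorem Meet.mono {i' j' : ℕ} (h : Meet T v i j) (hi : i ≤ (T false).ld (v false))
    (hj : j ≤ (T true).ld (v true)) (hi' : i' ≤ i) (hj' : j' ≤ j) : Meet T v i' j' := by
  obtain ⟨x, hx, hx'⟩ := h
  exact ⟨x, WeightedTree.blk_subset hi hi' hx, WeightedTree.blk_subset hj hj' hx'⟩

theorem cellDone_of_not_meet {f : ℝ} (h : ¬ Meet T v i j) : CellDone T v i j f :=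
  fun x hx hx' => absurd ⟨x, hx, hx'⟩ h

/-- The exit of level `i` is above the top of the path of level `i + 1`, hence above both exits on
that path. -/
theorem weight_ex_le {b : Bool} {x : Fin n} (hi : i + 1 ≤ (T b).ld (v b))
    (hx : x ∈ (T b).blk (v b) (i + 1)) : (T b).weight ((T b).ex (v b) i) ≤
      min ((T b).weight ((T b).exl x (i + 1))) ((T b).weight ((T b).ex (v b) (i + 1))) := by
  have h := WeightedTree.ex_isAncestor_top_succ (T := T b) (Nat.lt_succ_self i) hi
  exact le_min ((T b).weight_le_of_isAncestor (h.trans (WeightedTree.top_isAncestor_exl hi hx)))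
    ((T b).weight_le_of_isAncestor (h.trans (WeightedTree.top_isAncestor_ex hi)))

/-- A cell is dominated by the next cell on the diagonal if that is not empty. -/
theorem CellDone.of_succ {f : ℝ} (hi : i + 1 ≤ (T false).ld (v false))
    (hj : j + 1 ≤ (T true).ld (v true)) (hm : Meet T v (i + 1) (j + 1))
    (h : CellDone T v (i + 1) (j + 1) f) : CellDone T v i j f := by
  obtain ⟨x, hx, hx'⟩ := hm
  intro y hy hy'
  refine le_trans ?_ (h x hx hx')
  exact add_le_add ((min_le_right _ _).trans (weight_ex_le hi hx))
    ((min_le_right _ _).trans (weight_ex_le hj hx'))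

/-- A cell is done, or the next cell on the diagonal is not empty. -/
def Covered (T : ∀ b, WeightedTree n (m b)) (v : ∀ b, Fin (m b)) (i j : ℕ) (f : ℝ) : Prop :=
  CellDone T v i j f ∨
    (i + 1 ≤ (T false).ld (v false) ∧ j + 1 ≤ (T true).ld (v true) ∧ Meet T v (i + 1) (j + 1))

theorem Covered.mono {f f' : ℝ} (h : Covered T v i j f) (hf : f ≤ f') : Covered T v i j f' :=
  h.imp_left fun h => h.mono hf

/-- Induction along the diagonal: a covered cell that is not done is dominated by its successor,
which has fewer levels of the first tree left. -/
theorem cellDone_of_covered {f : ℝ} (h : ∀ i j, i ≤ (T false).ld (v false) →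
    j ≤ (T true).ld (v true) → Covered T v i j f) (d : ℕ) : ∀ i j, i ≤ (T false).ld (v false) →
    j ≤ (T true).ld (v true) → (T false).ld (v false) - i ≤ d → CellDone T v i j f := by
  induction d with
  | zero =>
    intro i j hi hj hd
    rcases h i j hi hj with h1 | ⟨h1, -⟩
    · exact h1
    · omega
  | succ d ih =>
    intro i j hi hj hd
    rcases h i j hi hj with h1 | ⟨h1, h2, h3⟩
    · exact h1
    · exact CellDone.of_succ h1 h2 h3 (ih _ _ h1 h2 (by omega))

open Query

theorem wp_nextCell (H : Spec E T e) (hB : Base T v A) (hL : Levels E i j A)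
    (hi : i ≤ (T false).ld (v false)) (hj : j ≤ (T true).ld (v true)) (hloc : Located T v A)
    (hjj : A.r .jj = j + 1) {Q : AState → Prop}
    (hQ : ∀ A', Frame [.up, .t, .s false .lvl, .jj] A A' → A'.f = A.f →
      ((i + 1 ≤ (T false).ld (v false) ∧ Meet T v (i + 1) j ∧ A'.r (.s false .lvl) = i + 1 ∧
        A'.r .jj = j + 1) ∨ ((i + 1 ≤ (T false).ld (v false) → ¬ Meet T v (i + 1) j) ∧
        A'.r (.s false .lvl) = i ∧ A'.r .jj = j)) → Q A') :
    nextCell.wp E Q A := by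
  have hW := H.two_mul_le
  have hW' := H.W_ge
  have hK := E.K_pos
  have hn := (T false).n_pos
  have hiK := hL.lt
  have hjK := hL.lt'
  have hv := node_lt H false (v false)
  have hlog := Nat.log_le_self 2 n
  have hld := (T false).ld_le_log (v false)
  have hld' := (T true).ld_le_log (v true)
  have c0 := E.lt_two_pow (x := 0) (by omega)
  have c1 := E.lt_two_pow (x := 1) (by omega)
  have c2 := E.lt_two_pow (x := i + 1) (by omega)
  have g1 := (T false).gap_lt (U := T true) (u := v true) (j := j) (p := (T false).pos (v false))
  have c3 := E.lt_two_pow (x := (T false).gap (T true) (v true) j ((T false).pos (v false)) + 1)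
    (by omega)
  have hscr : A.scr false j = (T false).gap (T true) (v true) j ((T false).pos (v false)) :=
    hloc false j hj
  simp only [nextCell, Cmd.wp, rd, Ex.s, Ex.t, Ex.up, Ex.val_var, Ex.ok_var, Ex.ok_ofNat,
    Ex.val_ofNat, Ex.ok_tab, Ex.val_tab, Ex.ok_add, Ex.val_add, Ex.ok_sub, Ex.val_sub, Ex.ok_scr,
    Ex.val_scr, true_and, and_true, AState.set_r, AState.set_scr, reduceCtorEq,
    if_false, if_true, hL.lvl, hL.lvl', hB.dep, hB.node, hscr, H.lo, H.hi, hjj,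
    lt_irrefl, IsEmpty.forall_iff, not_false_eq_true,
    forall_const, zero_lt_one, not_true_eq_false]
  have fr : ∀ A' : AState, A'.scr = A.scr → (∀ x, x ∉ ([.up, .t, .s false .lvl, .jj] : List Var) →
      A'.r x = A.r x) → Frame [.up, .t, .s false .lvl, .jj] A A' := fun A' h1 h2 => ⟨h2, h1⟩
  refine ⟨c0, fun hlt => ?_, fun hge => ?_⟩
  · have hi' : i + 1 ≤ (T false).ld (v false) := hlt
    have hK' := ld_lt H hi'
    have l1 := (WeightedTree.lo_le_sub hi').trans (WeightedTree.sub_le_pos hi')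
    have l2 := WeightedTree.pos_lt_hi hi'
    have l3 := WeightedTree.hi_le (T := T false) (v := v false) (i := i + 1)
    have s1 : (T false).lo (v false) (i + 1) < E.tab (.s false .select) 0 j
        ((T false).gap (T true) (v true) j ((T false).pos (v false))) ↔
        cnt (T false).rk ((T true).blk (v true) j) ((T false).lo (v false) (i + 1)) <
          cnt (T false).rk ((T true).blk (v true) j) ((T false).pos (v false)) :=
      select_lt_iff H (b := false) (d := 0) hj (Nat.zero_le 1) (by omega)
    have s2 : (T false).hi (v false) (i + 1) < E.tab (.s false .select) 0 j
        ((T false).gap (T true) (v true) j ((T false).pos (v false)) + 1) ↔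
        cnt (T false).rk ((T true).blk (v true) j) ((T false).hi (v false) (i + 1)) <
          cnt (T false).rk ((T true).blk (v true) j) ((T false).pos (v false)) + 1 :=
      select_lt_iff H (b := false) (d := 1) hj le_rfl l3
    have hmeet : Meet T v (i + 1) j ↔
        cnt (T false).rk ((T true).blk (v true) j) ((T false).lo (v false) (i + 1)) <
        cnt (T false).rk ((T true).blk (v true) j) ((T false).hi (v false) (i + 1)) := by
      rw [cnt_lt_cnt_iff]
      constructor
      · rintro ⟨x, hx, hx'⟩
        exact ⟨x, hx', WeightedTree.mem_blk.mp hx⟩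
      · rintro ⟨x, hx', hx⟩
        exact ⟨x, WeightedTree.mem_blk.mpr hx, hx'⟩
    have m1 := cnt_mono (r := (T false).rk) (B := (T true).blk (v true) j) l1
    have m2 := cnt_mono (r := (T false).rk) (B := (T true).blk (v true) j) l2.le
    rw [s1, s2]
    have k1 : ((1 < 2 ^ w ∧ i + 1 < 2 ^ w) ∧ 0 < 2 ^ w ∧ i + 1 < E.K ∧ 0 < E.K ∧
      (v false : ℕ) < E.W) := ⟨⟨c1, c2⟩, c0, by omega, hK, by omega⟩
    refine ⟨by omega, k1, ⟨c0, hK, hjK, by omega⟩, fun h1 => ⟨c1, c0, ⟨c1, c2⟩, hQ _ (fr _ rfl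
      fun x hx => ?_) rfl (Or.inl ⟨hi', hmeet.mpr (h1.trans_le m2), ?_, ?_⟩)⟩, fun h1 => ⟨k1,
      ⟨c0, ⟨c1, c3⟩, hK, hjK, by omega⟩, fun h2 => ⟨c0, ⟨c1, by omega⟩, hQ _ (fr _ rfl
      fun x hx => ?_) rfl (Or.inr ⟨fun _ hm => ?_, ?_, ?_⟩)⟩,
      fun h2 => ⟨c1, c0, ⟨c1, c2⟩, hQ _ (fr _ rfl fun x hx => ?_) rfl
      (Or.inl ⟨hi', hmeet.mpr (by omega), ?_, ?_⟩)⟩⟩⟩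
    · simp only [List.mem_cons, List.not_mem_nil, or_false, not_or] at hx
      simp [hx]
    · simp
    · simp [hjj]
    · simp only [List.mem_cons, List.not_mem_nil, or_false, not_or] at hx
      simp [hx]
    · have := hmeet.mp hm
      omega
    · simp [hL.lvl]
    · simp
    · simp only [List.mem_cons, List.not_mem_nil, or_false, not_or] at hx
      simp [hx]
    · simp
    · simp [hjj]
  · refine ⟨c0, ⟨c1, by omega⟩, hQ _ (fr _ rfl fun x hx => ?_) rfl (Or.inr ⟨fun h => ?_, ?_, ?_⟩)⟩
    · simp only [List.mem_cons, List.not_mem_nil, or_false, not_or] at hx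
      simp [hx]
    · omega
    · simp [hL.lvl]
    · simp

/-- The variables that are changed by the walk. -/
def walkVars : List Var := cellVars ++ [.s false .lvl, .s true .lvl, .jj, .up]

/-- The running time of a step of the walk. -/
def stepTime (n : ℕ) : ℕ := cellInit.cost + (cellTime n + nextCell.cost)

/-- The running time of the walk. -/
def walkTime (n : ℕ) : ℕ := walkInit.cost + ((2 * Nat.log 2 n + 1) * (1 + stepTime n) + 1)

/-- The state during the walk. -/
structure WalkState (T : ∀ b, WeightedTree n (m b)) (v : ∀ b, Fin (m b)) (A₀ : AState) (i jj : ℕ)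
    (A : AState) : Prop where
  base : Base T v A
  frame : Frame walkVars A₀ A
  improves : Improves T v A₀ A
  lvl : A.r (.s false .lvl) = i
  rjj : A.r .jj = jj
  le : i ≤ (T false).ld (v false)
  le' : jj ≤ (T true).ld (v true) + 1
  covered : ∀ i' j', i' ≤ (T false).ld (v false) → j' ≤ (T true).ld (v true) →
    i' < i ∨ jj ≤ j' → Covered T v i' j' (A.f 0)

theorem Located.frame {S : List Var} (h : Located T v A) (hf : Frame S A A') : Located T v A' :=
  fun b j hj => by rw [hf.scr]; exact h b j hj

/-- Raising `i` is justified because the cell `(i + 1, j)` has a leaf: then so have the diagonal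
successors of all cells `(i, j')` with `j' < j`. Lowering `j` is justified because `(i + 1, j)` has
no leaf or is out of range: then no cell `(i', j)` with `i' > i` within range has one. -/
theorem WalkState.runs_step (H : Spec E T e) (hloc : Located T v A₀)
    (hS : WalkState T v A₀ i (j + 1) A) :
    Runs E (.seq cellInit.comp (.seq cell nextCell.comp)) A (stepTime n) fun A' =>
      WalkState T v A₀ (i + 1) (j + 1) A' ∧ i < (T false).ld (v false) ∨
        WalkState T v A₀ i j A' := by
  have hW := H.W_ge
  have hi := hS.le
  have hj : j ≤ (T true).ld (v true) := by have := hS.le'; omega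
  have c1 := E.lt_two_pow (x := 1) (by omega)
  refine Runs.seq (Q := fun A' => A' = A.set (.s true .lvl) j) (Cmd.runs _ ?_) ?_
  · simp only [cellInit, Cmd.wp, rd, Ex.val_var, Ex.ok_var, Ex.ok_ofNat, Ex.val_ofNat, Ex.ok_sub,
      Ex.val_sub, true_and, and_true, hS.rjj, Nat.add_sub_cancel]
    exact ⟨c1, by omega⟩
  rintro A1 rfl
  have hf1 : Frame [.s true .lvl] A (A.set (.s true .lvl) j) := ⟨fun x hx => by
    simp only [List.mem_cons, List.not_mem_nil, or_false] at hx
    simp [hx], rfl⟩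
  set A1 := A.set (.s true .lvl) j with hA1
  have hL1 : Levels E i j A1 := ⟨by rw [hf1.r _ (by simp), hS.lvl], by simp [hA1],
    by have := ld_lt H hi; omega, by have := ld_lt H hj; omega⟩
  have hB1 := hS.base.frame hf1 (by simp [Var.static])
  have hI1 : Improves T v A₀ A1 :=
    ⟨hS.improves.good.congr (fun b => hf1.r _ (by simp)) rfl, hS.improves.le⟩
  have hl1 := (hloc.frame hS.frame).frame hf1
  refine Runs.seq (runs_cell H hB1 hI1.good hL1 hi hj hl1) ?_
  rintro A2 ⟨hf2, hI2, hdone⟩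
  have hle : A.f 0 ≤ A2.f 0 := hI2.le
  refine Cmd.runs _ (wp_nextCell H (hB1.frame hf2 (by simp [Var.static, cellVars]))
    (hL1.frame hf2 (by simp [cellVars])) hi hj (hl1.frame hf2)
    (by rw [hf2.r _ (by simp [cellVars]), hf1.r _ (by simp), hS.rjj]) ?_)
  intro A3 hf3 e3 h3
  have hB3 := (hB1.frame hf2 (by simp [Var.static, cellVars])).frame hf3 (by simp [Var.static])
  have hF : Frame walkVars A₀ A3 := (((hS.frame.trans hf1).trans hf2).trans hf3).mono (by
    intro x hx
    simp only [walkVars, List.mem_append] at hx ⊢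
    rcases hx with ((hx | hx) | hx) | hx
    · exact hx
    · exact Or.inr (by revert x; simp)
    · exact Or.inl hx
    · revert x; simp [cellVars])
  have hI3 : Improves T v A₀ A3 :=
    ⟨hI2.good.congr (fun b => hf3.r _ (by simp)) (by rw [e3]),
      by rw [e3]; exact hI1.le.trans hI2.le⟩
  rcases h3 with ⟨k1, k2, k3, k4⟩ | ⟨k1, k2, k3⟩
  · refine Or.inl ⟨⟨hB3, hF, hI3, k3, k4, k1, hS.le', fun i' j' hi' hj' h => ?_⟩, k1⟩
    rw [e3]
    by_cases hold : i' < i ∨ j + 1 ≤ j'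
    · exact (hS.covered i' j' hi' hj' hold).mono hle
    · obtain rfl : i' = i := by omega
      rcases (show j' ≤ j by omega).eq_or_lt with rfl | hlt
      · exact Or.inl hdone
      · exact Or.inr ⟨k1, by omega, k2.mono k1 hj le_rfl (by omega)⟩
  · refine Or.inr ⟨hB3, hF, hI3, k2, k3, hi, by omega, fun i' j' hi' hj' h => ?_⟩
    rw [e3]
    by_cases hold : i' < i ∨ j + 1 ≤ j'
    · exact (hS.covered i' j' hi' hj' hold).mono hle
    · obtain rfl : j' = j := by omega
      rcases (show i ≤ i' by omega).eq_or_lt with rfl | hlt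
      · exact Or.inl hdone
      · exact Or.inl (cellDone_of_not_meet fun hm =>
          k1 (by omega) (hm.mono hi' hj hlt le_rfl))

theorem runs_walk (H : Spec E T e) (hB : Base T v A) (hG : Good T v A) (hloc : Located T v A) :
    Runs E walk A (walkTime n) fun A' => Frame walkVars A A' ∧ Improves T v A A' ∧
      ∀ i j, i ≤ (T false).ld (v false) → j ≤ (T true).ld (v true) →
        CellDone T v i j (A'.f 0) := by
  have hW := H.two_mul_le
  have hW' := H.W_ge
  have hlog := Nat.log_le_self 2 n
  have hld := (T false).ld_le_log (v false)
  have hld' := (T true).ld_le_log (v true)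
  have hn := (T false).n_pos
  have c0 := E.lt_two_pow (x := 0) (by omega)
  have c1 := E.lt_two_pow (x := 1) (by omega)
  have c2 := E.lt_two_pow (x := (T true).ld (v true) + 1) (by omega)
  refine Runs.seq (Q := fun A' => WalkState T v A 0 ((T true).ld (v true) + 1) A')
    (Cmd.runs _ ?_) fun A1 hS => ?_
  · simp only [walkInit, Cmd.wp, rd, Ex.val_var, Ex.ok_var, Ex.ok_ofNat, Ex.val_ofNat, Ex.ok_add,
      Ex.val_add, true_and, AState.set_r, reduceCtorEq, Var.s.injEq, and_false, if_false,
      Bool.true_eq_false, hB.dep]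
    refine ⟨c0, ⟨c1, c2⟩, ?_⟩
    have hf : Frame [.s false .lvl, .jj] A
        ((A.set (.s false .lvl) 0).set .jj ((T true).ld (v true) + 1)) := ⟨fun x hx => by
      simp only [List.mem_cons, List.not_mem_nil, or_false, not_or] at hx
      simp [hx], rfl⟩
    exact ⟨hB.frame hf (by simp [Var.static]), hf.mono (by simp [walkVars]),
      ⟨hG.congr (fun b => hf.r _ (by simp)) rfl, le_rfl⟩, by simp, by simp, Nat.zero_le _, le_rfl,
      fun i' j' _ hj' h => by omega⟩
  -- Each round raises `i` or lowers `jj`, so the number of cells visited is at most the sum of the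
  -- two numbers of light ancestors plus one.
  · refine Runs.whileLt (fun τ A' => ∃ i jj, ((T false).ld (v false) - i + jj) * (1 + stepTime n) + 1
      ≤ τ ∧ WalkState T v A i jj A') ?_ ?_ ⟨0, _, ?_, hS⟩
    · rintro τ A' ⟨i, jj, hτ, hS⟩ hn
      rw [hS.rjj, hS.base.zero] at hn
      obtain rfl : jj = 0 := by omega
      exact ⟨by omega, hS.frame, hS.improves, fun i j hi hj => cellDone_of_covered
        (fun i j hi hj => hS.covered i j hi hj (Or.inr (Nat.zero_le _))) _ i j hi hj le_rfl⟩
    · rintro τ A' ⟨i, jj, hτ, hS⟩ hn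
      rw [hS.rjj, hS.base.zero] at hn
      obtain ⟨j, rfl⟩ : ∃ j, jj = j + 1 := ⟨jj - 1, by omega⟩
      refine ⟨_, (hS.runs_step H hloc).mono le_rfl ?_⟩
      rintro A'' (⟨hS', hlt⟩ | hS')
      · refine ⟨_, ⟨i + 1, j + 1, le_rfl, hS'⟩, le_trans (le_of_eq ?_) hτ⟩
        obtain ⟨d, hd⟩ : ∃ d, (T false).ld (v false) - i = d + 1 :=
          ⟨(T false).ld (v false) - i - 1, by omega⟩
        rw [hd, show (T false).ld (v false) - (i + 1) = d by omega]
        ring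
      · refine ⟨_, ⟨i, j, le_rfl, hS'⟩, le_trans (le_of_eq ?_) hτ⟩
        ring
    · exact Nat.add_le_add_right (Nat.mul_le_mul_right _ (by omega)) _

end

/-! ### Locating the query nodes in the lists -/

section

variable {w n : ℕ} {m : Bool → ℕ} {E : Env w} {T : ∀ b, WeightedTree n (m b)}
  {e : ℕ → ℕ → ℕ → ∀ b, Fin (m b)} {v : ∀ b, Fin (m b)} {A A' A'' A₀ : AState} {b : Bool}
  {j l h : ℕ}

/-- The states agree except for the variables of the location loop and the scratch memory. -/
structure LocFrame (A A' : AState) : Prop where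
  r : ∀ x, x ∉ ([.j, .l, .lim, .base, .t, .h, .mid] : List Var) → A'.r x = A.r x
  f : A'.f = A.f

theorem LocFrame.trans (h : LocFrame A A') (h' : LocFrame A' A'') : LocFrame A A'' :=
  ⟨fun x hx => (h'.r x hx).trans (h.r x hx), h'.f.trans h.f⟩

theorem Base.locFrame (h : Base T v A) (hf : LocFrame A A') : Base T v A' :=
  h.congr fun x hx => hf.r x fun hx' => by
    simp only [List.mem_cons, List.not_mem_nil, or_false] at hx'
    rcases hx' with rfl | rfl | rfl | rfl | rfl | rfl | rfl <;> cases hx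

theorem Good.locFrame (h : Good T v A) (hf : LocFrame A A') : Good T v A' :=
  h.congr (fun b => hf.r _ (by simp)) (by rw [hf.f])

/-- The scratch memory after the first `j` levels. -/
structure ScrUpTo (g : ℕ → ℕ) (b : Bool) (j : ℕ) (A A' : AState) : Prop where
  new : ∀ j' < j, A'.scr b j' = g j'
  old : ∀ b' j', (b' = b → j ≤ j') → A'.scr b' j' = A.scr b' j'

theorem ScrUpTo.zero (g : ℕ → ℕ) (b : Bool) (h : A'.scr = A.scr) : ScrUpTo g b 0 A A' :=
  ⟨fun _ h => absurd h (Nat.not_lt_zero _), fun _ _ _ => by rw [h]⟩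

theorem ScrUpTo.congr {g : ℕ → ℕ} (h : ScrUpTo g b j A A') (hs : A''.scr = A'.scr) :
    ScrUpTo g b j A A'' :=
  ⟨fun j' hj' => by rw [hs]; exact h.new j' hj', fun b' j' h' => by rw [hs]; exact h.old b' j' h'⟩

theorem ScrUpTo.succ {g : ℕ → ℕ} (h : ScrUpTo g b j A A')
    (hs : A''.scr = (A'.setScr b j (g j)).scr) : ScrUpTo g b (j + 1) A A'' := by
  refine ⟨fun j' hj' => ?_, fun b' j' h' => ?_⟩
  · rw [hs, AState.setScr_scr]
    split_ifs with h1
    · rw [h1.2]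
    · exact h.new j' (by simp at h1; omega)
  · rw [hs, AState.setScr_scr, if_neg, h.old b' j' fun hb => (Nat.le_succ j).trans (h' hb)]
    rintro ⟨h1, rfl⟩
    exact absurd (h' h1) (by omega)

open Query

theorem wp_locateInit (H : Spec E T e) (hB : Base T v A) {Q : AState → Prop}
    (hQ : ∀ A', LocFrame A A' → A'.scr = A.scr → A'.r .j = 0 → A'.r .l = 0 →
      A'.r .lim = (T !b).ld (v !b) + 1 → Q A') : (locateInit b).wp E Q A := by
  have hW := H.two_mul_le
  have hW' := H.W_ge
  have hlog := Nat.log_le_self 2 n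
  have hld' := (T !b).ld_le_log (v !b)
  have hn := (T b).n_pos
  have c0 := E.lt_two_pow (x := 0) (by omega)
  have c1 := E.lt_two_pow (x := 1) (by omega)
  have c2 := E.lt_two_pow (x := (T !b).ld (v !b) + 1) (by omega)
  simp only [locateInit, Cmd.wp, rd, Ex.val_var, Ex.ok_var, Ex.ok_ofNat, Ex.val_ofNat, Ex.ok_add,
    Ex.val_add, true_and, AState.set_r, reduceCtorEq, if_false, hB.dep]
  refine ⟨c0, c0, ⟨c1, c2⟩, hQ _ ⟨fun x hx => ?_, rfl⟩ rfl ?_ ?_ ?_⟩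
  · simp only [List.mem_cons, List.not_mem_nil, or_false, not_or] at hx
    simp [hx]
  all_goals simp

/-- The state of the binary search for the rank of `v b` in a block of the other tree. -/
structure SearchState (T : ∀ b, WeightedTree n (m b)) (v : ∀ b, Fin (m b)) (b : Bool) (j : ℕ)
    (A₀ : AState) (l h : ℕ) (A : AState) : Prop where
  base : Base T v A
  frame : LocFrame A₀ A
  scr : A.scr = A₀.scr
  rj : A.r .j = j
  rbase : A.r .base = 4 * (T !b).lo (v !b) j
  rl : A.r .l = l
  rh : A.r .h = h
  lim : A.r .lim = (T !b).ld (v !b) + 1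
  le : l ≤ cnt (T b).rk ((T !b).blk (v !b) j) ((T b).pos (v b))
  ge : cnt (T b).rk ((T !b).blk (v !b) j) ((T b).pos (v b)) ≤ h
  le_card : h ≤ ((T !b).blk (v !b) j).card

theorem SearchState.wp_search (H : Spec E T e) (hj : j ≤ (T !b).ld (v !b))
    (hS : SearchState T v b j A₀ l h A) (hlt : l < h) {Q : AState → Prop}
    (hQ : ∀ A' l' h', SearchState T v b j A₀ l' h' A' → 2 * (h' - l') ≤ h - l → Q A') :
    (search b).wp E Q A := by
  have hW := H.two_mul_le
  have hW' := H.W_ge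
  have hK := E.K_pos
  have hjK := ld_lt H hj
  have hcard := (T !b).card_blk_le (v := v !b) (i := j)
  have hhi := (T !b).hi_le (v := v !b) (i := j)
  have hhi' := (T !b).hi_eq (v := v !b) (i := j)
  have hc := hS.le_card
  have c0 := E.lt_two_pow (x := 0) (by omega)
  have c1 := E.lt_two_pow (x := 1) (by omega)
  have c2 := E.lt_two_pow (x := 2) (by omega)
  have c3 := E.lt_two_pow (x := l + h) (by omega)
  have c4 := E.lt_two_pow (x := (l + h) / 2 + 1) (by omega)
  have c5 := E.lt_two_pow (x := 4 * (T !b).lo (v !b) j + ((l + h) / 2 + 1)) (by omega)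
  have hpos : (T b).pos (v b) ≤ n := ((T b).pos_lt_fin (v b)).le.trans ((T b).fin_le _)
  have hsel := H.select b (v !b) j hj ((l + h) / 2 + 1) (by omega) _ hpos
  rw [← not_lt, not_iff_comm, not_le] at hsel
  simp only [search, Cmd.wp, rd, Ex.s, Ex.j, Ex.mid, Ex.val_var, Ex.ok_var, Ex.ok_ofNat, Ex.val_ofNat, Ex.ok_add,
    Ex.val_add, Ex.ok_div, Ex.val_div, Ex.ok_tab, Ex.val_tab, true_and, AState.set_r,
    reduceCtorEq, if_false, if_true, hS.rl, hS.rh, hS.rj, hS.rbase, hS.base.pos, ← hsel]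
  have key : ∀ A' : AState, (∀ x, x ∉ ([.l, .h, .mid] : List Var) → A'.r x = A.r x) →
      A'.f = A.f → A'.scr = A.scr → ∀ l' h', A'.r .l = l' → A'.r .h = h' →
      l' ≤ cnt (T b).rk ((T !b).blk (v !b) j) ((T b).pos (v b)) →
      cnt (T b).rk ((T !b).blk (v !b) j) ((T b).pos (v b)) ≤ h' →
      h' ≤ h → SearchState T v b j A₀ l' h' A' := by
    intro A' h1 h2 h3 l' h' h4 h5 h6 h7 h8
    have hf : LocFrame A A' := ⟨fun x hx => h1 x (by
      simp only [List.mem_cons, List.not_mem_nil, or_false, not_or] at hx ⊢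
      simp [hx]), h2⟩
    exact ⟨hS.base.locFrame hf, hS.frame.trans hf, h3.trans hS.scr,
      by rw [h1 _ (by simp), hS.rj], by rw [h1 _ (by simp), hS.rbase], h4, h5,
      by rw [h1 _ (by simp), hS.lim], h6, h7, h8.trans hc⟩
  refine ⟨⟨c3, c2⟩, ⟨⟨c0, ⟨⟨c1, c4⟩, c5⟩, hK, by omega, by omega⟩, fun hle => hQ _ l ((l + h) / 2)
    (key _ (fun x hx => ?_) (by rfl) (by rfl) l ((l + h) / 2) ?_ ?_ hS.le (by omega) (by omega)) (by omega),
    fun hle => ⟨⟨c1, c4⟩, hQ _ ((l + h) / 2 + 1) h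
    (key _ (fun x hx => ?_) (by rfl) (by rfl) ((l + h) / 2 + 1) h ?_ ?_ (by omega) hS.ge le_rfl) (by omega)⟩⟩⟩
  · simp only [List.mem_cons, List.not_mem_nil, or_false, not_or] at hx
    simp [hx]
  · simp [hS.rl]
  · simp
  · simp only [List.mem_cons, List.not_mem_nil, or_false, not_or] at hx
    simp [hx]
  · simp
  · simp [hS.rh]

/-- Each round at least halves the length of the range, so `μ` rounds suffice. -/
theorem SearchState.runs_search (H : Spec E T e) (hj : j ≤ (T !b).ld (v !b)) {μ : ℕ}
    (hS : SearchState T v b j A₀ l h A) (hμ : h - l < 2 ^ μ) :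
    Runs E (whileLt .l .h (search b).comp) A (μ * (1 + (search b).cost) + 1) fun A' =>
      ∃ l, SearchState T v b j A₀ l l A' := by
  refine Runs.whileLt (fun τ A' => ∃ μ l h, τ = μ * (1 + (search b).cost) + 1 ∧ h - l < 2 ^ μ ∧
    SearchState T v b j A₀ l h A') ?_ ?_ ⟨μ, l, h, rfl, hμ, hS⟩
  · rintro τ A' ⟨μ, l, h, rfl, hμ, hS⟩ hn
    rw [hS.rl, hS.rh] at hn
    have := hS.le.trans hS.ge
    obtain rfl : l = h := by omega
    exact ⟨by omega, l, hS⟩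
  · rintro τ A' ⟨μ, l, h, rfl, hμ, hS⟩ hn
    rw [hS.rl, hS.rh] at hn
    cases μ with
    | zero => rw [pow_zero] at hμ; omega
    | succ μ =>
      refine ⟨_, Cmd.runs _ (hS.wp_search H hj hn fun A'' l' h' hS' hle =>
        ⟨_, ⟨μ, l', h', rfl, ?_, hS'⟩, le_of_eq (by ring)⟩)⟩
      rw [pow_succ] at hμ
      omega

/-- A bound on the logarithms of the sizes of the ranges that remain to be searched. -/
noncomputable def potential (T : ∀ b, WeightedTree n (m b)) (v : ∀ b, Fin (m b)) (b : Bool)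
    (j : ℕ) : ℕ :=
  if j = 0 then 2 * Nat.log 2 n else Nat.log 2 ((T b).blk (v b) (j - 1)).card

/-- Beyond level `0` the slack is the rounded ratio of two consecutive block sizes, so its logarithm
is paid for by the drop in the logarithm of the block size. The value `2 * Nat.log 2 n` at level `0`
pays for the full search there and leaves enough for the logarithm of the first block. -/
theorem log_slack_add_potential_le (hj : j ≤ (T b).ld (v b)) :
    Nat.log 2 ((T b).slack (v b) j) + potential T v b (j + 1) ≤ potential T v b j := by
  have h1 : potential T v b (j + 1) = Nat.log 2 ((T b).blk (v b) j).card := by simp [potential]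
  rw [h1]
  by_cases h0 : j = 0
  · subst h0
    have := Nat.log_mono_right (b := 2) ((T b).card_blk_le (v := v b) (i := 0))
    simp only [potential, WeightedTree.slack, if_true]
    omega
  · rw [potential, if_neg h0, WeightedTree.slack, if_neg h0]
    have hg := WeightedTree.grain_pos hj
    rw [WeightedTree.grain, if_neg h0] at hg ⊢
    have hb := (T b).card_blk_pos (v := v b) (i := j)
    refine Nat.le_log_of_pow_le (by norm_num) ?_
    rw [pow_add]
    refine (Nat.mul_le_mul (Nat.pow_log_le_self 2 hg.ne') (Nat.pow_log_le_self 2 hb.ne')).trans ?_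
    exact Nat.div_mul_le_self _ _

/-- The running time of a level of the location loop, apart from the search. -/
def levelTime (b : Bool) : ℕ :=
  1 + (locateStart b).cost + (1 + (search b).cost + 1) + (locateEnd b).cost

/-- The running time of the location loop. -/
def locateTime (n : ℕ) (b : Bool) : ℕ :=
  (locateInit b).cost + ((Nat.log 2 n + 1) * levelTime b + 2 * Nat.log 2 n * (1 + (search b).cost) + 1)

/-- The state of the location loop. -/
structure LocState (T : ∀ b, WeightedTree n (m b)) (v : ∀ b, Fin (m b)) (b : Bool)
    (A₀ : AState) (j : ℕ) (A : AState) : Prop where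
  base : Base T v A
  frame : LocFrame A₀ A
  scr : ScrUpTo (fun j => (T b).gap (T !b) (v !b) j ((T b).pos (v b))) b j A₀ A
  rj : A.r .j = j
  rl : A.r .l = (T b).prev (T !b) (v !b) j ((T b).pos (v b))
  lim : A.r .lim = (T !b).ld (v !b) + 1
  le : j ≤ (T !b).ld (v !b) + 1

theorem LocState.wp_locateStart (H : Spec E T e) (hj : j ≤ (T !b).ld (v !b))
    (hS : LocState T v b A₀ j A) {Q : AState → Prop}
    (hQ : ∀ A' l h, SearchState T v b j A l h A' → h - l ≤ (T !b).slack (v !b) j → Q A') :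
    (locateStart b).wp E Q A := by
  have hW := H.two_mul_le
  have hW' := H.W_ge
  have hK := E.K_pos
  have hjK := ld_lt H hj
  have hv := node_lt H (!b) (v !b)
  have hcard := (T !b).card_blk_le (v := v !b) (i := j)
  have hhi := (T !b).hi_le (v := v !b) (i := j)
  have hhi' := (T !b).hi_eq (v := v !b) (i := j)
  have hdiv := WeightedTree.prev_div_grain_lt (T := T b) (p := (T b).pos (v b)) hj
  obtain ⟨k1, k2, k3, k4⟩ := H.locate b (v !b) j ((T b).pos (v b)) hj
  have c0 := E.lt_two_pow (x := 0) (by omega)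
  have c1 := E.lt_two_pow (x := 1) (by omega)
  have c2 := E.lt_two_pow (x := 4) (by omega)
  have c3 := E.lt_two_pow (x := 4 * (T !b).lo (v !b) j) (by omega)
  have c4 := E.lt_two_pow (x := 4 * (T !b).lo (v !b) j +
    (T b).prev (T !b) (v !b) j ((T b).pos (v b)) / (T !b).grain (v !b) j) (by omega)
  have c5 := E.lt_two_pow (x := 4 * (T !b).lo (v !b) j +
    (T b).prev (T !b) (v !b) j ((T b).pos (v b)) / (T !b).grain (v !b) j + 1) (by omega)
  simp only [locateStart, Cmd.wp, rd, Ex.s, Ex.j, Ex.t, Ex.val_var, Ex.ok_var, Ex.ok_ofNat, Ex.val_ofNat,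
    Ex.ok_add, Ex.val_add, Ex.ok_div, Ex.val_div, Ex.ok_mul, Ex.val_mul, Ex.ok_tab, Ex.val_tab,
    true_and, AState.set_r, reduceCtorEq, if_false, if_true, hS.rl, hS.rj, hS.base.node,
    H.lo, H.grain b j (v !b) hj]
  refine ⟨⟨c2, ⟨c0, by omega, hK, by omega⟩, c3⟩, ⟨⟨c0, by omega, hK, by omega⟩, c4⟩,
    ⟨c0, hK, by omega, by omega⟩, ⟨c0, ⟨c1, c5⟩, hK, by omega, by omega⟩, hQ _ _ _
    ⟨hS.base.congr fun x hx => ?_, ⟨fun x hx => ?_, rfl⟩, rfl, ?_, ?_, by simp, by simp,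
      ?_, k1, k2, k4⟩ (by omega)⟩
  · cases x <;> simp [Var.static] at hx ⊢
  · simp only [List.mem_cons, List.not_mem_nil, or_false, not_or] at hx
    simp [hx]
  · simp [hS.rj]
  · simp
  · simp [hS.lim]

theorem LocState.runs_level (H : Spec E T e) (hj : j ≤ (T !b).ld (v !b))
    (hS : LocState T v b A₀ j A) :
    Runs E (.seq (locateStart b).comp (.seq (whileLt .l .h (search b).comp) (locateEnd b).comp)) A
      ((locateStart b).cost + ((Nat.log 2 ((T !b).slack (v !b) j) + 1) * (1 + (search b).cost) + 1 +
        (locateEnd b).cost)) fun A' => LocState T v b A₀ (j + 1) A' := by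
  refine Runs.seq (Q := fun A' => ∃ l h, SearchState T v b j A l h A' ∧
    h - l ≤ (T !b).slack (v !b) j) (Cmd.runs _ (hS.wp_locateStart H hj
      fun A' l h h1 h2 => ⟨l, h, h1, h2⟩)) ?_
  rintro A1 ⟨l, h, hS1, hle⟩
  refine Runs.seq (hS1.runs_search H hj
    (hle.trans_lt (Nat.lt_pow_succ_log_self (by norm_num) _))) ?_
  rintro A2 ⟨l, hS2⟩
  refine Cmd.runs _ ?_
  have hW := H.two_mul_le
  have hW' := H.W_ge
  have hlog := Nat.log_le_self 2 n
  have hld' := (T !b).ld_le_log (v !b)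
  have hg := (T b).gap_lt (U := T !b) (u := v !b) (j := j) (p := (T b).pos (v b))
  have hl : l = cnt (T b).rk ((T !b).blk (v !b) j) ((T b).pos (v b)) := le_antisymm hS2.le hS2.ge
  have c1 := E.lt_two_pow (x := 1) (by omega)
  have c2 := E.lt_two_pow (x := j + 1) (by omega)
  have c3 := E.lt_two_pow (x := 4 * (T !b).lo (v !b) j + l) (by
    rw [hl]; unfold WeightedTree.gap at hg; omega)
  simp only [locateEnd, Cmd.wp, rd, Ex.j, Ex.val_var, Ex.ok_var, Ex.ok_ofNat, Ex.val_ofNat,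
    Ex.ok_add, Ex.val_add, true_and, AState.setScr_r, hS2.rj, hS2.rbase, hS2.rl]
  refine ⟨c3, by omega, ⟨c1, c2⟩, hS2.base.congr fun x hx => ?_, hS.frame.trans (hS2.frame.trans
    ⟨fun x hx => ?_, rfl⟩), (hS.scr.congr hS2.scr).succ ?_, ?_, ?_, ?_, by omega⟩
  · cases x <;> simp [Var.static] at hx ⊢
  · simp only [List.mem_cons, List.not_mem_nil, or_false, not_or] at hx
    simp [hx]
  · rw [AState.set_scr, hl]
    rfl
  · simp
  · simp [WeightedTree.prev, hS2.rl, hl]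
  · simp [hS2.lim]

/-- Besides the number of levels, the time is governed by the potential, which telescopes. All the
binary searches together take `O(log n)` steps, whereas separate searches in full lists would take
the square of that. -/
theorem runs_locate (H : Spec E T e) (hB : Base T v A) :
    Runs E (locate b) A (locateTime n b) fun A' => Base T v A' ∧ LocFrame A A' ∧
      ScrUpTo (fun j => (T b).gap (T !b) (v !b) j ((T b).pos (v b))) b ((T !b).ld (v !b) + 1)
        A A' := by
  refine Runs.seq (Q := fun A' => LocState T v b A 0 A') (Cmd.runs _ (wp_locateInit H hB
    fun A' h1 h2 h3 h4 h5 => ⟨hB.locFrame h1, h1, ScrUpTo.zero _ _ h2, h3, ?_, h5,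
      Nat.zero_le _⟩)) fun A1 hS => ?_
  · rw [h4]; simp [WeightedTree.prev]
  · have hld := (T !b).ld_le_log (v !b)
    refine Runs.whileLt (fun τ A' => ∃ j, ((T !b).ld (v !b) + 1 - j) * levelTime b +
      potential T v (!b) j * (1 + (search b).cost) + 1 ≤ τ ∧ LocState T v b A j A') ?_ ?_
      ⟨0, ?_, hS⟩
    · rintro τ A' ⟨j, hτ, hS⟩ hn
      rw [hS.rj, hS.lim] at hn
      have := hS.le
      obtain rfl : j = (T !b).ld (v !b) + 1 := by omega
      exact ⟨by omega, hS.base, hS.frame, hS.scr⟩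
    · rintro τ A' ⟨j, hτ, hS⟩ hn
      rw [hS.rj, hS.lim] at hn
      refine ⟨_, (hS.runs_level H (by omega)).mono le_rfl fun A'' hS' =>
        ⟨_, ⟨j + 1, le_rfl, hS'⟩, le_trans ?_ hτ⟩⟩
      have h1 := log_slack_add_potential_le (T := T) (v := v) (b := !b) (j := j) (by omega)
      have h2 := Nat.mul_le_mul_right (1 + (search b).cost) h1
      obtain ⟨d, hd⟩ : ∃ d, (T !b).ld (v !b) + 1 - j = d + 1 := ⟨(T !b).ld (v !b) - j, by omega⟩
      rw [hd, show (T !b).ld (v !b) + 1 - (j + 1) = d by omega]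
      rw [add_mul] at h2
      have h3 : (d + 1) * levelTime b = d * levelTime b + levelTime b := by ring
      have h4 : (Nat.log 2 ((T !b).slack (v !b) j) + 1) * (1 + (search b).cost)
        = Nat.log 2 ((T !b).slack (v !b) j) * (1 + (search b).cost) + (1 + (search b).cost) := by
        ring
      rw [h3, h4]
      unfold levelTime
      omega
    · refine Nat.add_le_add_right (Nat.add_le_add (Nat.mul_le_mul_right _ (by omega)) (le_of_eq ?_)) _
      simp [potential]

/-- The running time of erasing the scratch memory. -/
def eraseTime (n : ℕ) (b : Bool) : ℕ :=
  (locateInit b).cost + ((Nat.log 2 n + 1) * (1 + (eraseBody b).cost) + 1)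

theorem runs_erase (H : Spec E T e) (hB : Base T v A) :
    Runs E (erase b) A (eraseTime n b) fun A' => Base T v A' ∧ LocFrame A A' ∧
      ScrUpTo (fun _ => 0) b ((T !b).ld (v !b) + 1) A A' := by
  have hW := H.two_mul_le
  have hW' := H.W_ge
  have hlog := Nat.log_le_self 2 n
  have hld := (T !b).ld_le_log (v !b)
  have hn := (T b).n_pos
  have c0 := E.lt_two_pow (x := 0) (by omega)
  have c1 := E.lt_two_pow (x := 1) (by omega)
  refine Runs.seq (Q := fun A' => Base T v A' ∧ LocFrame A A' ∧ ScrUpTo (fun _ => 0) b 0 A A' ∧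
    A'.r .j = 0 ∧ A'.r .lim = (T !b).ld (v !b) + 1) (Cmd.runs _ (wp_locateInit H hB
      fun A' h1 h2 h3 h4 h5 => ⟨hB.locFrame h1, h1, ScrUpTo.zero _ _ h2, h3, h5⟩)) ?_
  rintro A1 ⟨hB1, hf1, hs1, hj1, hl1⟩
  refine Runs.whileLt (fun τ A' => ∃ j, ((T !b).ld (v !b) + 1 - j) * (1 + (eraseBody b).cost) + 1 ≤ τ
      ∧ Base T v A' ∧ LocFrame A A' ∧ ScrUpTo (fun _ => 0) b j A A' ∧ A'.r .j = j ∧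
      A'.r .lim = (T !b).ld (v !b) + 1 ∧ j ≤ (T !b).ld (v !b) + 1) ?_ ?_
      ⟨0, ?_, hB1, hf1, hs1, hj1, hl1, Nat.zero_le _⟩
  · rintro τ A' ⟨j, hτ, h1, h2, h3, h4, h5, h6⟩ hn
    rw [h4, h5] at hn
    obtain rfl : j = (T !b).ld (v !b) + 1 := by omega
    exact ⟨by omega, h1, h2, h3⟩
  · rintro τ A' ⟨j, hτ, h1, h2, h3, h4, h5, h6⟩ hn
    rw [h4, h5] at hn
    have c2 := E.lt_two_pow (x := j + 1) (by omega)
    refine ⟨_, Cmd.runs _ (Q := fun A'' => A'' = (A'.setScr b j 0).set .j (j + 1)) ?_ |>.mono le_rfl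
      ?_⟩
    · simp only [eraseBody, Cmd.wp, rd, Ex.j, Ex.val_var, Ex.ok_var, Ex.ok_ofNat, Ex.val_ofNat,
        Ex.ok_add, Ex.val_add, true_and, and_true, AState.setScr_r, h4]
      exact ⟨c0, by omega, c1, c2⟩
    · rintro A'' rfl
      have hf : LocFrame A' ((A'.setScr b j 0).set .j (j + 1)) := ⟨fun x hx => by
        simp only [List.mem_cons, List.not_mem_nil, or_false, not_or] at hx
        simp [hx], rfl⟩
      refine ⟨_, ⟨j + 1, le_rfl, h1.locFrame hf, h2.trans hf, h3.succ rfl, by simp, by simp [h5],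
        hn⟩, le_trans (le_of_eq ?_) hτ⟩
      obtain ⟨d, hd⟩ : ∃ d, (T !b).ld (v !b) + 1 - j = d + 1 := ⟨(T !b).ld (v !b) - j, by omega⟩
      rw [hd, show (T !b).ld (v !b) + 1 - (j + 1) = d by omega]
      ring
  · exact Nat.add_le_add_right (Nat.mul_le_mul_right _ (by omega)) _

end

/-! ### Correctness of the query program -/

section

variable {w n : ℕ} {m : Bool → ℕ} {E : Env w} {T : ∀ b, WeightedTree n (m b)}
  {e : ℕ → ℕ → ℕ → ∀ b, Fin (m b)} {v : ∀ b, Fin (m b)} {A A' A'' : AState}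

theorem valid_root (T : ∀ b, WeightedTree n (m b)) (v : ∀ b, Fin (m b)) :
    Valid T v fun b => (T b).root :=
  ⟨⟨0, (T false).n_pos⟩, fun _ => ⟨isAncestor_root _, isAncestor_root _⟩⟩

open Query

theorem wp_init (H : Spec E T e) (hv : ∀ b, A.r (.s b .node) = v b) (hz : A.r .zero = 0)
    {Q : AState → Prop} (hQ : ∀ A', A'.scr = A.scr → Base T v A' → Good T v A' → Q A') :
    init.wp E Q A := by
  have hW := H.two_mul_le
  have hW' := H.W_ge
  have hK := E.K_pos
  have c : ∀ k ≤ 32, k < 2 ^ w := fun k hk => E.lt_two_pow (by omega)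
  have hv0 := node_lt H false (v false)
  have hv1 := node_lt H true (v true)
  have b2 := E.lt_two_pow (x := m false + (T true).root) (by
    have := off_lt H true; have := node_lt H true (T true).root; simp at *; omega)
  have b1 := E.lt_two_pow (x := (T false).root) (by
    have := node_lt H false (T false).root; omega)
  have k1 := off_add_lt H false (T false).root
  have k2 := off_add_lt H true (T true).root
  have w1 := H.weight false (T false).root
  have w2 := H.weight true (T true).root
  have r1 := H.par_root false
  have r2 := H.par_root true
  simp only [Bool.false_eq_true, if_false, if_true, zero_add] at k1 k2 w1 w2 r1 r2
  simp only [init, initSide, initGlobal, Cmd.wp, rd, Ex.s, Ex.val_var, Ex.ok_var, Ex.ok_ofNat,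
    Ex.val_ofNat, Ex.ok_tab, Ex.val_tab, Ex.ok_add, Ex.val_add, true_and, and_true, AState.set_r,
    AState.setF_r, reduceCtorEq, Var.s.injEq, and_false, if_false, if_true, Bool.true_eq_false,
    Bool.false_eq_true, hv, H.ld, H.pos, H.par_off, H.par_heap, H.par_block, H.par_sparse,
    r1, r2, w1, w2, zero_add]
  have c0 := c 0 (by omega)
  refine ⟨⟨c0, c0, hK, hK, by omega⟩, ⟨c0, c0, hK, hK, by omega⟩, ⟨c0, c0, hK, hK, by omega⟩,
    ⟨c0, c0, hK, hK, by omega⟩, c0,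
    ⟨c0, c0, c 2 (by omega), hK, hK, by omega⟩, ⟨c0, c0, c 3 (by omega), hK, hK, by omega⟩,
    ⟨c0, c0, c 4 (by omega), hK, hK, by omega⟩, ⟨c0, c0, c 5 (by omega), hK, hK, by omega⟩,
    ⟨c0, c0, c 6 (by omega), hK, hK, by omega⟩, ⟨c0, c0, c 7 (by omega), hK, hK, by omega⟩,
    b1, k1, b2, k2, hQ _ rfl ⟨?_, ?_, ?_, ?_, ?_, ?_, ?_, ?_⟩
    ⟨_, valid_root T v, ?_, ?_⟩⟩
  · simp [hz]
  · simp [hv]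
  · intro b; cases b <;> simp
  · intro b; cases b <;> simp
  · intro b; cases b <;> simp
  · simp
  · simp
  · simp
  · intro b; cases b <;> simp
  · simp [wsum]

/-- The running time of the query program. -/
def queryTime (n : ℕ) : ℕ :=
  4 + (init.cost + (locateTime n false + (locateTime n true + (walkTime n + (eraseTime n false +
    (eraseTime n true + output.cost))))))

theorem runs_main (H : Spec E T e) (hv : ∀ b, A.r (.s b .node) = v b) (hz : A.r .zero = 0)
    (hscr : A.scr = fun _ _ => 0) :
    Runs E main A (init.cost + (locateTime n false + (locateTime n true + (walkTime n +
      (eraseTime n false + (eraseTime n true + output.cost)))))) fun A' =>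
      A'.scr = (fun _ _ => 0) ∧ ∃ u, Valid T v u ∧ (∀ b, A'.r (.s b .node) = u b) ∧
        ∀ i j, i ≤ (T false).ld (v false) → j ≤ (T true).ld (v true) →
          CellDone T v i j (wsum T u) := by
  refine Runs.seq (Q := fun A' => A'.scr = A.scr ∧ Base T v A' ∧ Good T v A')
    (Cmd.runs _ (wp_init H hv hz fun A' h1 h2 h3 => ⟨h1, h2, h3⟩)) ?_
  rintro A1 ⟨hs1, hB1, hG1⟩
  rw [hscr] at hs1
  refine Runs.seq (runs_locate H hB1) ?_
  rintro A2 ⟨hB2, hf2, hs2⟩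
  refine Runs.seq (runs_locate H hB2) ?_
  rintro A3 ⟨hB3, hf3, hs3⟩
  have hG3 := (hG1.locFrame hf2).locFrame hf3
  have hloc : Located T v A3 := by
    intro b j hj
    cases b
    · rw [hs3.old false j (by simp), hs2.new j (Nat.lt_succ_of_le hj)]
    · rw [hs3.new j (Nat.lt_succ_of_le hj)]
  refine Runs.seq (runs_walk H hB3 hG3 hloc) ?_
  rintro A4 ⟨hf4, hI4, hdone⟩
  refine Runs.seq (runs_erase H (hB3.frame hf4 (by simp [Var.static, walkVars, cellVars]))) ?_
  rintro A5 ⟨hB5, hf5, hs5⟩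
  refine Runs.seq (runs_erase H hB5) ?_
  rintro A6 ⟨hB6, hf6, hs6⟩
  -- The entries written while locating are exactly the ones erased; all others still have their
  -- initial value zero.
  have hscr6 : A6.scr = fun _ _ => 0 := by
    funext b j
    cases b
    · rw [hs6.old false j (by simp)]
      by_cases hj : j < (T !false).ld (v !false) + 1
      · rw [hs5.new j hj]
      · rw [hs5.old false j fun _ => not_lt.mp hj, hf4.scr, hs3.old false j (by simp),
          hs2.old false j fun _ => not_lt.mp hj, hs1]
    · by_cases hj : j < (T !true).ld (v !true) + 1
      · rw [hs6.new j hj]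
      · rw [hs6.old true j fun _ => not_lt.mp hj, hs5.old true j (by simp), hf4.scr,
          hs3.old true j fun _ => not_lt.mp hj, hs2.old true j (by simp), hs1]
  obtain ⟨u, hu, hbest, hf⟩ := (hI4.good.locFrame hf5).locFrame hf6
  have hf' : A4.f 0 = wsum T u := by rw [← hf, hf6.f, hf5.f]
  refine Cmd.runs _ ?_
  simp only [output, Cmd.wp, Ex.s, Ex.val_var, Ex.ok_var, true_and, AState.set_r, Var.s.injEq,
    reduceCtorEq, and_false, if_false, hbest]
  refine ⟨hscr6, u, hu, fun b => ?_, fun i j hi hj => hf' ▸ hdone i j hi hj⟩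
  cases b <;> simp

/-- A competing pair belongs to the cell given by `ld u₁` and `ld u₂`. Each of its nodes is above
the exit of the query node and above that of the common leaf, so its weight is at most the
corresponding minimum in `leafWeight`. -/
theorem isHeaviestInducedAncestors_of_cellDone {u : ∀ b, Fin (m b)} (hu : Valid T v u)
    (h : ∀ i j, i ≤ (T false).ld (v false) → j ≤ (T true).ld (v true) →
      CellDone T v i j (wsum T u)) :
    IsHeaviestInducedAncestors (T false) (T true) (v false) (v true) (u false) (u true) where
  ancestor₁ := by obtain ⟨x, hx⟩ := hu; exact (hx false).1
  ancestor₂ := by obtain ⟨x, hx⟩ := hu; exact (hx true).1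
  induced := by obtain ⟨x, hx⟩ := hu; exact ⟨x, (hx false).2, (hx true).2⟩
  heaviest := by
    rintro u₁ u₂ h₁ h₂ ⟨x, hx₁, hx₂⟩
    have key : ∀ {b : Bool} {a : Fin (m b)}, (T b).IsAncestor a (v b) →
        (T b).IsAncestor a ((T b).leaf x) → x ∈ (T b).blk (v b) ((T b).ld a) ∧
        (T b).weight a ≤ min ((T b).weight ((T b).exl x ((T b).ld a)))
          ((T b).weight ((T b).ex (v b) ((T b).ld a))) := fun h h' =>
      ⟨WeightedTree.mem_below.mpr ((WeightedTree.top_isAncestor h).trans h'),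
        le_min (WeightedTree.weight_le_of_isAncestor _ (WeightedTree.isAncestor_ex h'))
          (WeightedTree.weight_le_of_isAncestor _ (WeightedTree.isAncestor_ex h))⟩
    obtain ⟨k1, k2⟩ := key h₁ hx₁
    obtain ⟨k3, k4⟩ := key h₂ hx₂
    exact (add_le_add k2 k4).trans
      (h _ _ ((T false).ld_mono h₁) ((T true).ld_mono h₂) x k1 k3)

theorem answersQueries (H : Spec E T e) :
    AnswersQueries program E.D (T false) (T true) (queryTime n) := by
  intro v₁ v₂
  obtain ⟨v, rfl, rfl⟩ := exists_pair (m := m) false v₁ v₂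
  have hW := H.two_mul_le
  have hW' := H.W_ge
  have hK := E.K_pos
  have hfits := E.fits
  have c : ∀ k ≤ 32, k < 2 ^ w := fun k hk => E.lt_two_pow (by omega)
  have hnum : ∀ k ≤ 1, k < E.D.numWords := by
    intro k hk
    rw [E.numWords_eq]
    have h1 : numTabs * 1 * 1 * E.W ≤ numTabs * E.K * E.K * E.W := by
      gcongr <;> omega
    unfold numTabs at *
    omega
  have hword : ∀ k ≤ 1, (E.D.word k).toNat = E.tab .par 0 0 k := by
    intro k hk
    have := E.word_eq .par 0 0 k hK hK (by omega)
    simpa [addr, Tab.idx] using this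
  set s₀ := State.init E.D (BitVec.ofNat w (v false)) (BitVec.ofNat w (v true)) with hs₀
  have t0 : (BitVec.ofNat w 0).toNat = 0 := by simp
  have t1 : (BitVec.ofNat w 1).toNat = 1 := by simp [Nat.mod_eq_of_lt (c 1 (by omega))]
  have p1 := Exec.const s₀ 102 0
  set s₁ := s₀.setReg 102 (BitVec.ofNat w 0) with hs₁
  have e1 : (s₁.reg 102).toNat = 0 := by rw [hs₁]; simp [State.setReg]
  have p2 := Exec.load s₁ 100 102 (by rw [e1]; exact hnum 0 (by omega))
  rw [e1] at p2
  set s₂ := s₁.setReg 100 (s₁.mem.word 0) with hs₂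
  have p3 := Exec.const s₂ 102 1
  set s₃ := s₂.setReg 102 (BitVec.ofNat w 1) with hs₃
  have e3 : (s₃.reg 102).toNat = 1 := by rw [hs₃]; simp [State.setReg, Nat.mod_eq_of_lt (c 1 (by omega))]
  have p4 := Exec.load s₃ 101 102 (by rw [e3]; exact hnum 1 le_rfl)
  rw [e3] at p4
  set s₄ := s₃.setReg 101 (s₃.mem.word 1) with hs₄
  have hmem : s₄.mem = E.D := rfl
  have hreg : ∀ k < 100, s₄.reg k = s₀.reg k := by
    intro k hk
    simp [hs₄, hs₃, hs₂, hs₁, State.setReg, Function.update_of_ne (show k ≠ 100 by omega),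
      Function.update_of_ne (show k ≠ 101 by omega), Function.update_of_ne (show k ≠ 102 by omega)]
  have hreg0 : ∀ k, 1 < k → s₀.reg k = 0 := by
    intro k hk
    simp [hs₀, State.init, show k ≠ 0 by omega, show k ≠ 1 by omega]
  have hnode : ∀ b, (s₄.reg (Var.s b .node).idx).toNat = v b := by
    intro b
    rw [hreg _ (Var.idx_lt _)]
    cases b
    · have := E.lt_two_pow (x := v false) (by have := node_lt H false (v false); omega)
      simp [hs₀, State.init, Var.idx, SVar.idx, Nat.mod_eq_of_lt this]
    · have := E.lt_two_pow (x := v true) (by have := node_lt H true (v true); omega)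
      simp [hs₀, State.init, Var.idx, SVar.idx, Nat.mod_eq_of_lt this]
  have hrep : Rep E ⟨fun x => (s₄.reg x.idx).toNat, fun _ _ => 0, s₄.wreg⟩ s₄ := by
    refine ⟨fun _ => rfl, ?_, ?_, rfl, rfl, rfl, rfl, fun _ _ => rfl, fun b x hx => ?_⟩
    · rw [← H.par_levels, ← hword 0 (by omega)]
      simp [hs₄, hs₃, hs₂, State.setReg]
      rfl
    · rw [← H.par_width, ← hword 1 le_rfl]
      simp [hs₄, State.setReg]
      rfl
    · show (E.D.word _).toNat = 0
      rw [H.scr b x hx]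
      simp
  obtain ⟨t, s', A', hx, ht, hrep', hscr', u, hu, hout, hdone⟩ := runs_main H (v := v)
    (A := ⟨fun x => (s₄.reg x.idx).toNat, fun _ _ => 0, s₄.wreg⟩) hnode (by
      show (s₄.reg 28).toNat = 0
      rw [hreg _ (by omega), hreg0 _ (by omega)]
      simp) rfl s₄ hrep
  refine ⟨_, s', u false, u true, Exec.seq (p1.seq (p2.seq (p3.seq p4))) hx, ?_, ?_, ?_,
    isHeaviestInducedAncestors_of_cellDone hu hdone, ?_⟩
  · unfold queryTime
    omega
  · rw [← hout false, ← hrep'.reg]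
    rfl
  · rw [← hout true, ← hrep'.reg]
    rfl
  -- Words outside the scratch tables never changed, and those inside are zero again.
  · have hw : s'.mem.word = E.D.word := by
      funext a
      by_cases ha : ∃ b x, x < E.W ∧ a = addr E.K E.W (scrIdx b) 0 0 x
      · obtain ⟨b, x, hx, rfl⟩ := ha
        have := hrep'.scr b x hx
        rw [hscr'] at this
        rw [H.scr b x hx]
        exact BitVec.eq_of_toNat_eq (by simpa using this)
      · exact hrep'.word a fun b x hx h => ha ⟨b, x, hx, h⟩
    have h1 := hrep'.numWords
    have h2 := hrep'.numWeights
    have h3 := hrep'.weight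
    cases hm : s'.mem
    cases hD : E.D
    simp only [hm, hD] at h1 h2 h3 hw
    subst h1 h2 h3 hw
    rfl

end

/-! ### The memory -/

/-- The environment with given tables. -/
noncomputable def Env.ofTables {w : ℕ} (K W : ℕ) (tab : Tab → ℕ → ℕ → ℕ → ℕ) (numWeights : ℕ)
    (weight : ℕ → ℝ) (hK : 0 < K) (fits : numTabs * K * K * W < 2 ^ w)
    (htab : ∀ t i j x, x < W → tab t i j x < 2 ^ w) : Env w where
  D :=
    { numWords := numTabs * K * K * W
      word := fun a => if a / W / K / K < 31 then
        BitVec.ofNat w (tab (Tab.ofIdx (a / W / K / K)) (a / W / K % K) (a / W % K) (a % W)) else 0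
      numWeights := numWeights
      weight := weight }
  K := K
  W := W
  tab := tab
  K_pos := hK
  numWords_eq := rfl
  fits := fits
  word_eq t i j x hi hj hx := by
    have hW : 0 < W := by omega
    have h1 : addr K W t.idx i j x / W = (t.idx * K + i) * K + j := by
      rw [addr, mul_comm, Nat.mul_add_div hW, Nat.div_eq_of_lt hx, add_zero]
    have h2 : ((t.idx * K + i) * K + j) / K = t.idx * K + i := by
      rw [mul_comm, Nat.mul_add_div hK, Nat.div_eq_of_lt hj, add_zero]
    have h3 : (t.idx * K + i) / K = t.idx := by
      rw [mul_comm, Nat.mul_add_div hK, Nat.div_eq_of_lt hi, add_zero]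
    have h4 : addr K W t.idx i j x % W = x := by
      rw [addr, Nat.mul_add_mod_of_lt hx]
    have h5 : ((t.idx * K + i) * K + j) % K = j := Nat.mul_add_mod_of_lt hj
    have h6 : (t.idx * K + i) % K = i := Nat.mul_add_mod_of_lt hi
    simp only [h1, h2, h3, h4, h5, h6, if_pos t.idx_lt, Tab.ofIdx_idx, BitVec.toNat_ofNat]
    exact Nat.mod_eq_of_lt (htab t i j x hx)

theorem Env.ofTables_scr {w : ℕ} {K W : ℕ} {tab : Tab → ℕ → ℕ → ℕ → ℕ} {numWeights : ℕ}
    {weight : ℕ → ℝ} {hK : 0 < K} {fits : numTabs * K * K * W < 2 ^ w}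
    {htab : ∀ t i j x, x < W → tab t i j x < 2 ^ w} (b : Bool) {x : ℕ} (hx : x < W) :
    (Env.ofTables K W tab numWeights weight hK fits htab).D.word (addr K W (scrIdx b) 0 0 x) = 0 := by
  have hW : 0 < W := by omega
  have h1 : addr K W (scrIdx b) 0 0 x / W / K / K = scrIdx b := by
    rw [addr, mul_comm, Nat.mul_add_div hW, Nat.div_eq_of_lt hx, add_zero, add_zero,
      Nat.mul_div_cancel _ hK, add_zero, Nat.mul_div_cancel _ hK]
  simp only [Env.ofTables, h1]
  rw [if_neg]
  simp [scrIdx]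

/-- A maximum point of `f` on `[a, b)`. -/
noncomputable def argMax (f : ℕ → ℝ) (a b : ℕ) : ℕ :=
  if h : (Finset.Ico a b).Nonempty then ((Finset.Ico a b).exists_max_image f h).choose else 0

theorem argMax_spec (f : ℕ → ℝ) {a b : ℕ} (h : a < b) :
    a ≤ argMax f a b ∧ argMax f a b < b ∧ ∀ x, a ≤ x → x < b → f x ≤ f (argMax f a b) := by
  have hne : (Finset.Ico a b).Nonempty := Finset.nonempty_Ico.mpr h
  rw [argMax, dif_pos hne]
  have := ((Finset.Ico a b).exists_max_image f hne).choose_spec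
  rw [Finset.mem_Ico] at this
  exact ⟨this.1.1, this.1.2, fun x hx hx' => this.2 x (Finset.mem_Ico.mpr ⟨hx, hx'⟩)⟩

/-- Slot `x` is the heap leaf `N + x`; the truncated subtractions are exact because of `N ≤ a`. -/
theorem exists_argMax (f : ℕ → ℝ) {N a b : ℕ} (ha : N ≤ a) (h : a < b) :
    a ≤ N + argMax f (a - N) (b - N) ∧ N + argMax f (a - N) (b - N) < b ∧
      ∀ x, a ≤ N + x → N + x < b → f x ≤ f (argMax f (a - N) (b - N)) := by
  obtain ⟨h1, h2, h3⟩ := argMax_spec f (show a - N < b - N by omega)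
  exact ⟨by omega, by omega, fun x hx hx' => h3 x (by omega) (by omega)⟩

/-- A function on nodes as a table. -/
def nodeTab {m : ℕ} (f : Fin m → ℕ) (x : ℕ) : ℕ := if h : x < m then f ⟨x, h⟩ else 0

theorem nodeTab_apply {m : ℕ} (f : Fin m → ℕ) (u : Fin m) : nodeTab f u = f u := by
  simp [nodeTab]

theorem nodeTab_le {m B : ℕ} {f : Fin m → ℕ} (h : ∀ u, f u ≤ B) (x : ℕ) : nodeTab f x ≤ B := by
  unfold nodeTab
  split_ifs
  · exact h _
  · exact Nat.zero_le _

/-- The number of levels. -/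
def numLevels (n : ℕ) : ℕ := Nat.log 2 n + 2

/-- The width of the tables. -/
def width (n : ℕ) : ℕ := 2 ^ (Nat.log 2 n + 5)

theorem mul_le_width (n : ℕ) : 16 * n ≤ width n := by
  have := Nat.lt_pow_succ_log_self (b := 2) (by norm_num) n
  have h : 2 ^ (Nat.log 2 n + 5) = 16 * 2 ^ (Nat.log 2 n).succ := by
    rw [Nat.succ_eq_add_one, pow_succ, pow_add]; ring
  unfold width
  omega

section

variable {w n : ℕ} {m : Bool → ℕ}

/-- The slot of maximal weight below a node of the heap. -/
noncomputable def segSlot (T : ∀ b, WeightedTree n (m b)) (s : ℕ → ∀ b, Fin (m b)) (u : ℕ) : ℕ :=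
  argMax (fun x => wsum T (s x)) (u * 2 ^ (heapDepth n - Nat.log 2 u) - 2 ^ heapDepth n)
    ((u + 1) * 2 ^ (heapDepth n - Nat.log 2 u) - 2 ^ heapDepth n)

/-- The slot of maximal weight below a range of nodes of the heap. -/
noncomputable def sparseSlot (T : ∀ b, WeightedTree n (m b)) (s : ℕ → ∀ b, Fin (m b)) (l k : ℕ) :
    ℕ :=
  argMax (fun x => wsum T (s x)) (l * 2 ^ blockDepth n - 2 ^ heapDepth n)
    ((l + 2 ^ k) * 2 ^ blockDepth n - 2 ^ heapDepth n)

/-- The parameters. -/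
noncomputable def parTab (T : ∀ b, WeightedTree n (m b)) (x : ℕ) : ℕ :=
  if x = 0 then numLevels n else if x = 1 then width n else if x = 2 then m false
  else if x = 3 then 2 ^ heapDepth n else if x = 4 then blockDepth n
  else if x = 5 then sparseDepth n else if x = 6 then (T false).root else (T true).root

theorem parTab_le (T : ∀ b, WeightedTree n (m b)) (x : ℕ) : parTab T x ≤ width n := by
  have h1 := mul_le_width n
  have h2 := (T false).card_nodes_le
  have h3 := (T true).card_nodes_le
  have h4 := (T false).root.2
  have h5 := (T true).root.2
  have h6 : Nat.log 2 n + 5 < width n := Nat.lt_two_pow_self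
  have h7 : 2 ^ heapDepth n ≤ width n := Nat.pow_le_pow_right (by norm_num) (by
    unfold heapDepth; omega)
  have h8 := blockDepth_le n
  have h9 : heapDepth n ≤ Nat.log 2 n + 5 := by unfold heapDepth; omega
  unfold parTab numLevels sparseDepth
  split_ifs <;> omega

/-- The weights of the nodes of both trees. -/
noncomputable def nodeWeight (T : ∀ b, WeightedTree n (m b)) (a : ℕ) : ℝ :=
  if h : a < m false then (T false).weight ⟨a, h⟩
  else if h : a - m false < m true then (T true).weight ⟨a - m false, h⟩ else 0

theorem nodeWeight_apply (T : ∀ b, WeightedTree n (m b)) (b : Bool) (u : Fin (m b)) :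
    nodeWeight T ((if b then m false else 0) + u) = (T b).weight u := by
  cases b
  · simp [nodeWeight]
  · simp [nodeWeight]

/-- Every table entry is at most `width n`, so it fits into a word as soon as the addresses of the
memory do. -/
theorem exists_spec (T : ∀ b, WeightedTree n (m b))
    (fits : numTabs * numLevels n * numLevels n * width n < 2 ^ w) :
    ∃ (E : Env w) (e : ℕ → ℕ → ℕ → ∀ b, Fin (m b)), Spec E T e ∧
      E.D.size = numTabs * numLevels n * numLevels n * width n + (m false + m true) ∧
      E.D.WeightsFrom (T false) (T true) := by
  have hn := (T false).n_pos
  have hW := mul_le_width n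
  have hm : ∀ b, m b ≤ 2 * n := fun b => (T b).card_nodes_le
  have hlog : Nat.log 2 n + 5 < width n := Nat.lt_two_pow_self
  choose sel hsel hsel' using fun b => (T b).exists_select_table (T !b) (width n) (by omega)
  choose loc hloc hloc' using fun b => (T b).exists_locate_table (T !b) (width n) (by omega)
  choose grp hgrp hgrp' using fun b => (T b).exists_group_table (T !b) (width n) (by omega)
  choose bst hbst hbst' using fun b => (T b).exists_best_table (T !b) (width n) (by omega)
  obtain ⟨crs, hcrs, hcrs'⟩ := (T true).exists_cross_table (T false) (width n) (by omega)
  obtain ⟨srt, hsrt, hsrt'⟩ := (T false).exists_start_table (T true) (width n) (by omega)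
  obtain ⟨e₀, he₀⟩ := (T false).exists_slots (T true)
  set e : ℕ → ℕ → ℕ → ∀ b, Fin (m b) :=
    fun i j s b => Bool.rec (e₀ i j s).1 (e₀ i j s).2 b with he
  have hnode : ∀ b (u : Fin (m b)), (u : ℕ) ≤ width n := fun b u => by
    have := hm b
    have := u.2
    omega
  set tab : Tab → ℕ → ℕ → ℕ → ℕ := fun t i j x => match t with
    | .par => parTab T x
    | .cross => crs i j x
    | .start => srt i j x
    | .seg b => e i j (segSlot T (e i j) x) b
    | .sparse b => e i j (sparseSlot T (e i j) (x / sparseDepth n) (x % sparseDepth n)) b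
    | .log => Nat.log 2 x
    | .pow => if x = 0 then 0 else 2 ^ Nat.log 2 x
    | .s b .ex => nodeTab (fun u => ((T b).ex u i : ℕ)) x
    | .s b .sub => nodeTab (fun u => (T b).sub u i) x
    | .s b .lo => nodeTab (fun u => (T b).lo u i) x
    | .s b .hi => nodeTab (fun u => (T b).hi u i) x
    | .s b .pos => nodeTab (fun u => (T b).pos u) x
    | .s b .ld => nodeTab (fun u => (T b).ld u) x
    | .s b .select => sel b i j x
    | .s b .grain => nodeTab (fun u => (T !b).grain u i) x
    | .s b .locate => loc b i j x
    | .s b .group => grp b i j x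
    | .s b .best => bst b i j x with htabdef
  have hpos : ∀ b (u : Fin (m b)), (T b).pos u ≤ width n := fun b u => by
    have := (T b).pos_lt_fin u
    have := (T b).fin_le u
    omega
  have htab : ∀ t i j x, x < width n → tab t i j x ≤ width n := by
    intro t i j x hx
    cases t with
    | par => exact parTab_le T x
    | cross => exact (hcrs _ _ _).le
    | start => exact (hsrt _ _ _).le
    | seg b => exact hnode b _
    | sparse b => exact hnode b _
    | log => exact (Nat.log_le_self 2 x).trans hx.le
    | pow =>
      show (if x = 0 then 0 else 2 ^ Nat.log 2 x) ≤ width n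
      split_ifs with h
      · exact Nat.zero_le _
      · exact (Nat.pow_log_le_self 2 h).trans hx.le
    | s b t =>
      cases t with
      | ex => exact nodeTab_le (fun u => hnode b _) _
      | sub => exact nodeTab_le (fun u => hpos b _) _
      | lo => exact nodeTab_le (fun u => hpos b _) _
      | hi => exact nodeTab_le (fun u => ((T b).fin_le _).trans (by omega)) _
      | pos => exact nodeTab_le (fun u => hpos b _) _
      | ld => exact nodeTab_le (fun u => ((T b).ld_le_log u).trans (by omega)) _
      | select => exact (hsel _ _ _ _).le
      | grain =>
        refine nodeTab_le (fun u => ?_) _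
        unfold WeightedTree.grain
        split_ifs
        · omega
        · exact (Nat.div_le_self _ _).trans ((T !b).card_blk_le.trans (by omega))
      | locate => exact (hloc _ _ _ _).le
      | group => exact (hgrp _ _ _ _).le
      | best => exact (hbst _ _ _ _).le
  have hK : 0 < numLevels n := Nat.succ_pos _
  have hWfit : width n < 2 ^ w := by
    have h1 : numTabs * 1 * 1 * width n ≤ numTabs * numLevels n * numLevels n * width n := by
      gcongr <;> omega
    unfold numTabs at *
    omega
  have hbN := blockDepth_le n
  refine ⟨Env.ofTables (numLevels n) (width n) tab (m false + m true) (nodeWeight T) hK fits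
    (fun t i j x hx => (htab t i j x hx).trans_lt hWfit), e, ?_, rfl, ?_⟩
  · constructor
    case K_eq => rfl
    case W_eq => rfl
    case numWeights => rfl
    case weight => exact nodeWeight_apply T
    case scr => exact fun b x hx => Env.ofTables_scr b hx
    case par_levels => rfl
    case par_width => rfl
    case par_off => rfl
    case par_heap => rfl
    case par_block => rfl
    case par_sparse => rfl
    case par_root => intro b; cases b <;> rfl
    case ex => exact fun b i u => nodeTab_apply (fun u => ((T b).ex u i : ℕ)) u
    case sub => exact fun b i u => nodeTab_apply (fun u => (T b).sub u i) u
    case lo => exact fun b i u => nodeTab_apply (fun u => (T b).lo u i) u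
    case hi => exact fun b i u => nodeTab_apply (fun u => (T b).hi u i) u
    case pos => exact fun b u => nodeTab_apply (fun u => (T b).pos u) u
    case ld => exact fun b u => nodeTab_apply (fun u => (T b).ld u) u
    case grain => exact fun b j u _ => nodeTab_apply (fun u => (T !b).grain u j) u
    case select => exact hsel'
    case locate => exact hloc'
    case group => exact hgrp'
    case best => exact hbst'
    case cross => exact hcrs'
    case start => exact hsrt'
    case slots =>
      intro x i j hi hj u hu hx
      have := he₀ x i j hi hj u hu hx
      exact ⟨congrArg Prod.fst this, congrArg Prod.snd this⟩
    case seg =>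
      intro i j c u hc h1 h2
      -- The level of a heap node is recovered from its logarithm, so `segSlot` does not need it as
      -- an argument.
      have hlogu : Nat.log 2 u = heapDepth n - c := Nat.log_eq_of_pow_le_of_lt_pow h1 h2
      have hce : heapDepth n - Nat.log 2 u = c := by omega
      have hle : 2 ^ heapDepth n ≤ u * 2 ^ c := by
        refine le_trans (le_of_eq ?_) (Nat.mul_le_mul_right _ h1)
        rw [← pow_add]; congr 1; omega
      obtain ⟨k1, k2, k3⟩ := exists_argMax (fun x => wsum T (e i j x)) hle
        (show u * 2 ^ c < (u + 1) * 2 ^ c from Nat.mul_lt_mul_of_pos_right (Nat.lt_succ_self u)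
          (by positivity))
      refine ⟨segSlot T (e i j) u, ?_, ?_, fun b => rfl, fun x hx hx' => ?_⟩
      · rw [segSlot, hce]; exact k1
      · rw [segSlot, hce]; exact k2
      · rw [segSlot, hce]; exact k3 x hx hx'
    case sparse =>
      intro i j l k hk h1 h2
      have hle : 2 ^ heapDepth n ≤ l * 2 ^ blockDepth n := by
        refine le_trans (le_of_eq ?_) (Nat.mul_le_mul_right _ h1)
        rw [← pow_add]; congr 1; omega
      obtain ⟨k1, k2, k3⟩ := exists_argMax (fun x => wsum T (e i j x)) hle
        (show l * 2 ^ blockDepth n < (l + 2 ^ k) * 2 ^ blockDepth n from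
          Nat.mul_lt_mul_of_pos_right (Nat.lt_add_of_pos_right (by positivity)) (by positivity))
      refine ⟨sparseSlot T (e i j) l k, k1, k2, fun b => ?_, k3⟩
      have e1 : (l * sparseDepth n + k) / sparseDepth n = l := by
        rw [mul_comm, Nat.mul_add_div (by omega), Nat.div_eq_of_lt hk, add_zero]
      have e2 : (l * sparseDepth n + k) % sparseDepth n = k := Nat.mul_add_mod_of_lt hk
      show ((e i j (sparseSlot T (e i j) ((l * sparseDepth n + k) / sparseDepth n)
        ((l * sparseDepth n + k) % sparseDepth n)) b : Fin (m b)) : ℕ) = _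
      rw [e1, e2]
    case log => exact fun x _ => rfl
    case pow => exact fun x _ hx => if_neg hx.ne'
  · intro a ha
    have ha : a < m false + m true := ha
    by_cases h : a < m false
    · exact Or.inl ⟨⟨a, h⟩, by simp [Env.ofTables, nodeWeight, h]⟩
    · have h' : a - m false < m true := by omega
      exact Or.inr ⟨⟨a - m false, h'⟩, by simp [Env.ofTables, nodeWeight, h, h']⟩

end

/-! ### Space, time and word length -/

/-- The function `f` is bounded by a multiple of `g`. -/
def Bounded (f g : ℕ → ℕ) : Prop := ∃ C, ∀ n, f n ≤ C * g n

namespace Bounded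

variable {f f' g g' : ℕ → ℕ}

theorem const (c : ℕ) (hg : ∀ n, 1 ≤ g n) : Bounded (fun _ => c) g :=
  ⟨c, fun n => Nat.le_mul_of_pos_right c (hg n)⟩

theorem add (h : Bounded f g) (h' : Bounded f' g) : Bounded (fun n => f n + f' n) g := by
  obtain ⟨C, hC⟩ := h
  obtain ⟨C', hC'⟩ := h'
  exact ⟨C + C', fun n => (Nat.add_le_add (hC n) (hC' n)).trans (le_of_eq (by ring))⟩

theorem mul (h : Bounded f g) (h' : Bounded f' g') :
    Bounded (fun n => f n * f' n) (fun n => g n * g' n) := by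
  obtain ⟨C, hC⟩ := h
  obtain ⟨C', hC'⟩ := h'
  exact ⟨C * C', fun n => (Nat.mul_le_mul (hC n) (hC' n)).trans (le_of_eq (by ring))⟩

theorem mul_const (h : Bounded f g) (c : ℕ) : Bounded (fun n => f n * c) g := by
  obtain ⟨C, hC⟩ := h
  exact ⟨C * c, fun n => (Nat.mul_le_mul_right c (hC n)).trans (le_of_eq (by ring))⟩

theorem of_le (h : ∀ n, f n ≤ g n) : Bounded f g := ⟨1, fun n => (h n).trans (by rw [one_mul])⟩

theorem trans (h : Bounded f g) (h' : ∀ n, g n ≤ g' n) : Bounded f g' := by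
  obtain ⟨C, hC⟩ := h
  exact ⟨C, fun n => (hC n).trans (Nat.mul_le_mul_left C (h' n))⟩

end Bounded

/-- The order of magnitude of the running time. -/
def timeScale (n : ℕ) : ℕ := (Nat.log 2 n + 1) * (blockDepth n + 1)

/-- The loops over levels have `O(log n)` rounds. Only the walk has a body of nonconstant cost, of
order `blockDepth n`; the searches while locating add `O(log n)` in total. -/
theorem bounded_queryTime : Bounded queryTime timeScale := by
  have hl : ∀ n, 1 ≤ Nat.log 2 n + 1 := fun n => Nat.le_add_left _ _
  have hb : ∀ n, 1 ≤ blockDepth n + 1 := fun n => Nat.le_add_left _ _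
  have hlt : ∀ n, Nat.log 2 n + 1 ≤ timeScale n := fun n => Nat.le_mul_of_pos_right _ (hb n)
  have h1 : ∀ n, 1 ≤ timeScale n := fun n => (hl n).trans (hlt n)
  have log1 : Bounded (fun n => Nat.log 2 n + 1) (fun n => Nat.log 2 n + 1) :=
    Bounded.of_le fun _ => le_rfl
  have log2 : Bounded (fun n => 2 * Nat.log 2 n) (fun n => Nat.log 2 n + 1) :=
    ⟨2, fun n => by dsimp only; omega⟩
  have range : Bounded rangeTime (fun n => blockDepth n + 1) := by
    unfold rangeTime
    exact (Bounded.const _ hb).add ((((Bounded.of_le fun n => Nat.le_succ _).mul_const _).add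
      (Bounded.const _ hb)).add (Bounded.const _ hb))
  have step : Bounded (fun n => 1 + stepTime n) (fun n => blockDepth n + 1) := by
    unfold stepTime cellTime
    exact (Bounded.const _ hb).add ((Bounded.const _ hb).add (((Bounded.const _ hb).add
      ((Bounded.const _ hb).add (range.add (Bounded.const _ hb)))).add (Bounded.const _ hb)))
  have walk : Bounded walkTime timeScale := by
    unfold walkTime
    exact (Bounded.const _ h1).add (((log2.add (Bounded.const _ hl)).mul step).add
      (Bounded.const _ h1))
  have locate : ∀ b, Bounded (fun n => locateTime n b) timeScale := fun b => by
    unfold locateTime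
    exact (Bounded.const _ h1).add ((((log1.mul_const _).trans hlt).add
      ((log2.mul_const _).trans hlt)).add (Bounded.const _ h1))
  have erase : ∀ b, Bounded (fun n => eraseTime n b) timeScale := fun b => by
    unfold eraseTime
    exact (Bounded.const _ h1).add (((log1.mul_const _).trans hlt).add (Bounded.const _ h1))
  unfold queryTime
  exact (Bounded.const _ h1).add ((Bounded.const _ h1).add ((locate _).add ((locate _).add
    (walk.add ((erase _).add ((erase _).add (Bounded.const _ h1)))))))

/-- The space. -/
def space (n : ℕ) : ℕ := numTabs * numLevels n * numLevels n * width n + 4 * n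

/-- The word length. -/
def wordLength (n : ℕ) : ℕ := Nat.log 2 (space n) + 1

theorem natLog_two_le {n : ℕ} : (Nat.log 2 n : ℝ) ≤ 2 * Real.log n := by
  have h1 := Real.natLog_le_logb n 2
  have h2 : (0.5 : ℝ) < Real.log 2 := by have := Real.log_two_gt_d9; linarith
  refine h1.trans ?_
  rw [Real.logb, Nat.cast_two, div_le_iff₀ (by linarith)]
  have h3 : 0 ≤ Real.log n := Real.log_natCast_nonneg n
  nlinarith

theorem eventually_le_log (c : ℝ) : ∀ᶠ n : ℕ in atTop, c ≤ Real.log n :=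
  (Real.tendsto_log_atTop.comp tendsto_natCast_atTop_atTop).eventually_ge_atTop c

theorem space_le {n : ℕ} (h : 1 ≤ Real.log n) : (space n : ℝ) ≤ 16900 * (n * Real.log n ^ 2) := by
  have hn : 0 < n := by
    rcases Nat.eq_zero_or_pos n with rfl | h'
    · norm_num at h
    · exact h'
  have h1 : (numLevels n : ℝ) ≤ 4 * Real.log n := by
    have := natLog_two_le (n := n)
    unfold numLevels
    push_cast
    linarith
  have h2 : (width n : ℝ) ≤ 32 * n := by
    have : width n ≤ 32 * n := by
      have := Nat.pow_log_le_self 2 hn.ne'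
      unfold width
      rw [pow_add]
      omega
    exact_mod_cast this
  have h3 : (numLevels n : ℝ) * numLevels n ≤ (4 * Real.log n) * (4 * Real.log n) :=
    mul_le_mul h1 h1 (Nat.cast_nonneg _) (by linarith)
  have h4 : (numLevels n : ℝ) * numLevels n * width n
      ≤ (4 * Real.log n) * (4 * Real.log n) * (32 * n) :=
    mul_le_mul h3 h2 (Nat.cast_nonneg _) (by positivity)
  have h5 : (n : ℝ) ≤ n * Real.log n ^ 2 := by
    have : (1 : ℝ) ≤ Real.log n ^ 2 := by nlinarith
    have hn' : (0 : ℝ) ≤ n := Nat.cast_nonneg n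
    nlinarith
  -- `33` tables, two factors `4 * Real.log n` for the levels and the width `32 * n` give `16896`;
  -- the weights add `4`.
  unfold space numTabs
  push_cast
  nlinarith

theorem isBigO_space : (fun n : ℕ => (space n : ℝ)) =O[atTop] fun n : ℕ => (n : ℝ) * Real.log n ^ 2 := by
  refine IsBigO.of_bound 16900 ?_
  filter_upwards [eventually_le_log 1] with n hn
  rw [Real.norm_of_nonneg (Nat.cast_nonneg _), Real.norm_of_nonneg (by positivity)]
  exact space_le hn

theorem isBigO_wordLength : (fun n : ℕ => (wordLength n : ℝ)) =O[atTop] fun n : ℕ => Real.log n := by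
  -- Twice the logarithm of `16900 * (n * Real.log n ^ 2)`, plus one: with `Real.log (Real.log n) ≤
  -- Real.log n` and `1 ≤ Real.log n`, the terms other than `Real.log 16900` contribute `2 + 4 + 1`.
  refine IsBigO.of_bound (2 * Real.log 16900 + 7) ?_
  filter_upwards [eventually_le_log 1] with n hn
  rw [Real.norm_of_nonneg (Nat.cast_nonneg _), Real.norm_of_nonneg (by linarith)]
  have hn0 : (0 : ℝ) < n := by
    rcases Nat.eq_zero_or_pos n with rfl | h'
    · norm_num at hn
    · exact_mod_cast h'
  have h1 := natLog_two_le (n := space n)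
  have hs : (0 : ℝ) < space n := by
    have : 0 < space n := by
      have : 0 < n := by exact_mod_cast hn0
      unfold space
      omega
    exact_mod_cast this
  have h2 := Real.log_le_log hs (space_le hn)
  rw [Real.log_mul (by norm_num) (by positivity), Real.log_mul (by positivity) (by positivity),
    Real.log_pow] at h2
  have h3 := Real.log_le_self (x := Real.log n) (by linarith)
  have h4 : 0 ≤ Real.log 16900 := Real.log_nonneg (by norm_num)
  unfold wordLength
  push_cast at h2 ⊢
  nlinarith

theorem isBigO_queryTime :
    (fun n : ℕ => (queryTime n : ℝ)) =O[atTop] fun n : ℕ => Real.log n * Real.log (Real.log n) := by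
  obtain ⟨C, hC⟩ := bounded_queryTime
  -- The factor is `4 * 6`, from the bounds on `Nat.log 2 n + 1` and on `blockDepth n + 1`.
  refine IsBigO.of_bound (C * 24) ?_
  -- From `4` on, `Real.log n` is at least `Real.exp 1` and its square is at least `2 * Real.log n +
  -- 5`, which bounds `sparseDepth n`.
  filter_upwards [eventually_le_log 4] with n hn
  have hll : 1 ≤ Real.log (Real.log n) := by
    rw [Real.le_log_iff_exp_le (by linarith)]
    have := Real.exp_one_lt_d9
    linarith
  rw [Real.norm_of_nonneg (Nat.cast_nonneg _), Real.norm_of_nonneg (by positivity)]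
  have h1 : (Nat.log 2 n : ℝ) + 1 ≤ 4 * Real.log n := by
    have := natLog_two_le (n := n)
    linarith
  have h2 : ((blockDepth n : ℕ) : ℝ) + 1 ≤ 6 * Real.log (Real.log n) := by
    have k1 := natLog_two_le (n := sparseDepth n)
    have k2 : ((sparseDepth n : ℕ) : ℝ) ≤ Real.log n ^ 2 := by
      have := natLog_two_le (n := n)
      unfold sparseDepth
      push_cast
      nlinarith
    have k3 : (0 : ℝ) < sparseDepth n := by
      unfold sparseDepth
      positivity
    have k4 := Real.log_le_log k3 k2
    rw [Real.log_pow] at k4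
    unfold blockDepth
    push_cast at k4 ⊢
    linarith
  have h3 : (queryTime n : ℝ) ≤ C * timeScale n := by exact_mod_cast hC n
  refine h3.trans ?_
  rw [mul_assoc]
  refine mul_le_mul_of_nonneg_left ?_ (Nat.cast_nonneg C)
  unfold timeScale
  push_cast
  calc ((Nat.log 2 n : ℝ) + 1) * ((blockDepth n : ℕ) + 1)
      ≤ (4 * Real.log n) * (6 * Real.log (Real.log n)) :=
        mul_le_mul h1 h2 (by positivity) (by linarith)
    _ = 24 * (Real.log n * Real.log (Real.log n)) := by ring

end HIA

/-- There are one query program, a space bound `S(n) = O(n log² n)`, a time bound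
`t(n) = O(log n log log n)` and a word length `L(n) = O(log n)` such that any two weighted trees on the
same `n` leaves can be stored in `S(n)` memory cells, for words of `L(n)` (or more) bits, so that the
program finds a pair of heaviest induced ancestors of any two given nodes in `t(n)` steps. -/
theorem theorem2 :
    ∃ (p : HIA.Prog) (S t L : ℕ → ℕ),
      (fun n : ℕ => (S n : ℝ)) =O[atTop] (fun n : ℕ => (n : ℝ) * Real.log n ^ 2) ∧
      (fun n : ℕ => (t n : ℝ)) =O[atTop] (fun n : ℕ => Real.log n * Real.log (Real.log n)) ∧
      (fun n : ℕ => (L n : ℝ)) =O[atTop] (fun n : ℕ => Real.log n) ∧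
      ∀ (n m₁ m₂ : ℕ) (T₁ : HIA.WeightedTree n m₁) (T₂ : HIA.WeightedTree n m₂) (w : ℕ), L n ≤ w →
        ∃ D : HIA.Storage w, D.size ≤ S n ∧ D.WeightsFrom T₁ T₂ ∧
          HIA.AnswersQueries p D T₁ T₂ (t n) := by
  refine ⟨HIA.Query.program, HIA.space, HIA.queryTime, HIA.wordLength, HIA.isBigO_space,
    HIA.isBigO_queryTime, HIA.isBigO_wordLength, fun n m₁ m₂ T₁ T₂ w hw => ?_⟩
  have hfits : HIA.space n < 2 ^ w :=
    (Nat.lt_pow_succ_log_self (by norm_num) _).trans_le (Nat.pow_le_pow_right (by norm_num) hw)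
  -- The two trees become a family over `Bool`, so that one argument serves both sides.
  obtain ⟨E, e, H, hsize, hw⟩ := HIA.exists_spec (w := w) (m := fun b => cond b m₂ m₁)
    (@Bool.rec (fun b => HIA.WeightedTree n (cond b m₂ m₁)) T₁ T₂)
    ((Nat.le_add_right _ _).trans_lt hfits)
  refine ⟨E.D, ?_, hw, HIA.answersQueries H⟩
  have h1 := T₁.card_nodes_le
  have h2 := T₂.card_nodes_le
  rw [hsize]
  simp only [cond_false, cond_true, HIA.space]
  omega
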